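/- Multivalued functions of $z\neq 0$ are regarded as functions on the Riemann surface of the logarithm, with $z^{s}=\exp(s(\log|z|+i\arg z))$, $\arg z\in\mathbb{R}$. For $n\ge 0$ and $\nu\in\mathbb{C}$ put $$a_n(\nu)=\frac{(4\nu^2-1^2)(4\nu^2-3^2)\cdots(4\nu^2-(2n-1)^2)}{8^n\,n!},\qquad \omega=z-\tfrac{\pi}{2}\nu-\tfrac{\pi}{4}.$$ Let $J_\nu$, $Y_\nu$ be the Bessel functions and $K_\nu$ the modified Bessel function. Define the remainder $R_N^{(K)}(z,\nu)$, for integers $N\ge 0$, by $$K_\nu(z)=\Big(\frac{\pi}{2z}\Big)^{1/2}e^{-z}\Big(\sum_{n=0}^{N-1}\frac{a_n(\nu)}{z^n}+R_N^{(K)}(z,\nu)\Big),$$ and the remainders $R_{2N}^{(J)}(z,\nu)$ and $R_{2M+1}^{(J)}(z,\nu)$, for integers $N,M\ge 0$, by requiring that, with $$P=\sum_{n=0}^{N-1}(-1)^n\frac{a_{2n}(\nu)}{z^{2n}}+R_{2N}^{(J)}(z,\nu),\qquad Q=\sum_{m=0}^{M-1}(-1)^m\frac{a_{2m+1}(\nu)}{z^{2m+1}}-R_{2M+1}^{(J)}(z,\nu),$$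 one has $$J_\nu(z)=\Big(\frac{2}{\pi z}\Big)^{1/2}(P\cos\omega-Q\sin\omega),\qquad Y_\nu(z)=\Big(\frac{2}{\pi z}\Big)^{1/2}(P\sin\omega+Q\cos\omega).$$ Let $\Lambda_p(w)=w^pe^w\Gamma(1-p,w)$ and $\Pi_p(w)=\frac12\big(\Lambda_p(we^{\frac{\pi}{2}i})+\Lambda_p(we^{-\frac{\pi}{2}i})\big)$, where $\Gamma(s,w)=\int_w^{\infty}t^{s-1}e^{-t}\,dt$ is the (multivalued) incomplete gamma function, and let $\mathbf{F}(a,b;c;w)$ be the regularized hypergeometric function, i.e. $\sum_{n\ge 0}\frac{(a)_n(b)_n}{\Gamma(c+n)\,n!}w^n$ for $|w|<1$, continued analytically to $\mathbb{C}\setminus[1,\infty)$. **Theorem.** Let $N\ge 0$ be an integer and let $\nu,\lambda$ be complex numbers with $|\Re\nu|<N+\frac12$ and $\Re\lambda>0$. Then $$R_N^{(K)}(z,\nu)=(-1)^N\frac{\cos(\pi\nu)}{\pi}\frac{\Gamma(N+\lambda)}{2^N}\frac{1}{z^N}\int_0^{+\infty}\frac{t^{\lambda-1}}{(1+t)^{N+\lambda}}\mathbf{F}\big(\nu+\tfrac12,-\nu+\tfrac12;\lambda;-t\big)\Lambda_{N+\lambda}\big(2z(1+t)\big)\,dt$$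 provided $|\arg z|<\frac{3\pi}{2}$, and $$R_N^{(J)}(z,\nu)=(-1)^{\lfloor N/2\rfloor}\frac{\cos(\pi\nu)}{\pi}\frac{\Gamma(N+\lambda)}{2^N}\frac{1}{z^N}\int_0^{+\infty}\frac{t^{\lambda-1}}{(1+t)^{N+\lambda}}\mathbf{F}\big(\nu+\tfrac12,-\nu+\tfrac12;\lambda;-t\big)\Pi_{N+\lambda}\big(2z(1+t)\big)\,dt$$ provided $|\arg z|<\pi$, both integrals being absolutely convergent. -/

import Mathlib

/-!
Points of the Riemann surface of the logarithm.  A nonzero `z` together with a choice of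
`arg z ∈ ℝ` is given by `ζ = log |z| + i arg z : ℂ`, so that `z = exp ζ` and `arg z = ζ.im`;
multiplying `z` by `e^{iα}` is `ζ + α i`, and multiplying it by a real `x > 0` is `ζ + Real.log x`.
All multivalued functions of `z` below are functions of `ζ`.
-/

namespace BesselRemainder

open Complex

noncomputable section

/-- The coefficients `a_n(ν) = (4ν² - 1²)(4ν² - 3²) ⋯ (4ν² - (2n-1)²) / (8ⁿ n!)`. -/
def a (n : ℕ) (ν : ℂ) : ℂ :=
  (∏ k ∈ Finset.range n, (4 * ν ^ 2 - (2 * (k : ℂ) + 1) ^ 2)) / (8 ^ n * (n.factorial : ℂ))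

/-- The Bessel function `J_ν(z) = (z/2)^ν ∑ₖ (-1)ᵏ (z/2)^{2k} / (k! Γ(ν+k+1))`, at `z = exp ζ`. -/
def besselJ (ν ζ : ℂ) : ℂ :=
  exp (ν * (ζ - Real.log 2)) *
    ∑' k : ℕ, (-1) ^ k * (exp ζ / 2) ^ (2 * k) / ((k.factorial : ℂ) * Gamma (ν + k + 1))

/-- The modified Bessel function `I_ν(z) = (z/2)^ν ∑ₖ (z/2)^{2k} / (k! Γ(ν+k+1))`,
at `z = exp ζ`. -/
def besselI (ν ζ : ℂ) : ℂ :=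
  exp (ν * (ζ - Real.log 2)) *
    ∑' k : ℕ, (exp ζ / 2) ^ (2 * k) / ((k.factorial : ℂ) * Gamma (ν + k + 1))

open Classical in
/-- The Bessel function `Y_ν(z) = (J_ν(z) cos(πν) - J_{-ν}(z)) / sin(πν)`, at `z = exp ζ`;
for integer `ν`, the limit of this quotient. -/
def besselY (ν ζ : ℂ) : ℂ :=
  let q : ℂ → ℂ := fun μ =>
    (besselJ μ ζ * cos (Real.pi * μ) - besselJ (-μ) ζ) / sin (Real.pi * μ)
  if ∃ n : ℤ, ν = n then Filter.limUnder (nhdsWithin ν {ν}ᶜ) q else q ν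

open Classical in
/-- The modified Bessel function `K_ν(z) = (π/2) (I_{-ν}(z) - I_ν(z)) / sin(πν)`, at `z = exp ζ`;
for integer `ν`, the limit of this quotient. -/
def besselK (ν ζ : ℂ) : ℂ :=
  let q : ℂ → ℂ := fun μ =>
    (Real.pi / 2) * (besselI (-μ) ζ - besselI μ ζ) / sin (Real.pi * μ)
  if ∃ n : ℤ, ν = n then Filter.limUnder (nhdsWithin ν {ν}ᶜ) q else q ν

/-- The remainder `R_N^{(K)}(z,ν)`, at `z = exp ζ`, defined by
`K_ν(z) = (π/(2z))^{1/2} e^{-z} (∑_{n<N} a_n(ν)/zⁿ + R_N^{(K)}(z,ν))`. -/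
def RK (N : ℕ) (ν ζ : ℂ) : ℂ :=
  besselK ν ζ / ((Real.sqrt (Real.pi / 2) : ℂ) * exp (-(ζ / 2)) * exp (-exp ζ)) -
    ∑ n ∈ Finset.range N, a n ν / exp ζ ^ n

/-- `ω = z - πν/2 - π/4`, at `z = exp ζ`. -/
def omega (ν ζ : ℂ) : ℂ := exp ζ - Real.pi / 2 * ν - Real.pi / 4

/-- The factor `(2/(πz))^{1/2}`, at `z = exp ζ`. -/
def amp (ζ : ℂ) : ℂ := (Real.sqrt (2 / Real.pi) : ℂ) * exp (-(ζ / 2))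

/-- Hankel's function `P`, where `J_ν = (2/(πz))^{1/2} (P cos ω - Q sin ω)` and
`Y_ν = (2/(πz))^{1/2} (P sin ω + Q cos ω)`. -/
def hankelP (ν ζ : ℂ) : ℂ :=
  (besselJ ν ζ * cos (omega ν ζ) + besselY ν ζ * sin (omega ν ζ)) / amp ζ

/-- Hankel's function `Q`, where `J_ν = (2/(πz))^{1/2} (P cos ω - Q sin ω)` and
`Y_ν = (2/(πz))^{1/2} (P sin ω + Q cos ω)`. -/
def hankelQ (ν ζ : ℂ) : ℂ :=
  (besselY ν ζ * cos (omega ν ζ) - besselJ ν ζ * sin (omega ν ζ)) / amp ζ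

/-- The remainders `R_N^{(J)}(z,ν)`, at `z = exp ζ`: with Hankel's `P` and `Q`,
`P = ∑_{n<N} (-1)ⁿ a_{2n}(ν)/z^{2n} + R_{2N}^{(J)}` and
`Q = ∑_{m<M} (-1)ᵐ a_{2m+1}(ν)/z^{2m+1} - R_{2M+1}^{(J)}`. -/
def RJ (N : ℕ) (ν ζ : ℂ) : ℂ :=
  if Even N then
    hankelP ν ζ - ∑ n ∈ Finset.range (N / 2), (-1) ^ n * (a (2 * n) ν / exp ζ ^ (2 * n))
  else
    (∑ m ∈ Finset.range (N / 2), (-1) ^ m * (a (2 * m + 1) ν / exp ζ ^ (2 * m + 1))) - hankelQ ν ζ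

theorem amp_ne_zero (ζ : ℂ) : amp ζ ≠ 0 := by
  unfold amp
  refine mul_ne_zero ?_ (exp_ne_zero _)
  have : 0 < Real.sqrt (2 / Real.pi) := Real.sqrt_pos.mpr (div_pos two_pos Real.pi_pos)
  exact_mod_cast this.ne'

/-- The remainders `RJ` satisfy the large-`z` expansion of `J_ν`, for all truncations. -/
theorem besselJ_eq_expansion (N M : ℕ) (ν ζ : ℂ) :
    besselJ ν ζ = amp ζ *
      (cos (omega ν ζ) *
          ((∑ n ∈ Finset.range N, (-1) ^ n * (a (2 * n) ν / exp ζ ^ (2 * n))) + RJ (2 * N) ν ζ) -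
        sin (omega ν ζ) *
          ((∑ m ∈ Finset.range M, (-1) ^ m * (a (2 * m + 1) ν / exp ζ ^ (2 * m + 1))) -
            RJ (2 * M + 1) ν ζ)) := by
  have h1 : RJ (2 * N) ν ζ = hankelP ν ζ -
      ∑ n ∈ Finset.range N, (-1) ^ n * (a (2 * n) ν / exp ζ ^ (2 * n)) := by
    simp [RJ]
  have h2 : RJ (2 * M + 1) ν ζ =
      (∑ m ∈ Finset.range M, (-1) ^ m * (a (2 * m + 1) ν / exp ζ ^ (2 * m + 1))) -
        hankelQ ν ζ := by
    have h : (2 * M + 1) / 2 = M := by omega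
    simp [RJ, h]
  have h3 := sin_sq_add_cos_sq (omega ν ζ)
  have h4 := amp_ne_zero ζ
  rw [h1, h2, add_sub_cancel, sub_sub_cancel, hankelP, hankelQ]
  field_simp
  linear_combination (-besselJ ν ζ) * h3

/-- The remainders `RJ` satisfy the large-`z` expansion of `Y_ν`, for all truncations. -/
theorem besselY_eq_expansion (N M : ℕ) (ν ζ : ℂ) :
    besselY ν ζ = amp ζ *
      (sin (omega ν ζ) *
          ((∑ n ∈ Finset.range N, (-1) ^ n * (a (2 * n) ν / exp ζ ^ (2 * n))) + RJ (2 * N) ν ζ) +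
        cos (omega ν ζ) *
          ((∑ m ∈ Finset.range M, (-1) ^ m * (a (2 * m + 1) ν / exp ζ ^ (2 * m + 1))) -
            RJ (2 * M + 1) ν ζ)) := by
  have h1 : RJ (2 * N) ν ζ = hankelP ν ζ -
      ∑ n ∈ Finset.range N, (-1) ^ n * (a (2 * n) ν / exp ζ ^ (2 * n)) := by
    simp [RJ]
  have h2 : RJ (2 * M + 1) ν ζ =
      (∑ m ∈ Finset.range M, (-1) ^ m * (a (2 * m + 1) ν / exp ζ ^ (2 * m + 1))) -
        hankelQ ν ζ := by
    have h : (2 * M + 1) / 2 = M := by omega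
    simp [RJ, h]
  have h3 := sin_sq_add_cos_sq (omega ν ζ)
  have h4 := amp_ne_zero ζ
  rw [h1, h2, add_sub_cancel, sub_sub_cancel, hankelP, hankelQ]
  field_simp
  linear_combination (-besselY ν ζ) * h3

/-- The (upper) incomplete gamma function `Γ(s,w) = ∫_w^∞ t^{s-1} e^{-t} dt`, at `w = exp ζ`.
The path on the Riemann surface of the logarithm first follows the circle `|t| = |w|`
from `w` to the point `|w|` with argument `0`, and then the positive real axis. -/
def incGamma (s ζ : ℂ) : ℂ :=
  (∫ t in Set.Ioi (Real.exp ζ.re), (t : ℂ) ^ (s - 1) * exp (-(t : ℂ))) -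
    ∫ θ in (0 : ℝ)..ζ.im, I * exp (s * (ζ.re + θ * I)) * exp (-exp (ζ.re + θ * I))

/-- The basic terminant `Λ_p(w) = w^p e^w Γ(1-p,w)`, at `w = exp ζ`. -/
def Lam (p ζ : ℂ) : ℂ := exp (p * ζ) * exp (exp ζ) * incGamma (1 - p) ζ

/-- The basic terminant `Π_p(w) = (Λ_p(w e^{πi/2}) + Λ_p(w e^{-πi/2})) / 2`, at `w = exp ζ`. -/
def Pit (p ζ : ℂ) : ℂ :=
  (Lam p (ζ + Real.pi / 2 * I) + Lam p (ζ - Real.pi / 2 * I)) / 2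

open Classical in
/-- The regularized hypergeometric function `𝐅(a,b;c;w)`: the analytic continuation, along the
segment from `0` to `w`, of the power series that converges for `|w| < 1`.  This is the principal
branch, for `w ∉ [1,∞)`; the value does not depend on the choice of `f`, by the identity theorem. -/
def hyperF (a b c w : ℂ) : ℂ :=
  if h : ∃ f : ℂ → ℂ, AnalyticOnNhd ℂ f (segment ℝ 0 w) ∧
      f =ᶠ[nhds 0] regularizedGaussHGFun a b c
  then h.choose w else 0

/-- The integrand `t^{λ-1} (1+t)^{-N-λ} 𝐅(ν+1/2, -ν+1/2; λ; -t) T_{N+λ}(2z(1+t))`,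
at `z = exp ζ`, for a terminant `T`. -/
def integrand (T : ℂ → ℂ → ℂ) (N : ℕ) (ν lam ζ : ℂ) (t : ℝ) : ℂ :=
  (t : ℂ) ^ (lam - 1) / ((1 + t : ℝ) : ℂ) ^ ((N : ℂ) + lam) *
    hyperF (ν + 1 / 2) (-ν + 1 / 2) lam (-(t : ℂ)) *
    T ((N : ℂ) + lam) (ζ + (Real.log (2 * (1 + t)) : ℂ))

end

end BesselRemainder

/-!
The proof has three stages: the positive axis with one convenient value of `λ`, the removal of both
restrictions, and the passage from `K_ν` to `J_ν` and `Y_ν`.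

*Independence of `λ`.* At a positive point the terminant is a Stieltjes integral,
`Γ(p) Λ_p(x) = ∫ y^{p-1} e^{-y} (1 + y/x)⁻¹ dy`. Interchanging the integrations turns
`Γ(N+λ)` times the integral of the theorem into an integral of the normalized Laplace transform
`q^λ ∫ t^{λ-1} 𝐅(a,b;λ;-t) e^{-qt} dt` with `a, b = 1/2 ± ν`. Bateman's fractional integral of the
hypergeometric function shows that this transform does not depend on `λ` (`cpow_mul_hgLaplace_eq`),
so `λ` may be taken to be `ν + 1/2`, where `𝐅(a,b;a;-t) = (1+t)^{-b} / Γ(a)`. Bateman's integral also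
provides the continuation of `𝐅` along the negative axis, together with a bound on its growth:
the case `c = a` is explicit, fractional integration raises `c`, and differentiation lowers it
(`exists_isHGContinuation`).

*The case `λ = ν + 1/2`.* Now the integral is the remainder of the binomial series of
`(1 + y/(2z))^{ν-1/2}`, written as a Stieltjes integral (`binomial_remainder`) and integrated against
`y^{ν-1/2} e^{-y}`. This is the remainder in the large-`z` expansion of Poisson's integral
(`rhs_self_eq_poissonIntegral`), so there remains Poisson's formula for `K_ν(z)`, `z > 0`, where `K_ν`
is defined by the power series of `I_{±ν}`. For `-1/2 < Re ν < 0` the Wronskians of Poisson's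
integral with `I_ν` and `I_{-ν}` are constant and can be read off as `z → 0`; with the Wronskian of
`I_ν` and `I_{-ν}` they determine Poisson's integral. Continuation in `ν` gives `Re ν > -1/2`
(`besselSeries_connection`), and a limit gives the integer orders (`besselK_ofReal`).

*Complex `z`.* The terminant is also an integral along a ray of argument `α`, `|α| < π/2`, valid and
bounded for `|arg w - α| ≤ η < π` (`Lam_eq_rayTerminant`, `norm_rayTerminant_le`). With `α` a third of
`arg z` the integral of the theorem is dominated and holomorphic for `|arg z| < 3π/2`, and the
identity theorem applies, because `K_ν` is an entire function of `log z`, for integer `ν` too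
(`differentiable_besselK`). All terms are even in `ν`, so that `Re ν ≥ 0` may be assumed (`RK_eq`).

*The functions `J_ν` and `Y_ν`.* Hankel's `P ± iQ` are, up to elementary factors, the functions
`K_ν(z e^{∓πi/2})`. Hence the remainders for `J_ν` are half the sum, or the difference divided by
`2i`, of the remainders for `K_ν` at the two rotated points (`RJ_even`, `RJ_odd`), just as `Π_p` is
half the sum of the rotated `Λ_p`.
-/

open Complex MeasureTheory Set Filter Topology

namespace BesselRemainder


/-! ### Integrals over the half-line -/

/-- An integral of holomorphic functions is holomorphic when the integrand is dominated; no
hypothesis on the derivative is needed, since Cauchy's estimate bounds it. -/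
theorem differentiableOn_integral_of_dominated {α : Type*} [MeasurableSpace α] {μ : Measure α}
    {U : Set ℂ} (hU : IsOpen U) {F : ℂ → α → ℂ} {bound : α → ℝ}
    (hmeas : ∀ z ∈ U, AEStronglyMeasurable (F z) μ) (hbound : Integrable bound μ)
    (hle : ∀ᵐ x ∂μ, ∀ z ∈ U, ‖F z x‖ ≤ bound x)
    (hdiff : ∀ᵐ x ∂μ, DifferentiableOn ℂ (fun z => F z x) U) :
    DifferentiableOn ℂ (fun z => ∫ x, F z x ∂μ) U := by
  intro z₀ hz₀
  obtain ⟨ε, hε, hball⟩ := Metric.isOpen_iff.1 hU z₀ hz₀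
  have hsub : ∀ z ∈ Metric.ball z₀ (ε / 2), Metric.closedBall z (ε / 4) ⊆ U := by
    intro z hz w hw
    apply hball
    rw [Metric.mem_ball] at hz ⊢
    rw [Metric.mem_closedBall] at hw
    linarith [dist_triangle w z z₀]
  have hderiv : ∀ᵐ x ∂μ, ∀ z ∈ Metric.ball z₀ (ε / 2),
      HasDerivAt (fun z => F z x) (deriv (fun z => F z x) z) z := by
    filter_upwards [hdiff] with x hx z hz
    exact (hx.differentiableAt (hU.mem_nhds
      (hsub z hz (Metric.mem_closedBall_self (by positivity))))).hasDerivAt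
  have hmeas' : AEStronglyMeasurable (fun x => deriv (fun z => F z x) z₀) μ := by
    have hseq : Tendsto (fun n : ℕ => (((ε / 4) / (n + 1) : ℝ) : ℂ)) atTop (𝓝 0) := by
      rw [← Complex.ofReal_zero]
      refine (Complex.continuous_ofReal.tendsto 0).comp ?_
      have h1 := tendsto_one_div_add_atTop_nhds_zero_nat (𝕜 := ℝ)
      have := h1.const_mul (ε / 4)
      simp only [mul_zero] at this
      refine this.congr fun n => ?_
      ring
    have hne : ∀ n : ℕ, (((ε / 4) / (n + 1) : ℝ) : ℂ) ≠ 0 := fun n => by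
      have : (0 : ℝ) < (ε / 4) / (n + 1) := by positivity
      exact_mod_cast this.ne'
    refine aestronglyMeasurable_of_tendsto_ae atTop
      (f := fun (n : ℕ) x => (((ε / 4) / (n + 1) : ℝ) : ℂ)⁻¹ *
        (F (z₀ + ((ε / 4) / (n + 1) : ℝ)) x - F z₀ x)) ?_ ?_
    · intro n
      refine ((hmeas _ ?_).sub (hmeas _ hz₀)).const_mul _
      apply hsub z₀ (Metric.mem_ball_self (by positivity))
      rw [Metric.mem_closedBall, dist_eq_norm, add_sub_cancel_left, Complex.norm_real,
        Real.norm_of_nonneg (by positivity)]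
      apply div_le_self (by positivity)
      have : (0 : ℝ) ≤ n := Nat.cast_nonneg n
      linarith
    · filter_upwards [hderiv] with x hx
      have h2 := (hx z₀ (Metric.mem_ball_self (by positivity))).tendsto_slope_zero
      refine h2.comp (tendsto_nhdsWithin_iff.2 ⟨hseq, Eventually.of_forall fun n => hne n⟩)
  refine (hasDerivAt_integral_of_dominated_loc_of_deriv_le
    (bound := fun x => bound x / (ε / 4)) (F' := fun z x => deriv (fun z => F z x) z)
    (Metric.ball_mem_nhds z₀ (half_pos hε)) ?_ ?_ hmeas' ?_ (hbound.div_const _)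
    hderiv).2.differentiableAt.differentiableWithinAt
  · filter_upwards [hU.mem_nhds hz₀] with z hz using hmeas z hz
  · refine hbound.mono' (hmeas z₀ hz₀) ?_
    filter_upwards [hle] with x hx using hx z₀ hz₀
  · filter_upwards [hle, hdiff] with x hx hdx z hz
    refine norm_deriv_le_of_forall_mem_sphere_norm_le (by positivity) ?_ ?_
    · refine (hdx.mono (hsub z hz)).diffContOnCl_ball subset_rfl
    · intro w hw
      exact hx w (hsub z hz (Metric.sphere_subset_closedBall hw))

/-- The integral of `t^{a-1} e^{-rt}` for complex `r` in the right half-plane. -/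
theorem integral_cpow_mul_exp_neg_mul_Ioi_of_re_pos {a r : ℂ} (ha : 0 < a.re) (hr : 0 < r.re) :
    IntegrableOn (fun t : ℝ => (t : ℂ) ^ (a - 1) * exp (-(r * t))) (Ioi 0) ∧
    ∫ t : ℝ in Ioi 0, (t : ℂ) ^ (a - 1) * exp (-(r * t)) = r ^ (-a) * Gamma a := by
  have hmeas : ∀ r : ℂ, AEStronglyMeasurable (fun t : ℝ => (t : ℂ) ^ (a - 1) * exp (-(r * t)))
      (volume.restrict (Ioi 0)) := by
    intro r
    refine ContinuousOn.aestronglyMeasurable ?_ measurableSet_Ioi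
    refine ContinuousOn.mul (fun t ht => ?_) (by fun_prop)
    exact (continuousAt_ofReal_cpow_const _ _ (Or.inr (ne_of_gt ht))).continuousWithinAt
  have hnorm : ∀ (r : ℂ) (t : ℝ), t ∈ Ioi (0 : ℝ) →
      ‖(t : ℂ) ^ (a - 1) * exp (-(r * t))‖ = t ^ (a.re - 1) * Real.exp (-(r.re * t)) := by
    intro r t ht
    rw [norm_mul, norm_cpow_eq_rpow_re_of_pos ht, Complex.norm_exp]
    simp
  have hint : ∀ q : ℝ, 0 < q → IntegrableOn (fun t : ℝ => t ^ (a.re - 1) * Real.exp (-(q * t)))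
      (Ioi 0) := by
    intro q hq
    have := integrableOn_rpow_mul_exp_neg_mul_rpow (s := a.re - 1) (p := 1) (by linarith) one_pos hq
    simpa using this
  refine ⟨(hint r.re hr).mono' (hmeas r) ?_, ?_⟩
  · filter_upwards [ae_restrict_mem measurableSet_Ioi] with t ht using (hnorm r t ht).le
  have hd : ∀ q : ℝ, 0 < q → DifferentiableOn ℂ
      (fun r : ℂ => ∫ t : ℝ in Ioi 0, (t : ℂ) ^ (a - 1) * exp (-(r * t))) {r | q < r.re} := by
    intro q hq
    refine differentiableOn_integral_of_dominated (isOpen_lt continuous_const continuous_re)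
      (fun r _ => hmeas r) (hint q hq) ?_ ?_
    · filter_upwards [ae_restrict_mem measurableSet_Ioi] with t ht r hr
      rw [hnorm r t ht]
      have ht' : (0 : ℝ) < t := ht
      have hr' : q < r.re := hr
      gcongr
    · refine Eventually.of_forall fun t => ?_
      fun_prop
  have hopen : IsOpen {r : ℂ | 0 < r.re} := isOpen_lt continuous_const continuous_re
  have h1 : AnalyticOnNhd ℂ
      (fun r : ℂ => ∫ t : ℝ in Ioi 0, (t : ℂ) ^ (a - 1) * exp (-(r * t))) {r | 0 < r.re} := by
    refine DifferentiableOn.analyticOnNhd (fun r hr => ?_) hopen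
    have hr' : 0 < r.re := hr
    exact ((hd (r.re / 2) (by linarith)).differentiableAt
      ((isOpen_lt continuous_const continuous_re).mem_nhds
        (by simpa using hr'))).differentiableWithinAt
  have h2 : AnalyticOnNhd ℂ (fun r : ℂ => r ^ (-a) * Gamma a) {r | 0 < r.re} := by
    refine DifferentiableOn.analyticOnNhd (fun r hr => ?_) hopen
    have : r ∈ slitPlane := Or.inl hr
    exact ((differentiableAt_id.cpow_const this).mul_const _).differentiableWithinAt
  have hpre : IsPreconnected {r : ℂ | 0 < r.re} := (convex_halfSpace_re_gt 0).isPreconnected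
  refine h1.eqOn_of_preconnected_of_frequently_eq h2 hpre (z₀ := 1) (by simp) ?_ hr
  have hfreq : ∃ᶠ x : ℝ in 𝓝[≠] 1, 0 < x := by
    apply Eventually.frequently
    exact eventually_nhdsWithin_of_eventually_nhds (lt_mem_nhds one_pos)
  have htend : Tendsto (fun x : ℝ => (x : ℂ)) (𝓝[≠] 1) (𝓝[≠] 1) := by
    refine tendsto_nhdsWithin_iff.2 ⟨?_, ?_⟩
    · exact ((continuous_ofReal.tendsto 1).mono_left nhdsWithin_le_nhds)
    · filter_upwards [self_mem_nhdsWithin] with x hx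
      simpa using hx
  refine htend.frequently (hfreq.mono fun x hx => ?_)
  have := integral_cpow_mul_exp_neg_mul_Ioi ha hx
  rw [this, cpow_neg, one_div, inv_cpow]
  rw [arg_ofReal_of_nonneg hx.le]
  exact Real.pi_pos.ne

theorem integrableOn_rpow_mul_one_add_rpow {α β : ℝ} (hα : 0 < α) (hβ : α < β) :
    IntegrableOn (fun t : ℝ => t ^ (α - 1) * (1 + t) ^ (-β)) (Ioi 0) := by
  have hcont : ContinuousOn (fun t : ℝ => t ^ (α - 1) * (1 + t) ^ (-β)) (Ioi 0) := by
    intro t ht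
    have ht' : (0 : ℝ) < t := ht
    refine ContinuousAt.continuousWithinAt ?_
    refine (Real.continuousAt_rpow_const _ _ (Or.inl ht'.ne')).mul ?_
    exact (continuousAt_const.add continuousAt_id).rpow_const (Or.inl (by simp; linarith))
  rw [← Ioc_union_Ioi_eq_Ioi (zero_le_one' ℝ)]
  refine IntegrableOn.union ?_ ?_
  · have h1 : IntegrableOn (fun t : ℝ => t ^ (α - 1)) (Ioc 0 1) :=
      (intervalIntegrable_iff_integrableOn_Ioc_of_le zero_le_one).1
        (intervalIntegral.intervalIntegrable_rpow' (by linarith))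
    refine h1.mono' ((hcont.mono Ioc_subset_Ioi_self).aestronglyMeasurable measurableSet_Ioc) ?_
    filter_upwards [ae_restrict_mem measurableSet_Ioc] with t ht
    have ht' : (0 : ℝ) < t := ht.1
    rw [Real.norm_of_nonneg (by positivity)]
    apply mul_le_of_le_one_right (by positivity)
    exact Real.rpow_le_one_of_one_le_of_nonpos (by linarith) (by linarith)
  · have h1 : IntegrableOn (fun t : ℝ => t ^ (α - 1 - β)) (Ioi 1) :=
      integrableOn_Ioi_rpow_of_lt (by linarith) one_pos
    have hsub : Ioi (1 : ℝ) ⊆ Ioi 0 := Ioi_subset_Ioi zero_le_one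
    refine h1.mono' ((hcont.mono hsub).aestronglyMeasurable measurableSet_Ioi) ?_
    filter_upwards [ae_restrict_mem measurableSet_Ioi] with t ht
    have ht' : (0 : ℝ) < t := hsub ht
    rw [Real.norm_of_nonneg (by positivity), show α - 1 - β = (α - 1) + -β by ring,
      Real.rpow_add ht']
    have h2 : (1 + t) ^ (-β) ≤ t ^ (-β) :=
      Real.rpow_le_rpow_of_nonpos ht' (by linarith) (by linarith)
    exact mul_le_mul_of_nonneg_left h2 (by positivity)

theorem continuousOn_ofReal_cpow (c : ℂ) : ContinuousOn (fun t : ℝ => (t : ℂ) ^ c) (Ioi 0) :=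
  fun _ ht => (continuousAt_ofReal_cpow_const _ _ (Or.inr (ne_of_gt ht))).continuousWithinAt

/-- Interchanging the order of integration between a kernel and a Laplace integral. -/
theorem integral_mul_laplace_swap {k h : ℝ → ℂ} {q : ℂ} {C : ℝ} (hq : 0 < q.re)
    (hk : ContinuousOn k (Ioi 0)) (hh : ContinuousOn h (Ioi 0)) (hC : ∀ x, 0 < x → ‖h x‖ ≤ C)
    (hint : IntegrableOn (fun t => ‖k t‖ * (1 + t) ^ (-q.re)) (Ioi 0)) :
    ∫ t : ℝ in Ioi 0, k t * ∫ x : ℝ in Ioi 0, (x : ℂ) ^ (q - 1) * exp (-((1 + t) * x)) * h x =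
      ∫ x : ℝ in Ioi 0, (x : ℂ) ^ (q - 1) * exp (-x) * h x *
        ∫ t : ℝ in Ioi 0, k t * exp (-(x * t)) := by
  have hC0 : 0 ≤ C := (norm_nonneg _).trans (hC 1 one_pos)
  set f : ℝ → ℝ → ℂ := fun t x => k t * ((x : ℂ) ^ (q - 1) * exp (-((1 + t) * x)) * h x) with hf
  have hcont : ContinuousOn (Function.uncurry f) (Ioi 0 ×ˢ Ioi 0) := by
    have h1 : ContinuousOn (fun p : ℝ × ℝ => k p.1) (Ioi 0 ×ˢ Ioi 0) :=
      hk.comp continuousOn_fst fun p hp => hp.1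
    have h2 : ContinuousOn (fun p : ℝ × ℝ => (p.2 : ℂ) ^ (q - 1)) (Ioi 0 ×ˢ Ioi 0) :=
      (continuousOn_ofReal_cpow (q - 1)).comp continuousOn_snd fun p hp => hp.2
    have h3 : ContinuousOn (fun p : ℝ × ℝ => h p.2) (Ioi 0 ×ˢ Ioi 0) :=
      hh.comp continuousOn_snd fun p hp => hp.2
    exact h1.mul ((h2.mul (by fun_prop)).mul h3)
  have hmeas : AEStronglyMeasurable (Function.uncurry f)
      ((volume.restrict (Ioi 0)).prod (volume.restrict (Ioi 0))) := by
    rw [Measure.prod_restrict]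
    exact hcont.aestronglyMeasurable (measurableSet_Ioi.prod measurableSet_Ioi)
  have hnorm : ∀ t x : ℝ, 0 < t → 0 < x →
      ‖f t x‖ ≤ (C * ‖k t‖) * (x ^ (q.re - 1) * Real.exp (-((1 + t) * x))) := by
    intro t x ht hx
    simp only [hf, norm_mul, norm_cpow_eq_rpow_re_of_pos hx, Complex.norm_exp]
    have : (-((1 + (t : ℂ)) * x)).re = -((1 + t) * x) := by simp
    rw [this]
    have h1 := hC x hx
    calc _ ≤ ‖k t‖ * (x ^ (q - 1).re * Real.exp (-((1 + t) * x)) * C) := by gcongr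
      _ = _ := by simp; ring
  have hgamma : ∀ t : ℝ, 0 < t → IntegrableOn
      (fun x : ℝ => x ^ (q.re - 1) * Real.exp (-((1 + t) * x))) (Ioi 0) := by
    intro t ht
    have := integrableOn_rpow_mul_exp_neg_mul_rpow (s := q.re - 1) (p := 1) (b := 1 + t)
      (by linarith) one_pos (by linarith)
    simpa only [Real.rpow_one, neg_mul] using this
  have hprod : Integrable (Function.uncurry f)
      ((volume.restrict (Ioi 0)).prod (volume.restrict (Ioi 0))) := by
    rw [integrable_prod_iff hmeas]
    have hslice : ∀ t : ℝ, 0 < t → IntegrableOn (fun x => f t x) (Ioi 0) := by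
      intro t ht
      refine ((hgamma t ht).const_mul (C * ‖k t‖)).mono' ?_ ?_
      · refine ContinuousOn.aestronglyMeasurable ?_ measurableSet_Ioi
        exact hcont.comp (f := fun x : ℝ => (t, x)) (by fun_prop) fun x hx => ⟨ht, hx⟩
      · filter_upwards [ae_restrict_mem measurableSet_Ioi] with x hx using hnorm t x ht hx
    refine ⟨?_, ?_⟩
    · filter_upwards [ae_restrict_mem measurableSet_Ioi] with t ht using hslice t ht
    · refine ((hint.const_mul (C * Real.Gamma q.re))).mono' hmeas.norm.integral_prod_right' ?_
      filter_upwards [ae_restrict_mem measurableSet_Ioi] with t ht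
      have ht' : (0 : ℝ) < t := ht
      rw [Real.norm_of_nonneg (integral_nonneg fun _ => norm_nonneg _)]
      calc ∫ x in Ioi 0, ‖f t x‖
          ≤ ∫ x in Ioi 0, (C * ‖k t‖) * (x ^ (q.re - 1) * Real.exp (-((1 + t) * x))) := by
            refine setIntegral_mono_on (hslice t ht).norm ((hgamma t ht).const_mul _)
              measurableSet_Ioi fun x hx => hnorm t x ht hx
        _ = C * Real.Gamma q.re * (‖k t‖ * (1 + t) ^ (-q.re)) := by
            rw [integral_const_mul, Real.integral_rpow_mul_exp_neg_mul_Ioi hq (by linarith),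
              one_div, Real.inv_rpow (by linarith), Real.rpow_neg (by linarith)]
            ring
  have hswap := integral_integral_swap hprod
  have hleft : ∀ t : ℝ, ∫ x : ℝ in Ioi 0, f t x =
      k t * ∫ x : ℝ in Ioi 0, (x : ℂ) ^ (q - 1) * exp (-((1 + t) * x)) * h x :=
    fun t => integral_const_mul _ _
  simp_rw [← hleft]
  rw [hswap]
  refine setIntegral_congr_fun measurableSet_Ioi fun x _ => ?_
  simp only [hf]
  rw [← integral_const_mul]
  congr 1 with t
  rw [show -((1 + (t : ℂ)) * x) = -x + -(x * t) by ring, exp_add]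
  ring

theorem norm_one_add_cpow {t : ℝ} (ht : 0 < t) (c : ℂ) :
    ‖(1 + t : ℂ) ^ c‖ = (1 + t) ^ c.re := by
  have := norm_cpow_eq_rpow_re_of_pos (show (0 : ℝ) < 1 + t by linarith) c
  rwa [ofReal_add, ofReal_one] at this

/-- Euler's Beta integral over the half-line. -/
theorem integral_cpow_mul_one_add_cpow {u v : ℂ} (hu : 0 < u.re) (hv : 0 < v.re) :
    IntegrableOn (fun t : ℝ => (t : ℂ) ^ (u - 1) * (1 + t) ^ (-(u + v))) (Ioi 0) ∧
    ∫ t : ℝ in Ioi 0, (t : ℂ) ^ (u - 1) * (1 + t) ^ (-(u + v)) =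
      Gamma u * Gamma v / Gamma (u + v) := by
  have huv : 0 < (u + v).re := by simp; linarith
  have hcont : ContinuousOn (fun t : ℝ => (t : ℂ) ^ (u - 1) * (1 + t) ^ (-(u + v))) (Ioi 0) := by
    refine (continuousOn_ofReal_cpow _).mul fun t ht => ?_
    have ht' : (0 : ℝ) < t := ht
    refine ContinuousAt.continuousWithinAt ?_
    refine (continuousAt_const.add continuous_ofReal.continuousAt).cpow continuousAt_const ?_
    left
    simp
    linarith
  have hint := integrableOn_rpow_mul_one_add_rpow hu
    (show u.re < (u + v).re by simp; linarith)
  refine ⟨hint.mono' (hcont.aestronglyMeasurable measurableSet_Ioi) ?_, ?_⟩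
  · filter_upwards [ae_restrict_mem measurableSet_Ioi] with t ht
    rw [norm_mul, norm_cpow_eq_rpow_re_of_pos ht, norm_one_add_cpow ht]
    simp
  have key := integral_mul_laplace_swap (k := fun t : ℝ => (t : ℂ) ^ (u - 1)) (h := fun _ => 1)
    (C := 1) huv (continuousOn_ofReal_cpow _) continuousOn_const (by simp) (by
      refine hint.congr_fun (fun t ht => ?_) measurableSet_Ioi
      simp only [norm_cpow_eq_rpow_re_of_pos ht, sub_re, one_re])
  rw [eq_div_iff (Gamma_ne_zero_of_re_pos huv), ← integral_mul_const]
  calc _ = ∫ t : ℝ in Ioi 0, (t : ℂ) ^ (u - 1) *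
        ∫ x : ℝ in Ioi 0, (x : ℂ) ^ (u + v - 1) * exp (-((1 + t) * x)) * 1 := by
        refine setIntegral_congr_fun measurableSet_Ioi fun t ht => ?_
        have ht' : (0 : ℝ) < t := ht
        simp only [mul_one]
        rw [(integral_cpow_mul_exp_neg_mul_Ioi_of_re_pos huv
          (show 0 < (1 + (t : ℂ)).re by simp; linarith)).2]
        ring
    _ = ∫ x : ℝ in Ioi 0, Gamma u * ((x : ℂ) ^ (v - 1) * exp (-(1 * x))) := by
        rw [key]
        refine setIntegral_congr_fun measurableSet_Ioi fun x hx => ?_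
        have hx' : (0 : ℝ) < x := hx
        have hx0 : (x : ℂ) ≠ 0 := by exact_mod_cast hx'.ne'
        simp only [mul_one]
        rw [(integral_cpow_mul_exp_neg_mul_Ioi_of_re_pos (r := x) hu (by simpa using hx')).2,
          show v - 1 = (u + v - 1) + -u by ring, cpow_add _ _ hx0, one_mul]
        ring
    _ = _ := by
        rw [integral_const_mul, (integral_cpow_mul_exp_neg_mul_Ioi_of_re_pos hv (by simp)).2]
        simp


/-! ### The hypergeometric series -/

/-- The coefficients of the series of the regularized hypergeometric function. -/
noncomputable def hgCoeff (a b c : ℂ) (n : ℕ) : ℂ :=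
  ((ascPochhammer ℂ n).eval a * (ascPochhammer ℂ n).eval b) / (n.factorial * Gamma (c + n))

theorem hasSum_regularizedGaussHGFun (a b c : ℂ) {w : ℂ} (hw : ‖w‖ < 1) :
    HasSum (fun n => hgCoeff a b c n * w ^ n) (regularizedGaussHGFun a b c w) := by
  have hr := radius_regularizedGaussHGFunSeries_ge_one a b c
  have h := (regularizedGaussHGFunSeries a b c).hasFPowerSeriesOnBall (by
    exact lt_of_lt_of_le one_pos hr)
  have hmem : w ∈ Metric.eball (0 : ℂ) (regularizedGaussHGFunSeries a b c).radius := by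
    rw [Metric.mem_eball, edist_zero_right]
    refine lt_of_lt_of_le ?_ hr
    rw [← ofReal_norm, ← ENNReal.ofReal_one]
    exact (ENNReal.ofReal_lt_ofReal_iff one_pos).2 hw
  have hs := h.hasSum hmem
  rw [zero_add] at hs
  refine hs.congr_fun fun n => ?_
  rw [FormalMultilinearSeries.apply_eq_pow_smul_coeff, coeff_regularizedGaussHGFunSeries,
    smul_eq_mul, mul_comm]
  rfl

theorem summable_norm_hgCoeff (a b c : ℂ) {ρ : ℝ} (h0 : 0 ≤ ρ) (h1 : ρ < 1) :
    Summable fun n => ‖hgCoeff a b c n‖ * ρ ^ n := by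
  have h : ‖(ρ : ℂ)‖ < 1 := by rwa [Complex.norm_real, Real.norm_of_nonneg h0]
  have := (hasSum_regularizedGaussHGFun a b c h).summable.norm
  simpa [abs_of_nonneg h0] using this

/-- The relation that lowers the denominator parameter. -/
theorem regularizedGaussHGFun_eq_add_deriv (a b c : ℂ) {w : ℂ} (hw : ‖w‖ < 1 / 2) :
    regularizedGaussHGFun a b c w = c * regularizedGaussHGFun a b (c + 1) w +
      w * deriv (regularizedGaussHGFun a b (c + 1)) w := by
  have hmem : w ∈ Metric.ball (0 : ℂ) (1 / 2) := by simpa using hw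
  have h1 := hasSum_deriv_of_summable_norm (F := fun n (w : ℂ) => hgCoeff a b (c + 1) n * w ^ n)
    (summable_norm_hgCoeff a b (c + 1) (ρ := 1 / 2) (by norm_num) (by norm_num))
    (fun n => by fun_prop) (Metric.isOpen_ball (x := (0 : ℂ)) (ε := 1 / 2)) (fun n w hw => by
      rw [norm_mul, norm_pow]
      have : ‖w‖ ≤ 1 / 2 := (mem_ball_zero_iff.1 hw).le
      gcongr) hmem
  have h2 : deriv (fun w => ∑' n, hgCoeff a b (c + 1) n * w ^ n) w =
      deriv (regularizedGaussHGFun a b (c + 1)) w := by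
    refine Filter.EventuallyEq.deriv_eq ?_
    filter_upwards [Metric.isOpen_ball.mem_nhds hmem] with v hv
    have hv' : ‖v‖ < 1 / 2 := by simpa using hv
    exact (hasSum_regularizedGaussHGFun a b (c + 1) (by linarith)).tsum_eq
  rw [h2] at h1
  have h3 := ((hasSum_regularizedGaussHGFun a b (c + 1) (w := w) (by linarith)).mul_left c).add
    (h1.mul_left w)
  refine (hasSum_regularizedGaussHGFun a b c (w := w) (by linarith)).unique
    (h3.congr_fun fun n => ?_)
  have h4 : deriv (fun w : ℂ => hgCoeff a b (c + 1) n * w ^ n) w =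
      hgCoeff a b (c + 1) n * (n * w ^ (n - 1)) := by simp
  have h5 : w * (n * w ^ (n - 1)) = n * w ^ n := by
    rcases n with _ | n
    · simp
    · simp; ring
  have h6 : hgCoeff a b c n = (c + n) * hgCoeff a b (c + 1) n := by
    have := one_div_Gamma_eq_self_mul_one_div_Gamma_add_one (c + n)
    rw [hgCoeff, hgCoeff, show c + 1 + n = c + n + 1 by ring, div_eq_mul_inv, div_eq_mul_inv,
      mul_inv, mul_inv, this]
    ring
  rw [h4, h6]
  linear_combination (-hgCoeff a b (c + 1) n) * h5

theorem one_sub_cpow_eventuallyEq (a b : ℂ) (ha : 0 < a.re) :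
    (fun w : ℂ => (1 - w) ^ (-b) / Gamma a) =ᶠ[𝓝 0] regularizedGaussHGFun a b a := by
  filter_upwards [Metric.ball_mem_nhds (0 : ℂ) one_pos] with w hw
  have hw' : ‖w‖ < 1 := by simpa using hw
  have h1 := (one_div_one_sub_cpow_hasFPowerSeriesOnBall_zero b).hasSum (y := w) (by
    rw [Metric.mem_eball, edist_zero_right, ← ofReal_norm, ← ENNReal.ofReal_one]
    exact (ENNReal.ofReal_lt_ofReal_iff one_pos).2 hw')
  rw [zero_add, one_div, ← cpow_neg] at h1
  refine (h1.div_const (Gamma a)).unique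
    ((hasSum_regularizedGaussHGFun a b a hw').congr_fun fun n => ?_)
  have hne : ∀ k : ℕ, a ≠ -k := by
    intro k hk
    rw [hk] at ha
    simp at ha
    linarith [Nat.cast_nonneg (α := ℝ) k]
  have hG : Gamma a ≠ 0 := Gamma_ne_zero_of_re_pos ha
  have hGn : Gamma (a + n) ≠ 0 := Gamma_ne_zero_of_re_pos (by simp; positivity)
  have hpoch := Gamma_add_nat_div_Gamma_eq (n := n) a hne
  have hfac := Ring.factorial_nsmul_multichoose_eq_ascPochhammer b n
  rw [Polynomial.ascPochhammer_smeval_eq_eval, Ring.multichoose_eq, nsmul_eq_mul] at hfac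
  have hn : (n.factorial : ℂ) ≠ 0 := by exact_mod_cast n.factorial_ne_zero
  rw [FormalMultilinearSeries.apply_eq_pow_smul_coeff, FormalMultilinearSeries.coeff_ofScalars,
    hgCoeff, ← hfac, ← hpoch, smul_eq_mul]
  field_simp

/-! ### Continuation of the hypergeometric function along the negative axis -/

/-- A neighbourhood of the negative real axis, widening linearly. -/
def negCone (r : ℝ) : Set ℂ := {w | ∃ t : ℝ, 0 ≤ t ∧ ‖w + t‖ < r * (1 + t)}

theorem isOpen_negCone (r : ℝ) : IsOpen (negCone r) := by
  have : negCone r = ⋃ t : {t : ℝ // 0 ≤ t}, {w : ℂ | ‖w + t‖ < r * (1 + t)} := by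
    ext w
    simp [negCone]
  rw [this]
  exact isOpen_iUnion fun t => isOpen_lt (by fun_prop) (by fun_prop)

theorem neg_mem_negCone {r t : ℝ} (hr : 0 < r) (ht : 0 ≤ t) : -(t : ℂ) ∈ negCone r :=
  ⟨t, ht, by simp; positivity⟩

theorem negCone_mono {r s : ℝ} (h : r ≤ s) : negCone r ⊆ negCone s := by
  rintro w ⟨t, ht, hw⟩
  exact ⟨t, ht, hw.trans_le (by gcongr)⟩

theorem mul_mem_negCone {r s : ℝ} {w : ℂ} (hr : 0 < r) (hw : w ∈ negCone r) (h0 : 0 ≤ s)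
    (h1 : s ≤ 1) : w * s ∈ negCone r := by
  obtain ⟨t, ht, hw⟩ := hw
  refine ⟨s * t, by positivity, ?_⟩
  have h2 : w * s + ((s * t : ℝ) : ℂ) = s * (w + t) := by push_cast; ring
  rw [h2, norm_mul, Complex.norm_real, Real.norm_of_nonneg h0]
  rcases h0.eq_or_lt with h | h
  · subst h
    simp [hr]
  · calc s * ‖w + t‖ < s * (r * (1 + t)) := by gcongr
      _ = r * (s + s * t) := by ring
      _ ≤ r * (1 + s * t) := by gcongr

theorem one_add_norm_le_of_mem_negCone {r : ℝ} {w : ℂ} (hr : r ≤ 1 / 2) (hw : w ∈ negCone r) :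
    1 + ‖w‖ ≤ 3 * ‖1 - w‖ := by
  obtain ⟨t, ht, hw⟩ := hw
  have h1 : ‖w + t‖ < 1 / 2 * (1 + t) := hw.trans_le (by gcongr)
  have h2 : ‖w‖ ≤ ‖w + t‖ + t := by
    calc ‖w‖ = ‖(w + t) - t‖ := by ring_nf
      _ ≤ ‖w + t‖ + ‖(t : ℂ)‖ := norm_sub_le _ _
      _ = _ := by rw [Complex.norm_real, Real.norm_of_nonneg ht]
  have h3 : 1 + t ≤ ‖1 - w‖ + ‖w + t‖ := by
    calc 1 + t = ‖((1 + t : ℝ) : ℂ)‖ := by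
          rw [Complex.norm_real, Real.norm_of_nonneg (by positivity)]
      _ = ‖(1 - w) + (w + t)‖ := by congr 1; push_cast; ring
      _ ≤ _ := norm_add_le _ _
  linarith

theorem one_sub_mem_slitPlane_of_mem_negCone {r : ℝ} {w : ℂ} (hr : r ≤ 1 / 2)
    (hw : w ∈ negCone r) : 1 - w ∈ slitPlane := by
  obtain ⟨t, ht, hw⟩ := hw
  left
  have h1 : ‖w + t‖ < 1 / 2 * (1 + t) := hw.trans_le (by gcongr)
  have h2 := (Complex.abs_re_le_norm (w + t)).trans_lt h1
  have h3 := (abs_lt.1 h2).2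
  simp at h3 ⊢
  linarith

/-- `f` continues the hypergeometric series `𝐅(a,b;c;·)` to `negCone r`, with growth of order
at most `κ` at infinity. -/
structure IsHGContinuation (a b c : ℂ) (κ r : ℝ) (f : ℂ → ℂ) : Prop where
  pos : 0 < r
  le_half : r ≤ 1 / 2
  differentiableOn : DifferentiableOn ℂ f (negCone r)
  eventuallyEq : f =ᶠ[𝓝 0] regularizedGaussHGFun a b c
  bound : ∃ C, ∀ w ∈ negCone r, ‖f w‖ ≤ C * (1 + ‖w‖) ^ κ

/-- The function `hyperF` agrees with every continuation on the negative axis. -/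
theorem IsHGContinuation.hyperF_eq {a b c : ℂ} {κ r : ℝ} {f : ℂ → ℂ}
    (h : IsHGContinuation a b c κ r f) {t : ℝ} (ht : 0 ≤ t) :
    hyperF a b c (-(t : ℂ)) = f (-(t : ℂ)) := by
  have hsub : segment ℝ 0 (-(t : ℂ)) ⊆ negCone r := by
    rintro _ ⟨x, y, hx, hy, hxy, rfl⟩
    have : x • (0 : ℂ) + y • (-(t : ℂ)) = -((y * t : ℝ) : ℂ) := by
      simp
    rw [this]
    exact neg_mem_negCone h.pos (by positivity)
  have han : AnalyticOnNhd ℂ f (segment ℝ 0 (-(t : ℂ))) :=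
    (h.differentiableOn.analyticOnNhd (isOpen_negCone r)).mono hsub
  have hex : ∃ f : ℂ → ℂ, AnalyticOnNhd ℂ f (segment ℝ 0 (-(t : ℂ))) ∧
      f =ᶠ[nhds 0] regularizedGaussHGFun a b c := ⟨f, han, h.eventuallyEq⟩
  rw [hyperF, dif_pos hex]
  exact hex.choose_spec.1.eqOn_of_preconnected_of_eventuallyEq han
    (convex_segment _ _).isPreconnected (left_mem_segment ℝ _ _)
    (hex.choose_spec.2.trans h.eventuallyEq.symm) (right_mem_segment ℝ _ _)

theorem IsHGContinuation.mono {a b c : ℂ} {κ κ' r : ℝ} {f : ℂ → ℂ}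
    (h : IsHGContinuation a b c κ r f) (hκ : κ ≤ κ') : IsHGContinuation a b c κ' r f := by
  refine ⟨h.pos, h.le_half, h.differentiableOn, h.eventuallyEq, ?_⟩
  obtain ⟨C, hC⟩ := h.bound
  refine ⟨C, fun w hw => (hC w hw).trans ?_⟩
  have h0 : 0 ≤ C * (1 + ‖w‖) ^ κ := (norm_nonneg _).trans (hC w hw)
  have h1 : 0 < (1 + ‖w‖) ^ κ := by positivity
  have h2 : 0 ≤ C := by
    by_contra hneg
    push Not at hneg
    nlinarith
  gcongr
  linarith [norm_nonneg w]

/-- For `c = a` the hypergeometric function is a power of `1 - w`. -/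
theorem isHGContinuation_one_sub_cpow {a b : ℂ} {κ : ℝ} (ha : 0 < a.re) (hκ : -b.re ≤ κ) :
    IsHGContinuation a b a κ (1 / 2) (fun w => (1 - w) ^ (-b) / Gamma a) := by
  have hbase : IsHGContinuation a b a (-b.re) (1 / 2) (fun w => (1 - w) ^ (-b) / Gamma a) := by
    refine ⟨by norm_num, le_rfl, ?_, one_sub_cpow_eventuallyEq a b ha, ?_⟩
    · intro w hw
      have := one_sub_mem_slitPlane_of_mem_negCone le_rfl hw
      refine DifferentiableAt.differentiableWithinAt ?_
      exact ((by fun_prop : DifferentiableAt ℂ (fun w : ℂ => 1 - w) w).cpow_const this).div_const _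
    · refine ⟨(1 + 3 ^ b.re) * Real.exp (Real.pi * |b.im|) / ‖Gamma a‖, fun w hw => ?_⟩
      have h1 := one_add_norm_le_of_mem_negCone le_rfl hw
      have hw0 : 0 < 1 + ‖w‖ := by positivity
      have h2 : 0 < ‖1 - w‖ := by linarith
      rw [norm_div]
      have h3 : ‖(1 - w) ^ (-b)‖ ≤ ‖1 - w‖ ^ (-b.re) * Real.exp (Real.pi * |b.im|) := by
        refine (norm_cpow_le _ _).trans ?_
        rw [div_eq_mul_inv, ← Real.exp_neg, neg_re, neg_im]
        gcongr
        have := abs_arg_le_pi (1 - w)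
        calc -(arg (1 - w) * -b.im) ≤ |arg (1 - w) * b.im| := by
              rw [mul_neg, neg_neg]; exact le_abs_self _
          _ = |arg (1 - w)| * |b.im| := abs_mul _ _
          _ ≤ _ := by gcongr
      have h4 : ‖1 - w‖ ^ (-b.re) ≤ (1 + 3 ^ b.re) * (1 + ‖w‖) ^ (-b.re) := by
        rcases le_total 0 b.re with hb | hb
        · calc ‖1 - w‖ ^ (-b.re) ≤ ((1 + ‖w‖) / 3) ^ (-b.re) :=
                Real.rpow_le_rpow_of_nonpos (by positivity) (by linarith) (by linarith)
            _ = 3 ^ b.re * (1 + ‖w‖) ^ (-b.re) := by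
                rw [Real.div_rpow hw0.le (by norm_num), Real.rpow_neg (by norm_num : (0 : ℝ) ≤ 3)]
                field_simp
            _ ≤ _ := by gcongr; linarith
        · have h5 : ‖1 - w‖ ≤ 1 + ‖w‖ := by simpa using norm_sub_le (1 : ℂ) w
          calc ‖1 - w‖ ^ (-b.re) ≤ (1 + ‖w‖) ^ (-b.re) :=
                Real.rpow_le_rpow h2.le h5 (by linarith)
            _ = 1 * (1 + ‖w‖) ^ (-b.re) := (one_mul _).symm
            _ ≤ _ := by gcongr; linarith [Real.rpow_pos_of_pos (zero_lt_three' ℝ) b.re]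
      calc _ ≤ ((1 + 3 ^ b.re) * (1 + ‖w‖) ^ (-b.re)) * Real.exp (Real.pi * |b.im|) /
            ‖Gamma a‖ := by
            gcongr
            exact h3.trans (by gcongr)
        _ = _ := by ring
  exact hbase.mono hκ

/-- Lowering the denominator parameter. Cauchy's estimate on discs of radius comparable to
`1 + ‖w‖` shows that `w f'(w)` grows no faster than `f(w)`. -/
theorem IsHGContinuation.lower {a b c : ℂ} {κ r : ℝ} {f : ℂ → ℂ}
    (h : IsHGContinuation a b (c + 1) κ r f) :
    IsHGContinuation a b c κ (r / 4) (fun w => c * f w + w * deriv f w) := by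
  have hr := h.pos
  have hr2 := h.le_half
  have hsub : negCone (r / 4) ⊆ negCone r := negCone_mono (by linarith)
  have hd : DifferentiableOn ℂ (deriv f) (negCone r) :=
    h.differentiableOn.deriv (isOpen_negCone r)
  refine ⟨by linarith, by linarith, ?_, ?_, ?_⟩
  · exact ((h.differentiableOn.const_mul c).add (differentiableOn_id.mul hd)).mono hsub
  · filter_upwards [h.eventuallyEq.eventuallyEq_nhds,
      Metric.ball_mem_nhds (0 : ℂ) (half_pos one_pos)] with w hw hw2
    rw [regularizedGaussHGFun_eq_add_deriv a b c (by simpa using hw2), hw.eq_of_nhds, hw.deriv_eq]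
  · obtain ⟨C, hC⟩ := h.bound
    have hC0 : 0 ≤ C := by
      have := (norm_nonneg _).trans (hC 0 (by simpa using neg_mem_negCone hr le_rfl))
      simpa using this
    set K : ℝ := 4 ^ |κ| with hK
    refine ⟨C * ‖c‖ + 4 * K * C * (2 / r), ?_⟩
    rintro w ⟨t, ht, hw⟩
    set R : ℝ := r / 4 * (1 + t) with hR
    have hRpos : 0 < R := by positivity
    have hwt : |‖w‖ - t| ≤ ‖w + t‖ := by
      have := abs_norm_sub_norm_le w (-(t : ℂ))
      rwa [norm_neg, Complex.norm_real, Real.norm_of_nonneg ht, sub_neg_eq_add] at this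
    have hwt' := abs_le.1 hwt
    have hR8 : R ≤ (1 + t) / 8 := by rw [hR]; nlinarith
    have hsphere : ∀ v ∈ Metric.closedBall w R, v ∈ negCone r ∧
        (1 + ‖v‖) ^ κ ≤ K * (1 + ‖w‖) ^ κ := by
      intro v hv
      rw [Metric.mem_closedBall, dist_eq_norm] at hv
      have hv1 : ‖v + t‖ ≤ ‖v - w‖ + ‖w + t‖ := by
        calc ‖v + t‖ = ‖(v - w) + (w + t)‖ := by ring_nf
          _ ≤ _ := norm_add_le _ _
      have hvw := abs_le.1 ((abs_norm_sub_norm_le v w).trans hv)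
      refine ⟨⟨t, ht, ?_⟩, ?_⟩
      · have : r * (1 + t) = 4 * R := by rw [hR]; ring
        rw [this]
        linarith
      · have hup : 1 + ‖v‖ ≤ 4 * (1 + ‖w‖) := by linarith [norm_nonneg w]
        have hlo : 1 + ‖w‖ ≤ 4 * (1 + ‖v‖) := by linarith [norm_nonneg v]
        have hv0 : 0 < 1 + ‖v‖ := by positivity
        have hw0 : 0 < 1 + ‖w‖ := by positivity
        rcases le_total 0 κ with hk | hk
        · calc (1 + ‖v‖) ^ κ ≤ (4 * (1 + ‖w‖)) ^ κ := Real.rpow_le_rpow hv0.le hup hk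
            _ = _ := by rw [Real.mul_rpow (by norm_num) hw0.le, hK, abs_of_nonneg hk]
        · calc (1 + ‖v‖) ^ κ ≤ ((1 + ‖w‖) / 4) ^ κ :=
                Real.rpow_le_rpow_of_nonpos (by positivity) (by linarith) hk
            _ = _ := by
                rw [Real.div_rpow hw0.le (by norm_num), hK, abs_of_nonpos hk,
                  Real.rpow_neg (by norm_num)]
                field_simp
    have hball : DifferentiableOn ℂ f (Metric.closedBall w R) :=
      h.differentiableOn.mono fun v hv => (hsphere v hv).1
    have hderiv : ‖deriv f w‖ ≤ C * (K * (1 + ‖w‖) ^ κ) / R := by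
      refine norm_deriv_le_of_forall_mem_sphere_norm_le hRpos
        (hball.diffContOnCl_ball subset_rfl) fun v hv => ?_
      obtain ⟨h1, h2⟩ := hsphere v (Metric.sphere_subset_closedBall hv)
      exact (hC v h1).trans (by gcongr)
    have hwR : ‖w‖ ≤ 4 * (2 / r) * R := by
      have : 4 * (2 / r) * R = 2 * (1 + t) := by rw [hR]; field_simp
      rw [this]
      linarith
    calc ‖c * f w + w * deriv f w‖ ≤ ‖c‖ * ‖f w‖ + ‖w‖ * ‖deriv f w‖ := by
          refine (norm_add_le _ _).trans ?_
          rw [norm_mul, norm_mul]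
      _ ≤ ‖c‖ * (C * (1 + ‖w‖) ^ κ) + (4 * (2 / r) * R) * (C * (K * (1 + ‖w‖) ^ κ) / R) := by
          gcongr
          exact hC w (hsub ⟨t, ht, hw⟩)
      _ = _ := by field_simp


/-! ### Fractional integration and the denominator parameter -/

theorem integrableOn_beta {α β : ℝ} (hα : 0 < α) (hβ : 0 < β) :
    IntegrableOn (fun s : ℝ => s ^ (α - 1) * (1 - s) ^ (β - 1)) (Ioo 0 1) := by
  have h := (betaIntegral_convergent (u := α) (v := β) (by simpa using hα) (by simpa using hβ))
  rw [intervalIntegrable_iff_integrableOn_Ioo_of_le zero_le_one] at h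
  refine IntegrableOn.congr_fun h.norm (fun s hs => ?_) measurableSet_Ioo
  have h1 : (0 : ℝ) < 1 - s := by linarith [hs.2]
  have h2 := norm_cpow_eq_rpow_re_of_pos h1 ((β : ℂ) - 1)
  simp only [norm_mul, norm_cpow_eq_rpow_re_of_pos hs.1]
  push_cast at h2
  rw [h2]
  simp

theorem norm_one_sub_cpow {s : ℝ} (hs : s < 1) (c : ℂ) :
    ‖(1 - s : ℂ) ^ c‖ = (1 - s) ^ c.re := by
  have := norm_cpow_eq_rpow_re_of_pos (show (0 : ℝ) < 1 - s by linarith) c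
  rwa [ofReal_sub, ofReal_one] at this

theorem continuousOn_beta (u v : ℂ) :
    ContinuousOn (fun s : ℝ => (s : ℂ) ^ u * (1 - (s : ℂ)) ^ v) (Ioo 0 1) := by
  refine ((continuousOn_ofReal_cpow u).mono fun s hs => hs.1).mul fun s hs => ?_
  refine ContinuousAt.continuousWithinAt ?_
  refine (continuousAt_const.sub continuous_ofReal.continuousAt).cpow continuousAt_const ?_
  left
  simpa using hs.2

/-- Bateman's fractional integral of the hypergeometric series: it raises the denominator
parameter from `c` to `c + μ`. -/
theorem hasSum_bateman {a b c μ w : ℂ} (hc : 0 < c.re) (hμ : 0 < μ.re) (hw : ‖w‖ < 1) :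
    (Gamma μ)⁻¹ * ∫ s : ℝ in Ioo 0 1, (s : ℂ) ^ (c - 1) * (1 - (s : ℂ)) ^ (μ - 1) *
      regularizedGaussHGFun a b c (w * s) = regularizedGaussHGFun a b (c + μ) w := by
  set F : ℕ → ℝ → ℂ := fun n s => (s : ℂ) ^ (c - 1) * (1 - (s : ℂ)) ^ (μ - 1) *
    (hgCoeff a b c n * (w * s) ^ n) with hF
  have hbeta := integrableOn_beta hc hμ
  have hcont : ∀ n, ContinuousOn (F n) (Ioo 0 1) := fun n =>
    (continuousOn_beta _ _).mul (by fun_prop)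
  have hFn : ∀ n, ∀ s ∈ Ioo (0 : ℝ) 1, ‖F n s‖ ≤
      (‖hgCoeff a b c n‖ * ‖w‖ ^ n) * (s ^ (c.re - 1) * (1 - s) ^ (μ.re - 1)) := by
    intro n s hs
    simp only [hF, norm_mul, norm_pow, norm_cpow_eq_rpow_re_of_pos hs.1, norm_one_sub_cpow hs.2,
      Complex.norm_real, Real.norm_of_nonneg hs.1.le, sub_re, one_re]
    have h1 : 0 ≤ s ^ (c.re - 1) * (1 - s) ^ (μ.re - 1) :=
      mul_nonneg (Real.rpow_nonneg hs.1.le _) (Real.rpow_nonneg (by linarith [hs.2]) _)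
    rw [mul_comm]
    refine mul_le_mul_of_nonneg_right ?_ h1
    refine mul_le_mul_of_nonneg_left (pow_le_pow_left₀ ?_ ?_ n) (norm_nonneg _)
    · exact mul_nonneg (norm_nonneg w) hs.1.le
    · exact mul_le_of_le_one_right (norm_nonneg w) hs.2.le
  have hFint : ∀ n, IntegrableOn (F n) (Ioo 0 1) := by
    intro n
    refine (hbeta.const_mul (‖hgCoeff a b c n‖ * ‖w‖ ^ n)).mono'
      ((hcont n).aestronglyMeasurable measurableSet_Ioo) ?_
    filter_upwards [ae_restrict_mem measurableSet_Ioo] with s hs using hFn n s hs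
  have hsum : Summable fun n => ∫ s in Ioo (0 : ℝ) 1, ‖F n s‖ := by
    refine Summable.of_nonneg_of_le (fun n => integral_nonneg fun _ => norm_nonneg _)
      (fun n => ?_) ((summable_norm_hgCoeff a b c (norm_nonneg w) hw).mul_right
        (∫ s in Ioo (0 : ℝ) 1, s ^ (c.re - 1) * (1 - s) ^ (μ.re - 1)))
    rw [← integral_const_mul]
    exact setIntegral_mono_on (hFint n).norm (hbeta.const_mul _) measurableSet_Ioo (hFn n)
  have h1 := hasSum_integral_of_summable_integral_norm hFint hsum
  have h2 : ∫ s in Ioo (0 : ℝ) 1, ∑' n, F n s = ∫ s : ℝ in Ioo 0 1, (s : ℂ) ^ (c - 1) *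
      (1 - (s : ℂ)) ^ (μ - 1) * regularizedGaussHGFun a b c (w * s) := by
    refine setIntegral_congr_fun measurableSet_Ioo fun s hs => ?_
    have hws : ‖w * s‖ < 1 := by
      rw [norm_mul, Complex.norm_real, Real.norm_of_nonneg hs.1.le]
      exact (mul_le_of_le_one_right (norm_nonneg _) hs.2.le).trans_lt hw
    exact ((hasSum_regularizedGaussHGFun a b c hws).mul_left _).tsum_eq
  rw [h2] at h1
  refine (h1.mul_left (Gamma μ)⁻¹).unique ?_
  refine (hasSum_regularizedGaussHGFun a b (c + μ) hw).congr_fun fun n => ?_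
  have hcn : 0 < (c + n).re := by simp; positivity
  have hcμ : 0 < (c + n + μ).re := by rw [add_re]; positivity
  have h3 : ∫ s in Ioo (0 : ℝ) 1, F n s = hgCoeff a b c n * w ^ n * betaIntegral (c + n) μ := by
    rw [betaIntegral, intervalIntegral.integral_of_le zero_le_one, integral_Ioc_eq_integral_Ioo,
      ← integral_const_mul]
    refine setIntegral_congr_fun measurableSet_Ioo fun s hs => ?_
    have hs0 : (s : ℂ) ≠ 0 := by exact_mod_cast hs.1.ne'
    simp only [hF]
    rw [show c + n - 1 = (c - 1) + n by ring, cpow_add _ _ hs0, cpow_natCast]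
    ring
  rw [h3, betaIntegral_eq_Gamma_mul_div _ _ hcn hμ, hgCoeff, hgCoeff,
    show c + μ + n = c + n + μ by ring]
  have g1 := Gamma_ne_zero_of_re_pos hcn
  have g2 := Gamma_ne_zero_of_re_pos hμ
  have g3 := Gamma_ne_zero_of_re_pos hcμ
  have g4 : (n.factorial : ℂ) ≠ 0 := by exact_mod_cast n.factorial_ne_zero
  field_simp

/-- Raising the denominator parameter by a fractional integral. -/
theorem IsHGContinuation.raise {a b c μ : ℂ} {κ r : ℝ} {f : ℂ → ℂ}
    (h : IsHGContinuation a b c κ r f) (hc : 0 < c.re) (hcκ : 0 < c.re + κ) (hμ : 0 < μ.re) :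
    IsHGContinuation a b (c + μ) κ r (fun w => (Gamma μ)⁻¹ *
      ∫ s : ℝ in Ioo 0 1, (s : ℂ) ^ (c - 1) * (1 - (s : ℂ)) ^ (μ - 1) * f (w * s)) := by
  obtain ⟨C, hC⟩ := h.bound
  have hr := h.pos
  have hC0 : 0 ≤ C := by
    have := (norm_nonneg _).trans (hC 0 (by simpa using neg_mem_negCone hr le_rfl))
    simpa using this
  set G : ℝ → ℝ := fun s => s ^ (c.re - 1) * (1 - s) ^ (μ.re - 1) +
    s ^ (c.re + κ - 1) * (1 - s) ^ (μ.re - 1) with hG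
  have hGint : IntegrableOn G (Ioo 0 1) := (integrableOn_beta hc hμ).add (integrableOn_beta hcκ hμ)
  have hmemw : ∀ w ∈ negCone r, ∀ s ∈ Ioo (0 : ℝ) 1, w * s ∈ negCone r := fun w hw s hs =>
    mul_mem_negCone hr hw hs.1.le hs.2.le
  have hbound : ∀ w ∈ negCone r, ∀ s ∈ Ioo (0 : ℝ) 1,
      ‖(s : ℂ) ^ (c - 1) * (1 - (s : ℂ)) ^ (μ - 1) * f (w * s)‖ ≤
        C * (1 + ‖w‖) ^ κ * G s := by
    intro w hw s hs
    have hs0 := hs.1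
    have hs1 : 0 ≤ 1 - s := by linarith [hs.2]
    have h1 : (1 + ‖w * s‖) ^ κ ≤ (1 + s ^ κ) * (1 + ‖w‖) ^ κ := by
      rw [norm_mul, Complex.norm_real, Real.norm_of_nonneg hs0.le]
      have hp : 0 < (1 + ‖w‖) ^ κ := by positivity
      have hq : 0 < s ^ κ := by positivity
      rcases le_total 0 κ with hk | hk
      · calc (1 + ‖w‖ * s) ^ κ ≤ (1 + ‖w‖) ^ κ := by
              refine Real.rpow_le_rpow (by positivity) ?_ hk
              linarith [mul_le_of_le_one_right (norm_nonneg w) hs.2.le]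
          _ ≤ _ := by nlinarith
      · calc (1 + ‖w‖ * s) ^ κ ≤ (s * (1 + ‖w‖)) ^ κ := by
              refine Real.rpow_le_rpow_of_nonpos (by positivity) ?_ hk
              linarith [hs.2]
          _ = s ^ κ * (1 + ‖w‖) ^ κ := Real.mul_rpow hs0.le (by positivity)
          _ ≤ _ := by nlinarith
    rw [norm_mul, norm_mul, norm_cpow_eq_rpow_re_of_pos hs.1, norm_one_sub_cpow hs.2, sub_re,
      sub_re, one_re]
    calc s ^ (c.re - 1) * (1 - s) ^ (μ.re - 1) * ‖f (w * s)‖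
        ≤ s ^ (c.re - 1) * (1 - s) ^ (μ.re - 1) * (C * ((1 + s ^ κ) * (1 + ‖w‖) ^ κ)) := by
          have := Real.rpow_nonneg hs1 (μ.re - 1)
          gcongr
          exact (hC _ (hmemw w hw s hs)).trans (by gcongr)
      _ = _ := by
          rw [hG]
          simp only
          rw [show c.re + κ - 1 = (c.re - 1) + κ by ring, Real.rpow_add hs0]
          ring
  have hcontw : ∀ w ∈ negCone r, ContinuousOn
      (fun s : ℝ => (s : ℂ) ^ (c - 1) * (1 - (s : ℂ)) ^ (μ - 1) * f (w * s)) (Ioo 0 1) := by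
    intro w hw
    refine (continuousOn_beta _ _).mul ?_
    exact h.differentiableOn.continuousOn.comp (by fun_prop) (hmemw w hw)
  refine ⟨hr, h.le_half, ?_, ?_, ?_⟩
  · refine DifferentiableOn.const_mul (fun w₀ hw₀ => ?_) _
    set U := negCone r ∩ Metric.ball 0 (‖w₀‖ + 1) with hU
    have hUo : IsOpen U := (isOpen_negCone r).inter Metric.isOpen_ball
    have hw₀U : w₀ ∈ U := ⟨hw₀, by simp⟩
    have := differentiableOn_integral_of_dominated (μ := volume.restrict (Ioo (0 : ℝ) 1)) hUo
      (F := fun w s => (s : ℂ) ^ (c - 1) * (1 - (s : ℂ)) ^ (μ - 1) * f (w * s))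
      (bound := fun s => C * (‖w₀‖ + 2) ^ |κ| * G s)
      (fun w hw => (hcontw w hw.1).aestronglyMeasurable measurableSet_Ioo)
      (hGint.const_mul _) ?_ ?_
    · exact (this.differentiableAt (hUo.mem_nhds hw₀U)).differentiableWithinAt
    · filter_upwards [ae_restrict_mem measurableSet_Ioo] with s hs w hw
      refine (hbound w hw.1 s hs).trans ?_
      have hG0 : 0 ≤ G s := by
        have hs1 : 0 ≤ 1 - s := by linarith [hs.2]
        exact add_nonneg (mul_nonneg (Real.rpow_nonneg hs.1.le _) (Real.rpow_nonneg hs1 _))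
          (mul_nonneg (Real.rpow_nonneg hs.1.le _) (Real.rpow_nonneg hs1 _))
      refine mul_le_mul_of_nonneg_right (mul_le_mul_of_nonneg_left ?_ hC0) hG0
      have hw' : ‖w‖ < ‖w₀‖ + 1 := by simpa using hw.2
      calc (1 + ‖w‖) ^ κ ≤ (1 + ‖w‖) ^ |κ| :=
            Real.rpow_le_rpow_of_exponent_le (by linarith [norm_nonneg w]) (le_abs_self κ)
        _ ≤ _ := Real.rpow_le_rpow (by positivity) (by linarith) (abs_nonneg κ)
    · filter_upwards [ae_restrict_mem measurableSet_Ioo] with s hs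
      refine DifferentiableOn.const_mul ?_ _
      exact h.differentiableOn.comp (by fun_prop) fun w hw => hmemw w hw.1 s hs
  · obtain ⟨ε, hε, hball⟩ := Metric.eventually_nhds_iff_ball.1 h.eventuallyEq
    filter_upwards [Metric.ball_mem_nhds (0 : ℂ) hε, Metric.ball_mem_nhds (0 : ℂ) one_pos]
      with w hw hw1
    rw [← hasSum_bateman hc hμ (mem_ball_zero_iff.1 hw1)]
    congr 1
    refine setIntegral_congr_fun measurableSet_Ioo fun s hs => ?_
    rw [hball (w * s)]
    rw [mem_ball_zero_iff] at hw ⊢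
    rw [norm_mul, Complex.norm_real, Real.norm_of_nonneg hs.1.le]
    exact (mul_le_of_le_one_right (norm_nonneg _) hs.2.le).trans_lt hw
  · refine ⟨‖(Gamma μ)⁻¹‖ * (C * ∫ s in Ioo (0 : ℝ) 1, G s), fun w hw => ?_⟩
    rw [norm_mul]
    calc _ ≤ ‖(Gamma μ)⁻¹‖ * ∫ s in Ioo (0 : ℝ) 1, C * (1 + ‖w‖) ^ κ * G s := by
          gcongr
          refine norm_integral_le_of_norm_le (hGint.const_mul _) ?_
          filter_upwards [ae_restrict_mem measurableSet_Ioo] with s hs using hbound w hw s hs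
      _ = _ := by rw [integral_const_mul]; ring

/-- The hypergeometric function continues along the negative axis for every value of the
denominator parameter, with growth controlled by the numerator parameters alone. -/
theorem exists_isHGContinuation {a b c : ℂ} {κ : ℝ} (ha : 0 < a.re) (hb : -b.re ≤ κ)
    (haκ : 0 < a.re + κ) : ∃ r f, IsHGContinuation a b c κ r f := by
  have hlow : ∀ n : ℕ, (∃ r f, IsHGContinuation a b (c + n) κ r f) →
      ∃ r f, IsHGContinuation a b c κ r f := by
    intro n
    induction n with
    | zero => simp
    | succ n ih =>
      rintro ⟨r, f, hf⟩
      refine ih ⟨_, _, IsHGContinuation.lower (r := r) (f := f) ?_⟩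
      rw [show c + n + 1 = c + (n + 1 : ℕ) by push_cast; ring]
      exact hf
  obtain ⟨n, hn⟩ := exists_nat_gt (a.re - c.re)
  have := (isHGContinuation_one_sub_cpow ha hb).raise (μ := c + n - a) ha haκ (by simp; linarith)
  rw [add_sub_cancel] at this
  exact hlow n ⟨_, _, this⟩


/-! ### The basic terminant -/

theorem hasDerivAt_ofReal_cpow {x : ℝ} (hx : 0 < x) (c : ℂ) :
    HasDerivAt (fun x : ℝ => (x : ℂ) ^ c) (c * (x : ℂ) ^ (c - 1)) x := by
  simpa using ((hasDerivAt_id (x : ℂ)).cpow_const (c := c)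
    (ofReal_mem_slitPlane.2 hx)).comp_ofReal

/-- The integral representation of the terminant along the ray of argument `α`; up to the
factor `Γ(p)` it is `∫ s^{p-1} e^{-s} / (1 + s/w) ds`, at `w = exp ζ`. -/
noncomputable def rayTerminant (p : ℂ) (α : ℝ) (ζ : ℂ) : ℂ :=
  (Gamma p)⁻¹ * exp (p * (α * I)) * ∫ x : ℝ in Ioi 0,
    (x : ℂ) ^ (p - 1) * exp (-(exp (α * I) * x)) * (1 + x * exp (α * I - ζ))⁻¹

theorem exists_le_norm_one_add_mul_exp {η : ℝ} (h0 : 0 ≤ η) (hη : η < Real.pi) :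
    ∃ m : ℝ, 0 < m ∧ ∀ θ y : ℝ, |θ| ≤ η → 0 ≤ y → m ≤ ‖1 + y * exp (θ * I)‖ := by
  have hcos : ∀ θ : ℝ, |θ| ≤ η → Real.cos η ≤ Real.cos θ := by
    intro θ hθ
    rw [← Real.cos_abs θ]
    exact Real.cos_le_cos_of_nonneg_of_le_pi (abs_nonneg θ) hη.le hθ
  have hm : -1 < Real.cos η := by
    rw [← Real.cos_pi]
    exact Real.cos_lt_cos_of_nonneg_of_le_pi h0 le_rfl hη
  refine ⟨Real.sqrt ((1 + Real.cos η) / 2), Real.sqrt_pos.2 (by linarith), fun θ y hθ hy => ?_⟩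
  refine Real.sqrt_le_iff.2 ⟨norm_nonneg _, ?_⟩
  rw [← normSq_eq_norm_sq, normSq_apply]
  have h1 : (1 + y * exp (θ * I)).re = 1 + y * Real.cos θ := by
    simp [exp_ofReal_mul_I_re]
  have h2 : (1 + y * exp (θ * I)).im = y * Real.sin θ := by
    simp [exp_ofReal_mul_I_im]
  rw [h1, h2]
  have h3 := Real.sin_sq_add_cos_sq θ
  have h4 := hcos θ hθ
  have h5 := Real.cos_le_one θ
  -- `|1 + y e^{iθ}|² - (1 + cos θ)(1 + y)² / 2 = (1 - cos θ)(1 - y)² / 2`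
  have h6 : (1 + y * Real.cos θ) * (1 + y * Real.cos θ) + y * Real.sin θ * (y * Real.sin θ) =
      (1 + Real.cos θ) / 2 * (1 + y) ^ 2 + (1 - Real.cos θ) / 2 * (1 - y) ^ 2 := by
    linear_combination y ^ 2 * h3
  rw [h6]
  have h7 : 0 ≤ (1 - Real.cos θ) / 2 * (1 - y) ^ 2 :=
    mul_nonneg (by linarith) (sq_nonneg _)
  have h8 : (1 + Real.cos η) / 2 * 1 ≤ (1 + Real.cos θ) / 2 * (1 + y) ^ 2 := by
    gcongr
    · linarith
    · nlinarith
  linarith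

theorem exists_norm_inv_one_add_mul_exp_le {η : ℝ} (h0 : 0 ≤ η) (hη : η < Real.pi) :
    ∃ B : ℝ, 0 < B ∧ ∀ (α : ℝ) (ζ : ℂ) (x : ℝ), |ζ.im - α| ≤ η → 0 ≤ x →
      1 + x * exp (α * I - ζ) ≠ 0 ∧ ‖(1 + x * exp (α * I - ζ))⁻¹‖ ≤ B := by
  obtain ⟨m, hm, hmle⟩ := exists_le_norm_one_add_mul_exp h0 hη
  refine ⟨m⁻¹, inv_pos.2 hm, fun α ζ x hζ hx => ?_⟩
  have h1 : (x : ℂ) * exp (α * I - ζ) =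
      ((x * Real.exp (-ζ.re) : ℝ) : ℂ) * exp (((α - ζ.im : ℝ) : ℂ) * I) := by
    push_cast
    rw [mul_assoc, ← exp_add]
    congr 2
    conv_lhs => rw [← re_add_im ζ]
    ring
  have h2 := hmle (α - ζ.im) (x * Real.exp (-ζ.re)) (by rwa [abs_sub_comm]) (by positivity)
  rw [← h1] at h2
  refine ⟨norm_pos_iff.1 (hm.trans_le h2), ?_⟩
  rw [norm_inv]
  gcongr

section

variable {p : ℂ} {α : ℝ}

theorem re_exp_mul_I_pos (hα : |α| < Real.pi / 2) : 0 < (exp (α * I)).re := by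
  rw [exp_ofReal_mul_I_re]
  exact Real.cos_pos_of_mem_Ioo (abs_lt.1 hα)

theorem integral_ray_gamma (hp : 0 < p.re) (hα : |α| < Real.pi / 2) :
    IntegrableOn (fun x : ℝ => (x : ℂ) ^ (p - 1) * exp (-(exp (α * I) * x))) (Ioi 0) ∧
    ∫ x : ℝ in Ioi 0, (x : ℂ) ^ (p - 1) * exp (-(exp (α * I) * x)) =
      exp (-(p * (α * I))) * Gamma p := by
  have h := integral_cpow_mul_exp_neg_mul_Ioi_of_re_pos hp (re_exp_mul_I_pos hα)
  refine ⟨h.1, h.2.trans ?_⟩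
  have h1 := abs_lt.1 hα
  rw [cpow_def_of_ne_zero (exp_ne_zero _), log_exp (by simp; linarith [Real.pi_pos])
    (by simp; linarith [Real.pi_pos])]
  congr 2
  ring

theorem continuousOn_ray_kernel {ζ : ℂ} (hζ : |ζ.im - α| < Real.pi) (n : ℕ) :
    ContinuousOn (fun x : ℝ => ((1 + x * exp (α * I - ζ))⁻¹) ^ n) (Ici 0) := by
  obtain ⟨B, hB, h⟩ := exists_norm_inv_one_add_mul_exp_le (abs_nonneg _) hζ
  refine ContinuousOn.pow (ContinuousOn.inv₀ (by fun_prop) fun x hx => ?_) n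
  exact (h α ζ x le_rfl hx).1

/-- The differential equation of the terminant, in the variable `ζ = log w`. -/
theorem hasDerivAt_rayTerminant (hp : 0 < p.re) (hα : |α| < Real.pi / 2) {ζ : ℂ}
    (hζ : |ζ.im - α| < Real.pi) :
    HasDerivAt (rayTerminant p α) ((p + exp ζ) * rayTerminant p α ζ - exp ζ) ζ := by
  obtain ⟨hρ, hρint⟩ := integral_ray_gamma hp hα
  set ρ : ℝ → ℂ := fun x => (x : ℂ) ^ (p - 1) * exp (-(exp (α * I) * x)) with hρdef
  have hcont : ContinuousOn ρ (Ioi 0) := (continuousOn_ofReal_cpow _).mul (by fun_prop)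
  set η : ℝ := (|ζ.im - α| + Real.pi) / 2 with hη
  have hη1 : |ζ.im - α| < η := by rw [hη]; linarith
  have hη2 : η < Real.pi := by rw [hη]; linarith
  obtain ⟨B, hB, hker⟩ := exists_norm_inv_one_add_mul_exp_le ((abs_nonneg _).trans hη1.le) hη2
  set S : Set ℂ := {ξ | |ξ.im - α| < η} with hS
  have hSo : IsOpen S := isOpen_lt (by fun_prop) continuous_const
  have hSn : S ∈ 𝓝 ζ := hSo.mem_nhds hη1
  have hmeasK : ∀ ξ ∈ S, ∀ n : ℕ, AEStronglyMeasurable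
      (fun x : ℝ => ((1 + x * exp (α * I - ξ))⁻¹) ^ n) (volume.restrict (Ioi 0)) := fun ξ hξ n =>
    ((continuousOn_ray_kernel (lt_trans hξ hη2) n).mono Ioi_subset_Ici_self).aestronglyMeasurable
      measurableSet_Ioi
  have hmeasρ : AEStronglyMeasurable ρ (volume.restrict (Ioi 0)) :=
    hcont.aestronglyMeasurable measurableSet_Ioi
  have hintK : ∀ ξ ∈ S, ∀ n : ℕ, IntegrableOn
      (fun x : ℝ => ρ x * ((1 + x * exp (α * I - ξ))⁻¹) ^ n) (Ioi 0) := by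
    intro ξ hξ n
    refine (hρ.norm.mul_const (B ^ n)).mono' (hmeasρ.mul (hmeasK ξ hξ n)) ?_
    filter_upwards [ae_restrict_mem measurableSet_Ioi] with x hx
    rw [norm_mul, norm_pow]
    gcongr
    exact (hker α ξ x (le_of_lt hξ) (le_of_lt hx)).2
  have hderiv := (hasDerivAt_integral_of_dominated_loc_of_deriv_le
    (μ := volume.restrict (Ioi (0 : ℝ))) (x₀ := ζ) hSn
    (F := fun ξ x => ρ x * (1 + x * exp (α * I - ξ))⁻¹)
    (F' := fun ξ x => ρ x * ((1 + x * exp (α * I - ξ))⁻¹ - ((1 + x * exp (α * I - ξ))⁻¹) ^ 2))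
    (bound := fun x => ‖ρ x‖ * (B + B ^ 2)) ?_ ?_ ?_ ?_ ?_ ?_).2
  · -- the boundary terms of `ρ(x) x / (1 + x u)` vanish at `0` and at infinity
    have hzero : ∫ x : ℝ in Ioi 0, (p * (ρ x * (1 + x * exp (α * I - ζ))⁻¹) - exp ζ * ρ x +
        exp ζ * (ρ x * (1 + x * exp (α * I - ζ))⁻¹) -
        ρ x * ((1 + x * exp (α * I - ζ))⁻¹ - ((1 + x * exp (α * I - ζ))⁻¹) ^ 2)) = 0 := by
      have hp0 : p ≠ 0 := by
        rintro rfl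
        simp at hp
      have key := integral_Ioi_of_hasDerivAt_of_tendsto (a := 0) (m := 0)
        (f := fun x : ℝ => (x : ℂ) ^ p * exp (-(exp (α * I) * x)) * (1 + x * exp (α * I - ζ))⁻¹)
        (f' := fun x : ℝ => p * (ρ x * (1 + x * exp (α * I - ζ))⁻¹) - exp ζ * ρ x +
        exp ζ * (ρ x * (1 + x * exp (α * I - ζ))⁻¹) -
        ρ x * ((1 + x * exp (α * I - ζ))⁻¹ - ((1 + x * exp (α * I - ζ))⁻¹) ^ 2)) ?_ ?_ ?_ ?_
      · rw [key]
        simp [zero_cpow hp0]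
      · have h1 := continuousOn_ray_kernel hζ 1
        simp only [pow_one] at h1
        refine ContinuousWithinAt.mul (ContinuousAt.continuousWithinAt ?_) (h1 0 self_mem_Ici)
        exact (continuousAt_ofReal_cpow_const _ _ (Or.inl hp)).mul (by fun_prop)
      · intro x hx
        have hx' : (0 : ℝ) < x := hx
        have hx0 : (x : ℂ) ≠ 0 := by exact_mod_cast hx'.ne'
        have hne := (hker α ζ x hη1.le hx'.le).1
        have d1 : HasDerivAt (fun x : ℝ => (x : ℂ) ^ p) (p * (x : ℂ) ^ (p - 1)) x :=
          hasDerivAt_ofReal_cpow hx' p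
        have d2 : HasDerivAt (fun x : ℝ => exp (-(exp (α * I) * x)))
            (exp (-(exp (α * I) * x)) * (-(exp (α * I) * 1))) x :=
          (((hasDerivAt_id x).ofReal_comp.const_mul (exp (α * I))).neg).cexp
        have d3 : HasDerivAt (fun x : ℝ => (1 + (x : ℂ) * exp (α * I - ζ))⁻¹)
            (-(1 * exp (α * I - ζ)) / (1 + x * exp (α * I - ζ)) ^ 2) x :=
          (((hasDerivAt_id x).ofReal_comp.mul_const (exp (α * I - ζ))).const_add 1).inv hne
        refine ((d1.mul d2).mul d3).congr_deriv ?_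
        have e1 : exp (α * I) = exp ζ * exp (α * I - ζ) := by rw [← exp_add]; ring_nf
        have e2 : (x : ℂ) ^ p = x ^ (p - 1) * x := by
          rw [cpow_sub _ _ hx0, cpow_one]
          field_simp
        simp only [hρdef, Pi.mul_apply]
        rw [e2, e1]
        set u := exp (α * I - ζ)
        set E := exp (-(exp ζ * u * x))
        field_simp
        ring
      · have := hintK ζ hη1 1
        have h2 := hintK ζ hη1 2
        simp only [pow_one] at this
        refine (((this.const_mul p).sub (hρ.const_mul (exp ζ))).add (this.const_mul _)).sub ?_
        simp only [mul_sub]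
        exact this.sub h2
      · have hlim := (tendsto_rpow_mul_exp_neg_mul_atTop_nhds_zero p.re (exp (α * I)).re
          (re_exp_mul_I_pos hα)).mul_const B
        rw [zero_mul] at hlim
        refine squeeze_zero_norm' ?_ hlim
        filter_upwards [eventually_gt_atTop 0] with x hx
        rw [norm_mul, norm_mul, norm_cpow_eq_rpow_re_of_pos hx, Complex.norm_exp]
        have : (-(exp (α * I) * x)).re = -(exp (α * I)).re * x := by simp
        rw [this]
        gcongr
        exact (hker α ζ x hη1.le hx.le).2
    have hT := hintK ζ hη1 1
    have hT2 := hintK ζ hη1 2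
    simp only [pow_one] at hT
    have hD : IntegrableOn (fun x : ℝ => ρ x * ((1 + x * exp (α * I - ζ))⁻¹ -
        ((1 + x * exp (α * I - ζ))⁻¹) ^ 2)) (Ioi 0) := by
      simp only [mul_sub]
      exact hT.sub hT2
    have i1 := Integrable.const_mul hT p
    have i2 := Integrable.const_mul hρ (exp ζ)
    have i3 := Integrable.const_mul hT (exp ζ)
    have i12 : Integrable (fun x : ℝ => p * (ρ x * (1 + x * exp (α * I - ζ))⁻¹) - exp ζ * ρ x)
        (volume.restrict (Ioi 0)) := i1.sub i2
    have i123 : Integrable (fun x : ℝ => p * (ρ x * (1 + x * exp (α * I - ζ))⁻¹) - exp ζ * ρ x +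
        exp ζ * (ρ x * (1 + x * exp (α * I - ζ))⁻¹)) (volume.restrict (Ioi 0)) := i12.add i3
    rw [integral_sub i123 hD, integral_add i12 i3, integral_sub i1 i2, integral_const_mul,
      integral_const_mul, integral_const_mul, hρint] at hzero
    refine (hderiv.const_mul ((Gamma p)⁻¹ * exp (p * (α * I)))).congr_deriv ?_
    have hG := Gamma_ne_zero_of_re_pos hp
    have hee : exp (p * (α * I)) * exp (-(p * (α * I))) = 1 := by rw [← exp_add]; simp
    rw [rayTerminant]
    have hGi : (Gamma p)⁻¹ * Gamma p = 1 := inv_mul_cancel₀ hG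
    linear_combination (-(Gamma p)⁻¹ * exp (p * (α * I))) * hzero -
      exp ζ * (Gamma p)⁻¹ * Gamma p * hee - exp ζ * hGi
  · filter_upwards [hSn] with ξ hξ
    have h1 := hmeasK ξ hξ 1
    simp only [pow_one] at h1
    exact hmeasρ.mul h1
  · have h1 := hintK ζ hη1 1
    simp only [pow_one] at h1
    exact h1
  · have h1 := hmeasK ζ hη1 1
    simp only [pow_one] at h1
    exact hmeasρ.mul (h1.sub (hmeasK ζ hη1 2))
  · filter_upwards [ae_restrict_mem measurableSet_Ioi] with x hx ξ hξ
    have h1 := (hker α ξ x (le_of_lt hξ) (le_of_lt hx)).2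
    rw [norm_mul]
    refine mul_le_mul_of_nonneg_left ((norm_sub_le _ _).trans ?_) (norm_nonneg _)
    rw [norm_pow]
    gcongr
  · exact hρ.norm.mul_const _
  · filter_upwards [ae_restrict_mem measurableSet_Ioi] with x hx ξ hξ
    have hne := (hker α ξ x (le_of_lt hξ) (le_of_lt hx)).1
    have d1 : HasDerivAt (fun ξ : ℂ => (1 + x * exp (α * I - ξ))⁻¹)
        (-(x * (exp (α * I - ξ) * -1)) / (1 + x * exp (α * I - ξ)) ^ 2) ξ :=
      ((((hasDerivAt_id ξ).const_sub (α * I)).cexp.const_mul (x : ℂ)).const_add 1).inv hne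
    refine (d1.const_mul (ρ x)).congr_deriv ?_
    field_simp
    ring

theorem norm_rayTerminant_le (hp : 0 < p.re) (hα : |α| < Real.pi / 2) {η : ℝ} (h0 : 0 ≤ η)
    (hη : η < Real.pi) : ∃ C, ∀ ζ : ℂ, |ζ.im - α| ≤ η → ‖rayTerminant p α ζ‖ ≤ C := by
  obtain ⟨B, hB, hker⟩ := exists_norm_inv_one_add_mul_exp_le h0 hη
  obtain ⟨hρ, -⟩ := integral_ray_gamma hp hα
  refine ⟨‖(Gamma p)⁻¹ * exp (p * (α * I))‖ *
    ∫ x : ℝ in Ioi 0, ‖(x : ℂ) ^ (p - 1) * exp (-(exp (α * I) * x))‖ * B, fun ζ hζ => ?_⟩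
  rw [rayTerminant, norm_mul]
  gcongr
  refine norm_integral_le_of_norm_le (hρ.norm.mul_const B) ?_
  filter_upwards [ae_restrict_mem measurableSet_Ioi] with x hx
  rw [norm_mul]
  gcongr
  exact (hker α ζ x hζ (le_of_lt hx)).2

/-- The terminant is given by its integral along any ray in the right half-plane whose argument
is within `π` of `arg w`: both are primitives of the same function, vanishing at infinity. -/
theorem Lam_eq_rayTerminant (hp : 0 < p.re) (hα : |α| < Real.pi / 2) {ζ : ℂ}
    (hζ : |ζ.im - α| < Real.pi) : Lam p ζ = rayTerminant p α ζ := by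
  set M : ℂ → ℂ := fun ξ => exp (-(p * ξ) - exp ξ) * rayTerminant p α ξ with hM
  have hMd : ∀ ξ : ℂ, |ξ.im - α| < Real.pi →
      HasDerivAt M (-(exp ((1 - p) * ξ) * exp (-exp ξ))) ξ := by
    intro ξ hξ
    have d1 : HasDerivAt (fun ξ : ℂ => exp (-(p * ξ) - exp ξ))
        (exp (-(p * ξ) - exp ξ) * (-(p * 1) - exp ξ)) ξ :=
      ((((hasDerivAt_id ξ).const_mul p).neg).sub (hasDerivAt_exp ξ)).cexp
    refine (d1.mul (hasDerivAt_rayTerminant hp hα hξ)).congr_deriv ?_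
    have e1 : exp ((1 - p) * ξ) * exp (-exp ξ) = exp (-(p * ξ) - exp ξ) * exp ξ := by
      rw [← exp_add, ← exp_add]
      ring_nf
    rw [e1]
    ring
  have hα' := abs_lt.1 hα
  have hζ' := abs_lt.1 hζ
  have h0α : |(0 : ℝ) - α| < Real.pi := by
    rw [zero_sub, abs_neg]
    linarith [Real.pi_pos]
  obtain ⟨C, hC⟩ := norm_rayTerminant_le hp hα (abs_nonneg α) (by linarith [Real.pi_pos])
  have hinf : ∫ t in Ioi (Real.exp ζ.re), (t : ℂ) ^ ((1 - p) - 1) * exp (-(t : ℂ)) =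
      M ζ.re := by
    have hd : ∀ t ∈ Ici (Real.exp ζ.re), HasDerivAt (fun t : ℝ => -M (Real.log t : ℝ))
        ((t : ℂ) ^ ((1 - p) - 1) * exp (-(t : ℂ))) t := by
      intro t ht
      have ht0 : 0 < t := (Real.exp_pos _).trans_le ht
      have htc : (t : ℂ) ≠ 0 := by exact_mod_cast ht0.ne'
      have d1 := (hMd (Real.log t : ℝ) (by simpa using h0α)).scomp t
        ((Real.hasDerivAt_log ht0.ne').ofReal_comp)
      refine d1.neg.congr_deriv ?_
      have e1 : exp (((Real.log t : ℝ) : ℂ)) = t := by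
        rw [← ofReal_exp, Real.exp_log ht0]
      have e2 : exp ((1 - p) * (Real.log t : ℝ)) = (t : ℂ) ^ (1 - p) := by
        rw [cpow_def_of_ne_zero htc, ← ofReal_log ht0.le, mul_comm]
      rw [e1, e2, cpow_sub (1 - p) 1 htc, cpow_one, smul_eq_mul]
      push_cast
      field_simp
    have hlim : Tendsto (fun t : ℝ => -M (Real.log t : ℝ)) atTop (𝓝 0) := by
      have hl : Tendsto (fun t : ℝ => Real.exp (-t) * C) atTop (𝓝 0) := by
        simpa using (Real.tendsto_exp_neg_atTop_nhds_zero).mul_const C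
      refine squeeze_zero_norm' ?_ hl
      filter_upwards [eventually_ge_atTop 1] with t ht
      have ht0 : 0 < t := by linarith
      rw [norm_neg, hM]
      simp only [norm_mul, Complex.norm_exp]
      have e1 : exp (((Real.log t : ℝ) : ℂ)) = t := by
        rw [← ofReal_exp, Real.exp_log ht0]
      have h1 := hC (Real.log t : ℝ) (by simp)
      rw [e1]
      have e2 : (-(p * (Real.log t : ℝ)) - (t : ℂ)).re ≤ -t := by
        have := Real.log_nonneg ht
        simp only [sub_re, neg_re, re_mul_ofReal, ofReal_re]
        have := mul_nonneg hp.le this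
        linarith
      gcongr
    have hIoi := integrableOn_Ioi_deriv_of_nonneg' (g := fun t : ℝ => -Real.exp (-t))
      (g' := fun t : ℝ => Real.exp (-t)) (a := Real.exp ζ.re) (l := 0) (fun t _ =>
        ((hasDerivAt_id t).neg.exp).neg.congr_deriv (by simp)) (fun t _ => (Real.exp_pos _).le) (by
        simpa using Real.tendsto_exp_neg_atTop_nhds_zero.neg)
    have hint : IntegrableOn (fun t : ℝ => (t : ℂ) ^ ((1 - p) - 1) * exp (-(t : ℂ)))
        (Ioi (Real.exp ζ.re)) := by
      refine (hIoi.const_mul (Real.exp ζ.re ^ (-p.re))).mono' ?_ ?_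
      · refine ContinuousOn.aestronglyMeasurable ?_ measurableSet_Ioi
        exact ((continuousOn_ofReal_cpow _).mono (Ioi_subset_Ioi (Real.exp_pos _).le)).mul
          (by fun_prop)
      · filter_upwards [ae_restrict_mem measurableSet_Ioi] with t ht
        have ht0 : 0 < t := (Real.exp_pos _).trans ht
        rw [norm_mul, norm_cpow_eq_rpow_re_of_pos ht0, Complex.norm_exp]
        have e1 : (1 - p - 1).re = -p.re := by simp
        rw [e1, neg_re, ofReal_re]
        gcongr ?_ * _
        exact Real.rpow_le_rpow_of_nonpos (Real.exp_pos _) (le_of_lt ht) (by linarith)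
    rw [integral_Ioi_of_hasDerivAt_of_tendsto' hd hint hlim, Real.log_exp]
    ring
  have hver : ∫ θ in (0 : ℝ)..ζ.im, I * exp ((1 - p) * (ζ.re + θ * I)) *
      exp (-exp (ζ.re + θ * I)) = -M ζ + M ζ.re := by
    have hd : ∀ θ ∈ uIcc 0 ζ.im, HasDerivAt (fun θ : ℝ => -M (ζ.re + θ * I))
        (I * exp ((1 - p) * (ζ.re + θ * I)) * exp (-exp (ζ.re + θ * I))) θ := by
      intro θ hθ
      have hθα : |θ - α| < Real.pi := by
        rw [abs_lt]
        rcases le_total 0 ζ.im with h | h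
        · rw [uIcc_of_le h] at hθ
          constructor <;> linarith [hθ.1, hθ.2]
        · rw [uIcc_of_ge h] at hθ
          constructor <;> linarith [hθ.1, hθ.2]
      have hline : HasDerivAt (fun θ : ℝ => (ζ.re : ℂ) + θ * I) (1 * I) θ :=
        ((hasDerivAt_id θ).ofReal_comp.mul_const I).const_add _
      have d1 := (hMd (ζ.re + θ * I) (by simpa using hθα)).scomp θ hline
      refine d1.neg.congr_deriv ?_
      rw [smul_eq_mul]
      ring
    rw [intervalIntegral.integral_eq_sub_of_hasDerivAt hd
      (Continuous.intervalIntegrable (by fun_prop) _ _)]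
    simp [re_add_im]
  have hinc : incGamma (1 - p) ζ = M ζ := by
    rw [incGamma, hinf, hver]
    ring
  rw [Lam, hinc, hM]
  simp only
  rw [← mul_assoc, ← exp_add, ← exp_add]
  simp

end


/-! ### Laplace transforms of the hypergeometric function -/

section

variable {a b : ℂ} {κ : ℝ}

theorem continuousOn_hyperF_neg (ha : 0 < a.re) (hb : -b.re ≤ κ) (haκ : 0 < a.re + κ) (c : ℂ) :
    ContinuousOn (fun t : ℝ => hyperF a b c (-(t : ℂ))) (Ioi 0) := by
  obtain ⟨r, f, hf⟩ := exists_isHGContinuation (c := c) ha hb haκ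
  have h1 : ContinuousOn (fun t : ℝ => f (-(t : ℂ))) (Ioi 0) :=
    hf.differentiableOn.continuousOn.comp (by fun_prop)
      fun t ht => neg_mem_negCone hf.pos (le_of_lt ht)
  exact h1.congr fun t ht => hf.hyperF_eq (le_of_lt ht)

theorem exists_norm_hyperF_neg_le (ha : 0 < a.re) (hb : -b.re ≤ κ) (haκ : 0 < a.re + κ) (c : ℂ) :
    ∃ C, 0 ≤ C ∧ ∀ t : ℝ, 0 < t → ‖hyperF a b c (-(t : ℂ))‖ ≤ C * (1 + t) ^ κ := by
  obtain ⟨r, f, hf⟩ := exists_isHGContinuation (c := c) ha hb haκ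
  obtain ⟨C, hC⟩ := hf.bound
  have h : ∀ t : ℝ, 0 ≤ t → ‖hyperF a b c (-(t : ℂ))‖ ≤ C * (1 + t) ^ κ := by
    intro t ht
    have := hC _ (neg_mem_negCone hf.pos ht)
    rwa [norm_neg, Complex.norm_real, Real.norm_of_nonneg ht, ← hf.hyperF_eq ht] at this
  refine ⟨C, ?_, fun t ht => h t ht.le⟩
  have := (norm_nonneg _).trans (h 0 le_rfl)
  simpa using this

theorem hyperF_neg_self (ha : 0 < a.re) {t : ℝ} (ht : 0 ≤ t) :
    hyperF a b a (-(t : ℂ)) = (1 + t : ℂ) ^ (-b) / Gamma a := by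
  rw [(isHGContinuation_one_sub_cpow ha le_rfl).hyperF_eq ht, sub_neg_eq_add]

theorem hyperF_neg_bateman (ha : 0 < a.re) (hb : -b.re ≤ κ) (haκ : 0 < a.re + κ) {c μ : ℂ}
    (hc : 0 < c.re) (hμ : 0 < μ.re) {t : ℝ} (ht : 0 ≤ t) :
    hyperF a b (c + μ) (-(t : ℂ)) = (Gamma μ)⁻¹ * ∫ s : ℝ in Ioo 0 1,
      (s : ℂ) ^ (c - 1) * (1 - (s : ℂ)) ^ (μ - 1) * hyperF a b c (-((t * s : ℝ) : ℂ)) := by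
  obtain ⟨r, f, hf⟩ := exists_isHGContinuation (c := c) ha hb haκ
  -- enlarging the growth exponent makes the fractional integral converge for every `c`
  have hf' := (hf.mono (le_max_left κ 0)).raise hc
    (add_pos_of_pos_of_nonneg hc (le_max_right κ 0)) hμ
  rw [hf'.hyperF_eq ht]
  congr 1
  refine setIntegral_congr_fun measurableSet_Ioo fun s hs => ?_
  rw [hf.hyperF_eq (mul_nonneg ht hs.1.le)]
  push_cast
  rw [neg_mul]

theorem integrableOn_rpow_mul_one_add_rpow_mul_exp {α q : ℝ} (κ : ℝ) (hα : 0 < α) (hq : 0 < q) :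
    IntegrableOn (fun t : ℝ => t ^ (α - 1) * (1 + t) ^ κ * Real.exp (-(q * t))) (Ioi 0) := by
  set δ : ℝ := q / (2 * (|κ| + 1)) with hδ
  have hδ0 : 0 < δ := by positivity
  set K : ℝ := (1 + 1 / δ) ^ |κ| with hK
  have hbase : IntegrableOn (fun t : ℝ => t ^ (α - 1) * Real.exp (-(q / 2 * t))) (Ioi 0) := by
    have := integrableOn_rpow_mul_exp_neg_mul_rpow (s := α - 1) (p := 1) (b := q / 2)
      (by linarith) one_pos (by linarith)
    simpa only [Real.rpow_one, neg_mul] using this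
  refine (hbase.const_mul K).mono' ?_ ?_
  · refine ContinuousOn.aestronglyMeasurable (fun t ht => ?_) measurableSet_Ioi
    have ht' : (0 : ℝ) < t := ht
    refine ContinuousAt.continuousWithinAt ?_
    refine ((Real.continuousAt_rpow_const _ _ (Or.inl ht'.ne')).mul ?_).mul (by fun_prop)
    exact (continuousAt_const.add continuousAt_id).rpow_const (Or.inl (by simp; linarith))
  · filter_upwards [ae_restrict_mem measurableSet_Ioi] with t ht
    have ht' : (0 : ℝ) < t := ht
    rw [Real.norm_of_nonneg (by positivity)]
    have h1 : 1 + t ≤ (1 + 1 / δ) * Real.exp (δ * t) := by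
      have h2 : 1 + t ≤ (1 + 1 / δ) * (1 + δ * t) := by
        have : (1 + 1 / δ) * (1 + δ * t) = 1 + t + (1 / δ + δ * t) := by field_simp; ring
        rw [this]
        have : 0 < 1 / δ + δ * t := by positivity
        linarith
      refine h2.trans ?_
      gcongr
      linarith [Real.add_one_le_exp (δ * t)]
    have h3 : (1 + t) ^ κ ≤ K * Real.exp (q / 2 * t) := by
      calc (1 + t) ^ κ ≤ (1 + t) ^ |κ| :=
            Real.rpow_le_rpow_of_exponent_le (by linarith) (le_abs_self κ)
        _ ≤ ((1 + 1 / δ) * Real.exp (δ * t)) ^ |κ| :=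
            Real.rpow_le_rpow (by positivity) h1 (abs_nonneg κ)
        _ = K * Real.exp (δ * t * |κ|) := by
            rw [Real.mul_rpow (by positivity) (Real.exp_pos _).le, ← Real.exp_mul]
        _ ≤ _ := by
            refine mul_le_mul_of_nonneg_left (Real.exp_le_exp.2 ?_) (by positivity)
            have : δ * |κ| ≤ q / 2 := by
              rw [hδ, div_mul_eq_mul_div, div_le_iff₀ (by positivity)]
              nlinarith [abs_nonneg κ]
            nlinarith
    have h4 : Real.exp (-(q * t)) = Real.exp (-(q / 2 * t)) * Real.exp (-(q / 2 * t)) := by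
      rw [← Real.exp_add]
      ring_nf
    have h5 : Real.exp (q / 2 * t) * Real.exp (-(q / 2 * t)) = 1 := by
      rw [← Real.exp_add]
      simp
    calc t ^ (α - 1) * (1 + t) ^ κ * Real.exp (-(q * t))
        ≤ t ^ (α - 1) * (K * Real.exp (q / 2 * t)) * Real.exp (-(q * t)) := by gcongr
      _ = K * (t ^ (α - 1) * Real.exp (-(q / 2 * t))) *
          (Real.exp (q / 2 * t) * Real.exp (-(q / 2 * t))) := by rw [h4]; ring
      _ = _ := by rw [h5, mul_one]

/-- The Laplace transform of `t^{c-1} 𝐅(a,b;c;-t)`. -/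
noncomputable def hgLaplace (a b c : ℂ) (q : ℝ) : ℂ :=
  ∫ t : ℝ in Ioi 0, (t : ℂ) ^ (c - 1) * hyperF a b c (-(t : ℂ)) * exp (-(q * t))

theorem integrableOn_hgLaplace (ha : 0 < a.re) (hb : -b.re ≤ κ) (haκ : 0 < a.re + κ) {c : ℂ}
    (hc : 0 < c.re) {q : ℝ} (hq : 0 < q) :
    IntegrableOn (fun t : ℝ => (t : ℂ) ^ (c - 1) * hyperF a b c (-(t : ℂ)) * exp (-(q * t)))
      (Ioi 0) := by
  obtain ⟨C, hC0, hC⟩ := exists_norm_hyperF_neg_le ha hb haκ c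
  refine ((integrableOn_rpow_mul_one_add_rpow_mul_exp κ hc hq).const_mul C).mono' ?_ ?_
  · refine ContinuousOn.aestronglyMeasurable ?_ measurableSet_Ioi
    exact ((continuousOn_ofReal_cpow _).mul (continuousOn_hyperF_neg ha hb haκ c)).mul
      (by fun_prop)
  · filter_upwards [ae_restrict_mem measurableSet_Ioi] with t ht
    have ht' : (0 : ℝ) < t := ht
    rw [norm_mul, norm_mul, norm_cpow_eq_rpow_re_of_pos ht', Complex.norm_exp]
    have h1 : (-((q : ℂ) * t)).re = -(q * t) := by simp
    rw [h1, sub_re, one_re]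
    calc _ ≤ t ^ (c.re - 1) * (C * (1 + t) ^ κ) * Real.exp (-(q * t)) := by
          gcongr
          exact hC t ht'
      _ = _ := by ring

/-- Raising the denominator parameter by `μ` divides the Laplace transform by `q^μ`. -/
theorem hgLaplace_add (ha : 0 < a.re) (hb : -b.re ≤ κ) (haκ : 0 < a.re + κ) {c μ : ℂ}
    (hc : 0 < c.re) (hμ : 0 < μ.re) {q : ℝ} (hq : 0 < q) :
    hgLaplace a b (c + μ) q = (q : ℂ) ^ (-μ) * hgLaplace a b c q := by
  have hg := integral_cpow_mul_exp_neg_mul_Ioi_of_re_pos (a := μ) (r := q) hμ (by simpa using hq)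
  have hconv := integral_posConvolution (integrableOn_hgLaplace ha hb haκ hc hq) hg.1
    (ContinuousLinearMap.mul ℝ ℂ)
  rw [ContinuousLinearMap.mul_apply', hg.2] at hconv
  have hGμ := Gamma_ne_zero_of_re_pos hμ
  have hinner : ∀ t ∈ Ioi (0 : ℝ), ∫ x in (0 : ℝ)..t,
      (ContinuousLinearMap.mul ℝ ℂ)
        ((x : ℂ) ^ (c - 1) * hyperF a b c (-(x : ℂ)) * exp (-(q * x)))
        (((t - x : ℝ) : ℂ) ^ (μ - 1) * exp (-(q * (t - x : ℝ)))) =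
      Gamma μ *
        ((t : ℂ) ^ (c + μ - 1) * hyperF a b (c + μ) (-(t : ℂ)) * exp (-(q * t))) := by
    intro t ht
    have ht' : (0 : ℝ) < t := ht
    have ht0 : (t : ℂ) ≠ 0 := by exact_mod_cast ht'.ne'
    have hsub := intervalIntegral.smul_integral_comp_mul_left (a := 0) (b := 1)
      (fun x : ℝ => (ContinuousLinearMap.mul ℝ ℂ)
        ((x : ℂ) ^ (c - 1) * hyperF a b c (-(x : ℂ)) * exp (-(q * x)))
        (((t - x : ℝ) : ℂ) ^ (μ - 1) * exp (-(q * (t - x : ℝ))))) t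
    rw [mul_zero, mul_one] at hsub
    rw [← hsub, hyperF_neg_bateman ha hb haκ hc hμ ht'.le,
      intervalIntegral.integral_of_le zero_le_one, integral_Ioc_eq_integral_Ioo]
    have h1 : ∫ s : ℝ in Ioo 0 1, (ContinuousLinearMap.mul ℝ ℂ)
        (((t * s : ℝ) : ℂ) ^ (c - 1) * hyperF a b c (-((t * s : ℝ) : ℂ)) *
          exp (-(q * (t * s : ℝ))))
        (((t - t * s : ℝ) : ℂ) ^ (μ - 1) * exp (-(q * (t - t * s : ℝ)))) =
        ((t : ℂ) ^ (c - 1) * (t : ℂ) ^ (μ - 1) * exp (-(q * t))) * ∫ s : ℝ in Ioo 0 1,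
      (s : ℂ) ^ (c - 1) * (1 - (s : ℂ)) ^ (μ - 1) * hyperF a b c (-((t * s : ℝ) : ℂ)) := by
      rw [← integral_const_mul]
      refine setIntegral_congr_fun measurableSet_Ioo fun s hs => ?_
      simp only [ContinuousLinearMap.mul_apply']
      have e1 : ((t * s : ℝ) : ℂ) ^ (c - 1) = (t : ℂ) ^ (c - 1) * (s : ℂ) ^ (c - 1) := by
        rw [ofReal_mul, mul_cpow_ofReal_nonneg ht'.le hs.1.le]
      have e2 : ((t - t * s : ℝ) : ℂ) ^ (μ - 1) =
          (t : ℂ) ^ (μ - 1) * (1 - (s : ℂ)) ^ (μ - 1) := by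
        have h2 : (0 : ℝ) ≤ 1 - s := by linarith [hs.2]
        rw [show t - t * s = t * (1 - s) by ring, ofReal_mul, mul_cpow_ofReal_nonneg ht'.le h2]
        push_cast
        rfl
      have e3 : exp (-(q * t)) = exp (-(q * (t * s : ℝ))) * exp (-(q * (t - t * s : ℝ))) := by
        rw [← exp_add]
        push_cast
        ring_nf
      rw [e1, e2, e3]
      ring
    rw [h1, show c + μ - 1 = (c - 1) + (μ - 1) + 1 by ring, cpow_add _ _ ht0, cpow_add _ _ ht0,
      cpow_one, real_smul]
    field_simp
  rw [setIntegral_congr_fun measurableSet_Ioi hinner, integral_const_mul] at hconv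
  rw [hgLaplace, hgLaplace]
  apply mul_left_cancel₀ hGμ
  rw [hconv]
  ring

/-- The normalized Laplace transform `q^c ∫ t^{c-1} 𝐅(a,b;c;-t) e^{-qt} dt` does not depend
on `c`. -/
theorem cpow_mul_hgLaplace_eq (ha : 0 < a.re) (hb : -b.re ≤ κ) (haκ : 0 < a.re + κ) {c d : ℂ}
    (hc : 0 < c.re) (hd : 0 < d.re) {q : ℝ} (hq : 0 < q) :
    (q : ℂ) ^ c * hgLaplace a b c q = (q : ℂ) ^ d * hgLaplace a b d q := by
  have h1 := hgLaplace_add ha hb haκ hc hd hq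
  have h2 := hgLaplace_add ha hb haκ hd hc hq
  rw [add_comm d c, h1] at h2
  have hq0 : (q : ℂ) ≠ 0 := by exact_mod_cast hq.ne'
  have e1 : (q : ℂ) ^ c * (q : ℂ) ^ (-c) = 1 := by rw [← cpow_add _ _ hq0]; simp
  have e2 : (q : ℂ) ^ d * (q : ℂ) ^ (-d) = 1 := by rw [← cpow_add _ _ hq0]; simp
  linear_combination (q : ℂ) ^ c * (q : ℂ) ^ d * h2 + (q : ℂ) ^ d * hgLaplace a b d q * e1 -
    (q : ℂ) ^ c * hgLaplace a b c q * e2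

end

/-! ### Exchanging the terminant and the hypergeometric function -/

/-- The terminant at a positive point, as a real Stieltjes integral. -/
theorem Gamma_mul_Lam_ofReal {p : ℂ} (hp : 0 < p.re) (x : ℝ) :
    Gamma p * Lam p x = ∫ y : ℝ in Ioi 0,
      (y : ℂ) ^ (p - 1) * exp (-y) * (1 + y * exp (-(x : ℂ)))⁻¹ := by
  have hα : |(0 : ℝ)| < Real.pi / 2 := by simp [Real.pi_pos]
  rw [Lam_eq_rayTerminant hp hα (by simp [Real.pi_pos]), rayTerminant, ← mul_assoc, ← mul_assoc,
    mul_inv_cancel₀ (Gamma_ne_zero_of_re_pos hp)]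
  simp

theorem Gamma_mul_Lam_add_log {p : ℂ} (hp : 0 < p.re) (x : ℝ) {t : ℝ} (ht : 0 < t) :
    Gamma p * Lam p (x + (Real.log (2 * (1 + t)) : ℂ)) = (1 + t : ℂ) ^ p * ∫ y : ℝ in Ioi 0,
      (y : ℂ) ^ (p - 1) * exp (-((1 + t) * y)) * (1 + y * exp (-(x : ℂ)) / 2)⁻¹ := by
  have ht1 : (0 : ℝ) < 1 + t := by linarith
  have ht1c : (1 + t : ℂ) ≠ 0 := by exact_mod_cast ht1.ne'
  rw [← ofReal_add, Gamma_mul_Lam_ofReal hp]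
  have hsub := integral_comp_mul_left_Ioi' (fun y : ℝ => (y : ℂ) ^ (p - 1) * exp (-y) *
    (1 + y * exp (-((x + Real.log (2 * (1 + t)) : ℝ) : ℂ)))⁻¹) 0 ht1
  rw [mul_zero] at hsub
  rw [← hsub, real_smul, ← integral_const_mul, ← integral_const_mul]
  refine setIntegral_congr_fun measurableSet_Ioi fun y hy => ?_
  have hy' : (0 : ℝ) < y := hy
  have e1 : exp (-((x + Real.log (2 * (1 + t)) : ℝ) : ℂ)) = exp (-(x : ℂ)) / (2 * (1 + t)) := by
    rw [ofReal_add, neg_add, exp_add, exp_neg ((Real.log _ : ℝ) : ℂ), ← ofReal_exp,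
      Real.exp_log (by positivity)]
    push_cast
    rfl
  have e2 : (((1 + t) * y : ℝ) : ℂ) ^ (p - 1) = (1 + t : ℂ) ^ (p - 1) * (y : ℂ) ^ (p - 1) := by
    rw [ofReal_mul, mul_cpow_ofReal_nonneg ht1.le hy'.le]
    push_cast
    rfl
  have e3 : (1 + t : ℂ) ^ p = (1 + t : ℂ) * (1 + t : ℂ) ^ (p - 1) := by
    rw [cpow_sub p 1 ht1c, cpow_one]
    field_simp
  rw [e1, e2, e3]
  push_cast
  have e4 : (1 + t) * (y : ℂ) * (exp (-(x : ℂ)) / (2 * (1 + t))) = y * exp (-(x : ℂ)) / 2 := by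
    field_simp
  rw [e4]
  ring

/-- At positive points the integral of the theorem is an integral of the normalized Laplace
transform, so it does not depend on `λ`. -/
theorem Gamma_mul_integral_integrand {ν : ℂ} {κ : ℝ} {N : ℕ} (ha : 0 < (ν + 1 / 2).re)
    (hb : -(-ν + 1 / 2).re ≤ κ) (haκ : 0 < (ν + 1 / 2).re + κ) (hκN : κ < N) {c : ℂ}
    (hc : 0 < c.re) (x : ℝ) :
    Gamma (N + c) * ∫ t : ℝ in Ioi 0, integrand Lam N ν c x t = ∫ y : ℝ in Ioi 0,
      (y : ℂ) ^ ((N : ℂ) - 1) * exp (-y) * (1 + y * exp (-(x : ℂ)) / 2)⁻¹ *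
        ((y : ℂ) ^ c * hgLaplace (ν + 1 / 2) (-ν + 1 / 2) c y) := by
  have hp : 0 < ((N : ℂ) + c).re := by simp; positivity
  have hpos : ∀ y : ℝ, 0 < y → ∃ r : ℝ, 1 ≤ r ∧ (1 + y * exp (-(x : ℂ)) / 2 : ℂ) = r := by
    intro y hy
    refine ⟨1 + y * Real.exp (-x) / 2, ?_, by push_cast; rfl⟩
    have : 0 < y * Real.exp (-x) / 2 := by positivity
    linarith
  obtain ⟨C, hC0, hC⟩ := exists_norm_hyperF_neg_le ha hb haκ c
  have hk : ContinuousOn (fun t : ℝ => (t : ℂ) ^ (c - 1) *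
      hyperF (ν + 1 / 2) (-ν + 1 / 2) c (-(t : ℂ))) (Ioi 0) :=
    (continuousOn_ofReal_cpow _).mul (continuousOn_hyperF_neg ha hb haκ c)
  have key := integral_mul_laplace_swap (q := N + c) (C := 1)
    (k := fun t : ℝ => (t : ℂ) ^ (c - 1) * hyperF (ν + 1 / 2) (-ν + 1 / 2) c (-(t : ℂ)))
    (h := fun y : ℝ => (1 + y * exp (-(x : ℂ)) / 2)⁻¹) hp hk ?_ ?_ ?_
  · rw [← integral_const_mul]
    calc _ = ∫ t : ℝ in Ioi 0, (t : ℂ) ^ (c - 1) *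
          hyperF (ν + 1 / 2) (-ν + 1 / 2) c (-(t : ℂ)) * ∫ y : ℝ in Ioi 0,
          (y : ℂ) ^ ((N : ℂ) + c - 1) * exp (-((1 + t) * y)) *
            (1 + y * exp (-(x : ℂ)) / 2)⁻¹ := by
          refine setIntegral_congr_fun measurableSet_Ioi fun t ht => ?_
          have ht' : (0 : ℝ) < t := ht
          have h1 := Gamma_mul_Lam_add_log hp x ht'
          have ht1c : (1 + t : ℂ) ≠ 0 := by
            exact_mod_cast (show (0 : ℝ) < 1 + t by linarith).ne'
          have h2 : (1 + t : ℂ) ^ ((N : ℂ) + c) ≠ 0 := by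
            rw [Ne, cpow_eq_zero_iff]
            exact fun h => ht1c h.1
          simp only [integrand]
          push_cast at h1 ⊢
          calc _ = (t : ℂ) ^ (c - 1) / (1 + t : ℂ) ^ ((N : ℂ) + c) *
                hyperF (ν + 1 / 2) (-ν + 1 / 2) c (-(t : ℂ)) *
                (Gamma (N + c) * Lam (N + c) (x + (Real.log (2 * (1 + t)) : ℂ))) := by
                ring
            _ = _ := by
                rw [h1, div_mul_eq_mul_div, div_mul_eq_mul_div, div_eq_iff h2]
                ring
      _ = _ := by
          rw [key]
          refine setIntegral_congr_fun measurableSet_Ioi fun y hy => ?_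
          have hy0 : (y : ℂ) ≠ 0 := by exact_mod_cast (ne_of_gt hy)
          simp only [hgLaplace]
          rw [show (N : ℂ) + c - 1 = (N - 1) + c by ring, cpow_add _ _ hy0]
          ring
  · refine ContinuousOn.inv₀ (by fun_prop) fun y hy => ?_
    obtain ⟨r, hr, h⟩ := hpos y hy
    rw [h]
    exact_mod_cast (by linarith : (0 : ℝ) < r).ne'
  · intro y hy
    obtain ⟨r, hr, h⟩ := hpos y hy
    rw [h, norm_inv, Complex.norm_real, Real.norm_of_nonneg (by linarith)]
    exact inv_le_one_of_one_le₀ hr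
  · have hint := integrableOn_rpow_mul_one_add_rpow hc
      (show c.re < N + c.re - κ by linarith)
    refine (hint.const_mul C).mono' ?_ ?_
    · refine ContinuousOn.aestronglyMeasurable (hk.norm.mul fun t ht => ?_) measurableSet_Ioi
      have ht' : (0 : ℝ) < t := ht
      refine ContinuousAt.continuousWithinAt ?_
      exact (continuousAt_const.add continuousAt_id).rpow_const (Or.inl (by simp; linarith))
    · filter_upwards [ae_restrict_mem measurableSet_Ioi] with t ht
      have ht' : (0 : ℝ) < t := ht
      have ht1 : (0 : ℝ) < 1 + t := by linarith
      rw [norm_mul, norm_norm, norm_mul, norm_cpow_eq_rpow_re_of_pos ht', sub_re, one_re,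
        Real.norm_of_nonneg (by positivity)]
      have e1 : (1 + t) ^ (-(N + c.re - κ)) = (1 + t) ^ κ * (1 + t) ^ (-((N : ℂ) + c).re) := by
        rw [← Real.rpow_add ht1]
        congr 1
        simp
        ring
      rw [e1]
      calc _ ≤ t ^ (c.re - 1) * (C * (1 + t) ^ κ) * (1 + t) ^ (-((N : ℂ) + c).re) := by
            gcongr
            exact hC t ht'
        _ = _ := by ring

theorem Gamma_mul_integral_integrand_eq {ν : ℂ} {κ : ℝ} {N : ℕ} (ha : 0 < (ν + 1 / 2).re)
    (hb : -(-ν + 1 / 2).re ≤ κ) (haκ : 0 < (ν + 1 / 2).re + κ) (hκN : κ < N) {c d : ℂ}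
    (hc : 0 < c.re) (hd : 0 < d.re) (x : ℝ) :
    Gamma (N + c) * ∫ t : ℝ in Ioi 0, integrand Lam N ν c x t =
      Gamma (N + d) * ∫ t : ℝ in Ioi 0, integrand Lam N ν d x t := by
  rw [Gamma_mul_integral_integrand ha hb haκ hκN hc, Gamma_mul_integral_integrand ha hb haκ hκN hd]
  refine setIntegral_congr_fun measurableSet_Ioi fun y hy => ?_
  rw [cpow_mul_hgLaplace_eq ha hb haκ hc hd hy]


/-! ### The remainder of the binomial series -/

/-- The binomial coefficient `(s choose n)`, as a product. -/
noncomputable def binomCoeff (s : ℂ) (n : ℕ) : ℂ :=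
  (∏ k ∈ Finset.range n, (s - k)) / n.factorial

theorem continuousOn_binomKernel (N : ℕ) {y : ℝ} (hy : 0 < y) :
    ContinuousOn (fun t : ℝ => ((1 + t : ℂ) ^ N * (1 + t + y))⁻¹) (Ici 0) := by
  refine ContinuousOn.inv₀ (by fun_prop) fun t ht => ?_
  have ht' : (0 : ℝ) ≤ t := ht
  have h1 : (1 + t : ℂ) ≠ 0 := by exact_mod_cast (show (0 : ℝ) < 1 + t by linarith).ne'
  have h2 : (1 + t + y : ℂ) ≠ 0 := by exact_mod_cast (show (0 : ℝ) < 1 + t + y by linarith).ne'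
  exact mul_ne_zero (pow_ne_zero _ h1) h2

theorem norm_binomKernel_le (N : ℕ) {y t : ℝ} (hy : 0 < y) (ht : 0 ≤ t) :
    ‖((1 + t : ℂ) ^ N * (1 + t + y))⁻¹‖ ≤ (1 + t) ^ (-(N + 1 : ℝ)) := by
  have h1 : (1 + t : ℂ) ^ N * (1 + t + y) = (((1 + t) ^ N * (1 + t + y) : ℝ) : ℂ) := by
    push_cast
    rfl
  have ht1 : (0 : ℝ) < 1 + t := by linarith
  rw [h1, norm_inv, Complex.norm_real, Real.norm_of_nonneg (by positivity), Real.rpow_neg ht1.le]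
  have h2 : (1 + t) ^ (N + 1 : ℝ) = (1 + t) ^ N * (1 + t) := by
    rw [Real.rpow_add ht1, Real.rpow_natCast, Real.rpow_one]
  rw [h2]
  exact inv_anti₀ (by positivity) (mul_le_mul_of_nonneg_left (by linarith) (by positivity))

theorem integrableOn_binomKernel (N : ℕ) {y : ℝ} (hy : 0 < y) {s : ℂ} (hs : 0 < s.re)
    (hsN : s.re < N + 1) :
    IntegrableOn (fun t : ℝ => (t : ℂ) ^ (s - 1) * ((1 + t : ℂ) ^ N * (1 + t + y))⁻¹)
      (Ioi 0) := by
  refine (integrableOn_rpow_mul_one_add_rpow hs hsN).mono' ?_ ?_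
  · exact ((continuousOn_ofReal_cpow _).mul ((continuousOn_binomKernel N hy).mono
      Ioi_subset_Ici_self)).aestronglyMeasurable measurableSet_Ioi
  · filter_upwards [ae_restrict_mem measurableSet_Ioi] with t ht
    have ht' : (0 : ℝ) < t := ht
    rw [norm_mul, norm_cpow_eq_rpow_re_of_pos ht', sub_re, one_re]
    gcongr
    exact norm_binomKernel_le N hy ht'.le

theorem Gamma_nat_add_one_sub {s : ℂ} (hs : s.re < 1) (N : ℕ) :
    Gamma (N + 1 - s) = (-1) ^ N * (∏ k ∈ Finset.range N, (s - 1 - k)) * Gamma (1 - s) := by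
  induction N with
  | zero => simp
  | succ N ih =>
    have hne : (N + 1 - s : ℂ) ≠ 0 := by
      intro h
      have := congrArg re h
      simp at this
      linarith [Nat.cast_nonneg (α := ℝ) N]
    rw [show ((N + 1 : ℕ) : ℂ) + 1 - s = (N + 1 - s) + 1 by push_cast; ring,
      Gamma_add_one _ hne, ih, Finset.prod_range_succ]
    ring

/-- The remainder of the binomial series as a Stieltjes integral, where the series is the
expansion of a Stieltjes integral itself. -/
theorem binomial_remainder_of_re_lt_one {y : ℝ} (hy : 0 < y) {s : ℂ} (hs : 0 < s.re)
    (hs1 : s.re < 1) (N : ℕ) :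
    sin (Real.pi * s) / Real.pi * (-(y : ℂ)) ^ N *
      ∫ t : ℝ in Ioi 0, (t : ℂ) ^ (s - 1) * ((1 + t : ℂ) ^ N * (1 + t + y))⁻¹ =
    (1 + y : ℂ) ^ (s - 1) - ∑ n ∈ Finset.range N, binomCoeff (s - 1) n * (y : ℂ) ^ n := by
  have hs1' : 0 < (1 - s).re := by simp; linarith
  have hG1 := Gamma_ne_zero_of_re_pos hs
  have hG2 := Gamma_ne_zero_of_re_pos hs1'
  have hpi : (Real.pi : ℂ) ≠ 0 := by exact_mod_cast Real.pi_ne_zero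
  have hrefl := Gamma_mul_Gamma_one_sub s
  have hsin : sin (Real.pi * s) ≠ 0 := by
    intro h
    rw [h, div_zero] at hrefl
    exact mul_ne_zero hG1 hG2 hrefl
  have hrefl' : sin (Real.pi * s) / Real.pi * (Gamma s * Gamma (1 - s)) = 1 := by
    rw [hrefl]
    field_simp
  induction N with
  | zero =>
    have hy1 : (0 : ℝ) < 1 + y := by linarith
    have hy1c : (1 + y : ℂ) ≠ 0 := by exact_mod_cast hy1.ne'
    have hbeta := (integral_cpow_mul_one_add_cpow hs hs1').2
    have hsub := integral_comp_mul_left_Ioi' (fun t : ℝ => (t : ℂ) ^ (s - 1) *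
      ((1 + t : ℂ) ^ 0 * (1 + t + y))⁻¹) 0 hy1
    rw [mul_zero] at hsub
    rw [← hsub, real_smul]
    have h1 : ∫ t : ℝ in Ioi 0, (((1 + y) * t : ℝ) : ℂ) ^ (s - 1) *
        ((1 + ((1 + y) * t : ℝ) : ℂ) ^ 0 * (1 + ((1 + y) * t : ℝ) + y))⁻¹ =
        (1 + y : ℂ) ^ (s - 1) * (1 + y : ℂ)⁻¹ *
          ∫ t : ℝ in Ioi 0, (t : ℂ) ^ (s - 1) * (1 + t : ℂ) ^ (-(s + (1 - s))) := by
      rw [← integral_const_mul]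
      refine setIntegral_congr_fun measurableSet_Ioi fun t ht => ?_
      have ht' : (0 : ℝ) < t := ht
      have e1 : (((1 + y) * t : ℝ) : ℂ) ^ (s - 1) = (1 + y : ℂ) ^ (s - 1) * (t : ℂ) ^ (s - 1) := by
        rw [ofReal_mul, mul_cpow_ofReal_nonneg hy1.le ht'.le]
        push_cast
        rfl
      have e2 : (1 + t : ℂ) ^ (-(s + (1 - s))) = (1 + t : ℂ)⁻¹ := by
        rw [show -(s + (1 - s)) = -1 by ring, cpow_neg_one]
      have e3 : (1 + ((1 + y) * t : ℝ) + y : ℂ) = (1 + y) * (1 + t) := by push_cast; ring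
      rw [e1, e2, e3, pow_zero, one_mul, mul_inv]
      ring
    rw [h1, hbeta, add_sub_cancel, Gamma_one]
    push_cast
    simp only [pow_zero, Finset.range_zero, Finset.sum_empty, sub_zero, mul_one, div_one]
    field_simp
    field_simp at hrefl'
    linear_combination (1 + y : ℂ) ^ (s - 1) * hrefl'
  | succ N ih =>
    have hv : 0 < (N + 1 - s).re := by
      simp
      linarith [Nat.cast_nonneg (α := ℝ) N]
    obtain ⟨hbint, hbeta⟩ := integral_cpow_mul_one_add_cpow hs hv
    have hN1 : (s + (N + 1 - s) : ℂ) = ((N + 1 : ℕ) : ℂ) := by push_cast; ring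
    have hJ := integrableOn_binomKernel N hy hs
      (by linarith [Nat.cast_nonneg (α := ℝ) N] : s.re < N + 1)
    -- `y / ((1+t)^{N+1} (1+t+y)) = 1 / (1+t)^{N+1} - 1 / ((1+t)^N (1+t+y))`
    have hstep : (y : ℂ) * ∫ t : ℝ in Ioi 0, (t : ℂ) ^ (s - 1) *
        ((1 + t : ℂ) ^ (N + 1) * (1 + t + y))⁻¹ =
        Gamma s * Gamma (N + 1 - s) / Gamma (s + (N + 1 - s)) -
        ∫ t : ℝ in Ioi 0, (t : ℂ) ^ (s - 1) * ((1 + t : ℂ) ^ N * (1 + t + y))⁻¹ := by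
      rw [← hbeta, ← integral_sub hbint hJ, ← integral_const_mul]
      refine setIntegral_congr_fun measurableSet_Ioi fun t ht => ?_
      have ht' : (0 : ℝ) < t := ht
      have h1 : (1 + t : ℂ) ≠ 0 := by exact_mod_cast (show (0 : ℝ) < 1 + t by linarith).ne'
      have h2 : (1 + t + y : ℂ) ≠ 0 := by
        exact_mod_cast (show (0 : ℝ) < 1 + t + y by linarith).ne'
      rw [hN1, cpow_neg, cpow_natCast]
      field_simp
      ring
    rw [Finset.sum_range_succ, ← sub_sub, ← ih]
    have hG : Gamma (s + (N + 1 - s)) = N.factorial := by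
      rw [← Gamma_nat_eq_factorial]
      congr 1
      ring
    rw [hG, Gamma_nat_add_one_sub hs1] at hstep
    have hfac : (N.factorial : ℂ) ≠ 0 := by exact_mod_cast N.factorial_ne_zero
    have hsq : ((-1 : ℂ) ^ N) * (-1) ^ N = 1 := by rw [← mul_pow]; simp
    have hneg : (-(y : ℂ)) ^ N = (-1) ^ N * (y : ℂ) ^ N := by rw [← mul_pow]; simp
    rw [pow_succ, binomCoeff, hneg]
    linear_combination (-(sin (Real.pi * s) / Real.pi) * ((-1) ^ N * (y : ℂ) ^ N)) * hstep -
      (y : ℂ) ^ N * (∏ k ∈ Finset.range N, (s - 1 - k)) / N.factorial * hrefl' -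
      (sin (Real.pi * s) / Real.pi) * (y : ℂ) ^ N * (Gamma s * Gamma (1 - s)) *
        (∏ k ∈ Finset.range N, (s - 1 - k)) / N.factorial * hsq

/-- The remainder of the binomial series as a Stieltjes integral. The exponent is continued
analytically from the strip in which the untruncated integral converges. -/
theorem binomial_remainder {y : ℝ} (hy : 0 < y) {s : ℂ} (hs : 0 < s.re) {N : ℕ}
    (hsN : s.re < N + 1) :
    sin (Real.pi * s) / Real.pi * (-(y : ℂ)) ^ N *
      ∫ t : ℝ in Ioi 0, (t : ℂ) ^ (s - 1) * ((1 + t : ℂ) ^ N * (1 + t + y))⁻¹ =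
    (1 + y : ℂ) ^ (s - 1) - ∑ n ∈ Finset.range N, binomCoeff (s - 1) n * (y : ℂ) ^ n := by
  set U : Set ℂ := {s | 0 < s.re} ∩ {s | s.re < N + 1} with hU
  have hUo : IsOpen U := (isOpen_lt continuous_const continuous_re).inter
    (isOpen_lt continuous_re continuous_const)
  have hUc : IsPreconnected U :=
    ((convex_halfSpace_re_gt 0).inter (convex_halfSpace_re_lt _)).isPreconnected
  have hyc : (1 + y : ℂ) ≠ 0 := by exact_mod_cast (show (0 : ℝ) < 1 + y by linarith).ne'
  have hL : AnalyticOnNhd ℂ (fun s : ℂ => sin (Real.pi * s) / Real.pi * (-(y : ℂ)) ^ N *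
      ∫ t : ℝ in Ioi 0, (t : ℂ) ^ (s - 1) * ((1 + t : ℂ) ^ N * (1 + t + y))⁻¹) U := by
    refine DifferentiableOn.analyticOnNhd (fun s hs => ?_) hUo
    refine DifferentiableAt.differentiableWithinAt ?_
    refine DifferentiableAt.mul (by fun_prop) ?_
    have hO : (fun t : ℝ => ((1 + t : ℂ) ^ N * (1 + t + y))⁻¹) =O[atTop]
        fun t : ℝ => t ^ (-(N + 1 : ℝ)) := by
      refine Asymptotics.IsBigO.of_bound 1 ?_
      filter_upwards [eventually_gt_atTop 0] with t ht
      rw [one_mul, Real.norm_of_nonneg (Real.rpow_nonneg ht.le _)]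
      refine (norm_binomKernel_le N hy ht.le).trans ?_
      exact Real.rpow_le_rpow_of_nonpos ht (by linarith)
        (by linarith [Nat.cast_nonneg (α := ℝ) N])
    have hO0 : (fun t : ℝ => ((1 + t : ℂ) ^ N * (1 + t + y))⁻¹) =O[𝓝[>] 0]
        fun t : ℝ => t ^ (-(0 : ℝ)) := by
      refine Asymptotics.IsBigO.of_bound 1 ?_
      filter_upwards [self_mem_nhdsWithin] with t ht
      have ht' : (0 : ℝ) < t := ht
      simp only [neg_zero, Real.rpow_zero, norm_one, mul_one]
      refine (norm_binomKernel_le N hy ht'.le).trans ?_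
      exact Real.rpow_le_one_of_one_le_of_nonpos (by linarith)
        (by linarith [Nat.cast_nonneg (α := ℝ) N])
    have := mellin_differentiableAt_of_isBigO_rpow (s := s)
      (((continuousOn_binomKernel N hy).mono Ioi_subset_Ici_self).locallyIntegrableOn
        measurableSet_Ioi) hO hs.2 hO0 hs.1
    simpa only [mellin, smul_eq_mul] using! this
  have hR : AnalyticOnNhd ℂ (fun s : ℂ => (1 + y : ℂ) ^ (s - 1) -
      ∑ n ∈ Finset.range N, binomCoeff (s - 1) n * (y : ℂ) ^ n) U := by
    refine DifferentiableOn.analyticOnNhd (Differentiable.differentiableOn ?_) hUo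
    refine Differentiable.sub ?_ ?_
    · intro s
      exact (by fun_prop : DifferentiableAt ℂ (fun s : ℂ => s - 1) s).const_cpow (Or.inl hyc)
    · unfold binomCoeff
      fun_prop
  have hhalf : (1 / 2 : ℂ) ∈ U := by
    constructor
    · simp
    · simp
      linarith [Nat.cast_nonneg (α := ℝ) N]
  refine hL.eqOn_of_preconnected_of_eventuallyEq hR hUc hhalf ?_ ⟨hs, hsN⟩
  have hnear : {s : ℂ | 0 < s.re} ∩ {s | s.re < 1} ∈ 𝓝 (1 / 2 : ℂ) := by
    refine IsOpen.mem_nhds ((isOpen_lt continuous_const continuous_re).inter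
      (isOpen_lt continuous_re continuous_const)) ⟨?_, ?_⟩ <;> norm_num
  filter_upwards [hnear] with s hs using binomial_remainder_of_re_lt_one hy hs.1 hs.2 N

/-! ### The remainder for the modified Bessel function on the positive axis -/

/-- Poisson's integral, a multiple of `z^{-ν} K_ν(z)`. -/
noncomputable def poissonIntegral (ν : ℂ) (z : ℝ) : ℂ :=
  ∫ t : ℝ in Ioi 0, (t : ℂ) ^ (ν - 1 / 2) * (1 + t : ℂ) ^ (ν - 1 / 2) * exp (-((1 + 2 * t) * z))

/-- The coefficients `a_n(ν)` are the binomial coefficients of `(1+u)^{ν-1/2}`, multiplied by the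
integrals of the powers. -/
theorem a_mul_Gamma {ν : ℂ} (hν : 0 < (ν + 1 / 2).re) (n : ℕ) :
    a n ν * 2 ^ n * Gamma (ν + 1 / 2) = binomCoeff (ν + 1 / 2 - 1) n * Gamma (ν + 1 / 2 + n) := by
  have hne : ∀ k : ℕ, ν + 1 / 2 + k ≠ 0 := by
    intro k h
    have := congrArg re h
    rw [add_re] at this
    simp only [natCast_re, zero_re] at this
    linarith [Nat.cast_nonneg (α := ℝ) k]
  have hprod : ∀ n : ℕ, (∏ k ∈ Finset.range n, (4 * ν ^ 2 - (2 * (k : ℂ) + 1) ^ 2)) *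
      Gamma (ν + 1 / 2) =
      4 ^ n * (∏ k ∈ Finset.range n, (ν + 1 / 2 - 1 - k)) * Gamma (ν + 1 / 2 + n) := by
    intro n
    induction n with
    | zero => simp
    | succ n ih =>
      rw [Finset.prod_range_succ, Finset.prod_range_succ, Nat.cast_succ, ← add_assoc,
        Gamma_add_one _ (hne n), pow_succ (4 : ℂ)]
      generalize ∏ k ∈ Finset.range n, (4 * ν ^ 2 - (2 * (k : ℂ) + 1) ^ 2) = A at ih ⊢
      generalize ∏ k ∈ Finset.range n, (ν + 1 / 2 - 1 - (k : ℂ)) = B at ih ⊢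
      linear_combination (4 * ν ^ 2 - (2 * (n : ℂ) + 1) ^ 2) * ih
  have h8 : (8 : ℂ) ^ n = 2 ^ n * 4 ^ n := by rw [← mul_pow]; norm_num
  have hfac : (n.factorial : ℂ) ≠ 0 := by exact_mod_cast n.factorial_ne_zero
  have := hprod n
  rw [a, binomCoeff, h8]
  generalize ∏ k ∈ Finset.range n, (4 * ν ^ 2 - (2 * (k : ℂ) + 1) ^ 2) = A at this ⊢
  generalize ∏ k ∈ Finset.range n, (ν + 1 / 2 - 1 - (k : ℂ)) = B at this ⊢
  generalize Gamma (ν + 1 / 2) = C at this ⊢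
  generalize Gamma (ν + 1 / 2 + n) = D at this ⊢
  field_simp
  linear_combination this

/-- Hankel's form of Poisson's integral, by the substitution `y = 2zt`. -/
theorem integral_hankel_eq {ν : ℂ} {z : ℝ} (hz : 0 < z) :
    ∫ y : ℝ in Ioi 0, (y : ℂ) ^ (ν + 1 / 2 - 1) * exp (-y) *
      (1 + (y / (2 * z) : ℝ) : ℂ) ^ (ν + 1 / 2 - 1) =
    (2 * z : ℂ) ^ (ν + 1 / 2) * exp z * poissonIntegral ν z := by
  have hz2 : 0 < 2 * z := by linarith
  have hz2c : (2 * z : ℂ) ≠ 0 := by exact_mod_cast hz2.ne'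
  have hsub := integral_comp_mul_left_Ioi' (fun y : ℝ => (y : ℂ) ^ (ν + 1 / 2 - 1) * exp (-y) *
      (1 + (y / (2 * z) : ℝ) : ℂ) ^ (ν + 1 / 2 - 1)) 0 hz2
  rw [mul_zero] at hsub
  rw [← hsub, real_smul, poissonIntegral, ← integral_const_mul, ← integral_const_mul]
  refine setIntegral_congr_fun measurableSet_Ioi fun t ht => ?_
  have ht' : (0 : ℝ) < t := ht
  have e1 : ((2 * z * t : ℝ) : ℂ) ^ (ν + 1 / 2 - 1) =
      (2 * z : ℂ) ^ (ν + 1 / 2 - 1) * (t : ℂ) ^ (ν + 1 / 2 - 1) := by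
    rw [ofReal_mul, mul_cpow_ofReal_nonneg hz2.le ht'.le]
    push_cast
    rfl
  have e2 : 2 * z * t / (2 * z) = t := by field_simp
  have e3 : exp (-((2 * z * t : ℝ) : ℂ)) = exp z * exp (-((1 + 2 * t) * z)) := by
    rw [← exp_add]
    push_cast
    ring_nf
  have e4 : (2 * z : ℂ) ^ (ν + 1 / 2) = 2 * z * (2 * z : ℂ) ^ (ν + 1 / 2 - 1) := by
    rw [cpow_sub (ν + 1 / 2) 1 hz2c, cpow_one, mul_div_cancel₀ _ hz2c]
  rw [e1, e2, e3, e4, show ν + 1 / 2 - 1 = ν - 1 / 2 by ring]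
  push_cast
  ring

/-- The integral of the theorem for `λ = ν + 1/2`, at a positive point, reduced to the remainder
of the binomial series. -/
theorem Gamma_mul_integral_integrand_self {ν : ℂ} {N : ℕ} (hν : 0 < (ν + 1 / 2).re)
    (hνN : (ν + 1 / 2).re < N + 1) (x : ℝ) :
    Gamma (ν + 1 / 2) * (Gamma (N + (ν + 1 / 2)) *
      ∫ t : ℝ in Ioi 0, integrand Lam N ν (ν + 1 / 2) x t) =
    ∫ y : ℝ in Ioi 0, (y : ℂ) ^ (N + (ν + 1 / 2) - 1) * exp (-y) * ∫ t : ℝ in Ioi 0,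
      (t : ℂ) ^ (ν + 1 / 2 - 1) *
        ((1 + t : ℂ) ^ N * (1 + t + (y / (2 * Real.exp x) : ℝ)))⁻¹ := by
  set s := ν + 1 / 2 with hs
  have hp : 0 < ((N : ℂ) + s).re := by rw [add_re, natCast_re]; positivity
  have hGs := Gamma_ne_zero_of_re_pos hν
  set f : ℝ → ℝ → ℂ := fun t y => ((t : ℂ) ^ (s - 1) *
    ((1 + t : ℂ) ^ N * (1 + t + (y / (2 * Real.exp x) : ℝ)))⁻¹) *
    ((y : ℂ) ^ (N + s - 1) * exp (-y)) with hf
  have hypos : ∀ y : ℝ, 0 < y → 0 < y / (2 * Real.exp x) := fun y hy => by positivity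
  have hne : ∀ t y : ℝ, 0 < t → 0 < y →
      (1 + t : ℂ) ≠ 0 ∧ (1 + t + (y / (2 * Real.exp x) : ℝ) : ℂ) ≠ 0 := by
    intro t y ht hy
    have := hypos y hy
    exact ⟨by exact_mod_cast (show (0 : ℝ) < 1 + t by linarith).ne',
      by exact_mod_cast (show (0 : ℝ) < 1 + t + y / (2 * Real.exp x) by linarith).ne'⟩
  have hcont : ContinuousOn (Function.uncurry f) (Ioi 0 ×ˢ Ioi 0) := by
    have h1 : ContinuousOn (fun p : ℝ × ℝ => (p.1 : ℂ) ^ (s - 1)) (Ioi 0 ×ˢ Ioi 0) :=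
      (continuousOn_ofReal_cpow _).comp continuousOn_fst fun p hp => hp.1
    have h2 : ContinuousOn (fun p : ℝ × ℝ => (p.2 : ℂ) ^ (N + s - 1)) (Ioi 0 ×ˢ Ioi 0) :=
      (continuousOn_ofReal_cpow _).comp continuousOn_snd fun p hp => hp.2
    refine (h1.mul (ContinuousOn.inv₀ (by fun_prop) fun p hp => ?_)).mul (h2.mul (by fun_prop))
    obtain ⟨g1, g2⟩ := hne p.1 p.2 hp.1 hp.2
    exact mul_ne_zero (pow_ne_zero _ g1) g2
  have hmeas : AEStronglyMeasurable (Function.uncurry f)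
      ((volume.restrict (Ioi 0)).prod (volume.restrict (Ioi 0))) := by
    rw [Measure.prod_restrict]
    exact hcont.aestronglyMeasurable (measurableSet_Ioi.prod measurableSet_Ioi)
  have hgam := (integral_cpow_mul_exp_neg_mul_Ioi_of_re_pos (r := 1) hp (by simp)).1.norm
  have hprod : Integrable (Function.uncurry f)
      ((volume.restrict (Ioi 0)).prod (volume.restrict (Ioi 0))) := by
    refine ((integrableOn_rpow_mul_one_add_rpow hν hνN).mul_prod hgam).mono' hmeas ?_
    rw [Measure.prod_restrict]
    filter_upwards [ae_restrict_mem (measurableSet_Ioi.prod measurableSet_Ioi)] with q hq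
    have h1 : (0 : ℝ) < q.1 := hq.1
    have h2 : (0 : ℝ) < q.2 := hq.2
    simp only [Function.uncurry, hf]
    rw [norm_mul, norm_mul ((q.1 : ℂ) ^ (s - 1)), norm_cpow_eq_rpow_re_of_pos h1, sub_re, one_re,
      one_mul]
    gcongr
    exact norm_binomKernel_le N (hypos _ h2) h1.le
  have hswap := integral_integral_swap hprod
  calc _ = ∫ t : ℝ in Ioi 0, ∫ y : ℝ in Ioi 0, f t y := by
        rw [← integral_const_mul, ← integral_const_mul]
        refine setIntegral_congr_fun measurableSet_Ioi fun t ht => ?_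
        have ht' : (0 : ℝ) < t := ht
        have ht1c := (hne t 1 ht' one_pos).1
        have hLam := Gamma_mul_Lam_ofReal hp (x + Real.log (2 * (1 + t)))
        have hcp : (1 + t : ℂ) ^ (N + s) ≠ 0 := by
          rw [Ne, cpow_eq_zero_iff]
          exact fun h => ht1c h.1
        have hF := hyperF_neg_self (b := -ν + 1 / 2) hν ht'.le
        have e0 : (1 + t : ℂ) ^ (-(-ν + 1 / 2 : ℂ)) = (1 + t : ℂ) ^ (N + s) *
            ((1 + t : ℂ) ^ (N + 1))⁻¹ := by
          rw [← cpow_natCast, ← cpow_neg, ← cpow_add _ _ ht1c]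
          congr 1
          rw [hs]
          push_cast
          ring
        have hint : integrand Lam N ν s x t = (t : ℂ) ^ (s - 1) * ((1 + t : ℂ) ^ (N + 1))⁻¹ /
            Gamma s * Lam (N + s) ((x + Real.log (2 * (1 + t)) : ℝ) : ℂ) := by
          rw [integrand, ← hs, hF, e0]
          push_cast
          field_simp
        rw [hint]
        have h3 : ∫ y : ℝ in Ioi 0, f t y = (t : ℂ) ^ (s - 1) * ((1 + t : ℂ) ^ (N + 1))⁻¹ *
            (Gamma (N + s) * Lam (N + s) ((x + Real.log (2 * (1 + t)) : ℝ) : ℂ)) := by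
          rw [hLam, ← integral_const_mul]
          refine setIntegral_congr_fun measurableSet_Ioi fun y hy => ?_
          have e1 : exp (-((x + Real.log (2 * (1 + t)) : ℝ) : ℂ)) =
              (2 * Real.exp x * (1 + t) : ℂ)⁻¹ := by
            rw [← ofReal_neg, ← ofReal_exp, Real.exp_neg, Real.exp_add,
              Real.exp_log (by positivity)]
            push_cast
            ring
          obtain ⟨g1, g2⟩ := hne t y ht' hy
          have hE : ((Real.exp x : ℝ) : ℂ) ≠ 0 := by exact_mod_cast (Real.exp_pos x).ne'
          have e2 : (1 + y * (2 * Real.exp x * (1 + t) : ℂ)⁻¹)⁻¹ =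
              (1 + t) * (1 + t + (y / (2 * Real.exp x) : ℝ) : ℂ)⁻¹ := by
            have h5 : (1 + y * (2 * Real.exp x * (1 + t) : ℂ)⁻¹) =
                (1 + t + (y / (2 * Real.exp x) : ℝ) : ℂ) / (1 + t) := by
              rw [ofReal_div, ofReal_mul, ofReal_ofNat]
              field_simp
            rw [h5, inv_div, div_eq_mul_inv]
          simp only [hf]
          rw [e1, e2]
          rw [mul_inv, pow_succ, mul_inv]
          field_simp
        rw [h3]
        field_simp
    _ = _ := by
        rw [hswap]
        refine setIntegral_congr_fun measurableSet_Ioi fun y _ => ?_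
        simp only [hf]
        rw [integral_mul_const, mul_comm]

/-- On the positive axis and for `λ = ν + 1/2`, the right-hand side of the theorem is the
remainder of the large-`z` expansion of Poisson's integral. -/
theorem rhs_self_eq_poissonIntegral {ν : ℂ} {N : ℕ} (hν : 0 < (ν + 1 / 2).re)
    (hνN : (ν + 1 / 2).re < N + 1) (x : ℝ) :
    (-1) ^ N * (cos (Real.pi * ν) / Real.pi) * (1 / 2 ^ N) * (1 / exp x ^ N) *
      (Gamma (N + (ν + 1 / 2)) * ∫ t : ℝ in Ioi 0, integrand Lam N ν (ν + 1 / 2) x t) =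
    (2 * Real.exp x : ℂ) ^ (ν + 1 / 2) * exp (Real.exp x) *
      poissonIntegral ν (Real.exp x) / Gamma (ν + 1 / 2) -
      ∑ n ∈ Finset.range N, a n ν / exp x ^ n := by
  set s := ν + 1 / 2 with hs
  have hGs := Gamma_ne_zero_of_re_pos hν
  set z := Real.exp x with hz
  have hz0 : 0 < z := Real.exp_pos x
  have hzc : (z : ℂ) ≠ 0 := by exact_mod_cast hz0.ne'
  have hez : exp (x : ℂ) = z := by rw [hz]; push_cast; rfl
  have hsin : cos (Real.pi * ν) = sin (Real.pi * s) := by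
    rw [hs, mul_add, mul_one_div, sin_add_pi_div_two]
  have hgam : ∀ n : ℕ, IntegrableOn (fun y : ℝ => (y : ℂ) ^ (s - 1) * exp (-y) *
      (binomCoeff (s - 1) n * ((y / (2 * z) : ℝ) : ℂ) ^ n)) (Ioi 0) ∧
      ∫ y : ℝ in Ioi 0, (y : ℂ) ^ (s - 1) * exp (-y) *
      (binomCoeff (s - 1) n * ((y / (2 * z) : ℝ) : ℂ) ^ n) = Gamma s * (a n ν / z ^ n) := by
    intro n
    have hsn : 0 < (s + n).re := by rw [add_re, natCast_re]; positivity
    obtain ⟨h1, h2⟩ := integral_cpow_mul_exp_neg_mul_Ioi_of_re_pos (r := 1) hsn (by simp)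
    have hcongr : ∀ y ∈ Ioi (0 : ℝ), (binomCoeff (s - 1) n / (2 * z : ℂ) ^ n) *
        ((y : ℂ) ^ (s + n - 1) * exp (-(1 * y))) = (y : ℂ) ^ (s - 1) * exp (-y) *
        (binomCoeff (s - 1) n * ((y / (2 * z) : ℝ) : ℂ) ^ n) := by
      intro y hy
      have hy0 : (y : ℂ) ≠ 0 := by exact_mod_cast (ne_of_gt hy)
      rw [show s + n - 1 = (s - 1) + n by ring, cpow_add _ _ hy0, cpow_natCast, one_mul]
      push_cast
      rw [div_pow]
      ring
    refine ⟨IntegrableOn.congr_fun (h1.const_mul _) hcongr measurableSet_Ioi, ?_⟩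
    rw [← setIntegral_congr_fun measurableSet_Ioi hcongr, integral_const_mul, h2, one_cpow,
      one_mul, mul_pow]
    have := a_mul_Gamma hν n
    rw [← hs] at this
    field_simp
    linear_combination -this
  have hmain : IntegrableOn (fun y : ℝ => (y : ℂ) ^ (s - 1) * exp (-y) *
      (1 + (y / (2 * z) : ℝ) : ℂ) ^ (s - 1)) (Ioi 0) := by
    have h1 := (integrableOn_rpow_mul_one_add_rpow_mul_exp (s.re - 1) hν
      (by positivity : 0 < 2 * z)).const_mul ((2 * z) ^ (s.re - 1))
    have hcomp := integrableOn_Ioi_comp_mul_left_iff (fun y : ℝ => (y : ℂ) ^ (s - 1) * exp (-y) *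
      (1 + (y / (2 * z) : ℝ) : ℂ) ^ (s - 1)) 0 (by positivity : 0 < 2 * z)
    rw [mul_zero] at hcomp
    refine hcomp.1 ?_
    refine h1.mono' ?_ ?_
    · refine ContinuousOn.aestronglyMeasurable ?_ measurableSet_Ioi
      intro t ht
      have ht' : (0 : ℝ) < t := ht
      have e2 : ∀ t : ℝ, 2 * z * t / (2 * z) = t := fun t => by field_simp
      simp only [e2]
      refine ContinuousAt.continuousWithinAt ?_
      refine ContinuousAt.mul (ContinuousAt.mul ?_ (by fun_prop)) ?_
      · exact (continuousAt_ofReal_cpow_const (2 * z * t) _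
          (Or.inr (by positivity : 0 < 2 * z * t).ne')).comp (f := fun t : ℝ => 2 * z * t)
          (by fun_prop)
      · refine (continuousAt_const.add continuous_ofReal.continuousAt).cpow continuousAt_const ?_
        left
        simp
        linarith
    · filter_upwards [ae_restrict_mem measurableSet_Ioi] with t ht
      have ht' : (0 : ℝ) < t := ht
      have e2 : 2 * z * t / (2 * z) = t := by field_simp
      rw [e2, norm_mul, norm_mul, norm_cpow_eq_rpow_re_of_pos (by positivity : 0 < 2 * z * t),
        norm_one_add_cpow ht', Complex.norm_exp, Real.mul_rpow (by positivity) ht'.le]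
      simp only [sub_re, one_re, neg_re, ofReal_re]
      apply le_of_eq
      ring
  have hself := Gamma_mul_integral_integrand_self hν hνN x
  rw [← hs, ← hz] at hself
  apply mul_left_cancel₀ hGs
  calc _ = (-1) ^ N * (sin (Real.pi * s) / Real.pi) * (1 / 2 ^ N) * (1 / z ^ N) *
        (Gamma s * (Gamma (N + s) * ∫ t : ℝ in Ioi 0, integrand Lam N ν s x t)) := by
        rw [hsin, hez]
        ring
    _ = ∫ y : ℝ in Ioi 0, (y : ℂ) ^ (s - 1) * exp (-y) *
        ((1 + (y / (2 * z) : ℝ) : ℂ) ^ (s - 1) -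
          ∑ n ∈ Finset.range N, binomCoeff (s - 1) n * ((y / (2 * z) : ℝ) : ℂ) ^ n) := by
        rw [hself, ← integral_const_mul]
        refine setIntegral_congr_fun measurableSet_Ioi fun y hy => ?_
        have hy' : (0 : ℝ) < y := hy
        have hy0 : (y : ℂ) ≠ 0 := by exact_mod_cast hy'.ne'
        rw [← binomial_remainder (by positivity : 0 < y / (2 * z)) hν hνN,
          show (N : ℂ) + s - 1 = N + (s - 1) by ring, cpow_add _ _ hy0, cpow_natCast]
        have e1 : (-((y / (2 * z) : ℝ) : ℂ)) ^ N =
            (-1) ^ N * (y : ℂ) ^ N * (1 / 2 ^ N) * (1 / z ^ N) := by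
          push_cast
          rw [neg_pow, div_pow, mul_pow]
          field_simp
        rw [e1]
        ring
    _ = (∫ y : ℝ in Ioi 0, (y : ℂ) ^ (s - 1) * exp (-y) *
          (1 + (y / (2 * z) : ℝ) : ℂ) ^ (s - 1)) -
        ∑ n ∈ Finset.range N, ∫ y : ℝ in Ioi 0, (y : ℂ) ^ (s - 1) * exp (-y) *
          (binomCoeff (s - 1) n * ((y / (2 * z) : ℝ) : ℂ) ^ n) := by
        rw [← integral_finsetSum _ fun n _ => (hgam n).1, ← integral_sub hmain
          (integrable_finsetSum _ fun n _ => (hgam n).1)]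
        congr 1 with y
        rw [mul_sub, Finset.mul_sum]
    _ = _ := by
        rw [integral_hankel_eq hz0, Finset.sum_congr rfl fun n _ => (hgam n).2, ← Finset.mul_sum,
          mul_sub, hez, ← hs]
        field_simp


/-! ### The entire function behind the Bessel functions -/

/-- The entire function `∑ₖ wᵏ / (k! Γ(μ+k+1))`: both `I_μ(z)` and `J_μ(z)` are `(z/2)^μ` times its
value, at `w = z²/4` and at `w = -z²/4`. -/
noncomputable def besselSeries (μ w : ℂ) : ℂ :=
  ∑' k : ℕ, w ^ k / ((k.factorial : ℂ) * Gamma (μ + k + 1))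

theorem besselI_eq (ν ζ : ℂ) :
    besselI ν ζ = exp (ν * (ζ - Real.log 2)) * besselSeries ν ((exp ζ / 2) ^ 2) := by
  simp only [besselI, besselSeries, pow_mul]

theorem besselJ_eq (ν ζ : ℂ) :
    besselJ ν ζ = exp (ν * (ζ - Real.log 2)) * besselSeries ν (-(exp ζ / 2) ^ 2) := by
  simp only [besselJ, besselSeries, pow_mul]
  congr 2 with k
  rw [neg_pow (a := _ ^ 2)]

/-- A bound on the coefficients, uniform in the order; it makes the series holomorphic in `μ` as well
as in `w`. -/
theorem exists_norm_inv_Gamma_add_nat_le (R : ℝ) :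
    ∃ M : ℝ, 0 ≤ M ∧ ∀ μ : ℂ, ‖μ‖ ≤ R → ∀ k : ℕ, ‖(Gamma (μ + k + 1))⁻¹‖ ≤ M := by
  have hC : ∀ k : ℕ, ∃ C : ℝ, ∀ μ : ℂ, ‖μ‖ ≤ R → ‖(Gamma (μ + k + 1))⁻¹‖ ≤ C := by
    intro k
    have hcont : Continuous fun μ : ℂ => (Gamma (μ + k + 1))⁻¹ :=
      differentiable_one_div_Gamma.continuous.comp (by fun_prop)
    obtain ⟨C, hC⟩ := (isCompact_closedBall (0 : ℂ) R).exists_bound_of_continuousOn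
      hcont.continuousOn
    exact ⟨C, fun μ hμ => hC μ (by simpa using hμ)⟩
  choose C hC using hC
  set K := ⌈R⌉₊ with hK
  have hsum : ∀ k ≤ K, C k ≤ ∑ j ∈ Finset.range (K + 1), |C j| := fun k hk =>
    (le_abs_self _).trans (Finset.single_le_sum (f := fun j => |C j|) (fun _ _ => abs_nonneg _)
      (Finset.mem_range.2 (by omega)))
  refine ⟨∑ j ∈ Finset.range (K + 1), |C j|, by positivity, fun μ hμ k => ?_⟩
  rcases le_total k K with hk | hk
  · exact (hC k μ hμ).trans (hsum k hk)
  · -- beyond `K` the recurrence of the Gamma function only decreases the norm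
    induction k, hk using Nat.le_induction with
    | base => exact (hC K μ hμ).trans (hsum K le_rfl)
    | succ k hk ih =>
      have h1 := one_div_Gamma_eq_self_mul_one_div_Gamma_add_one (μ + k + 1)
      have h2 : (1 : ℝ) ≤ ‖μ + k + 1‖ := by
        have h3 : R ≤ k := (Nat.le_ceil R).trans (by exact_mod_cast hk)
        have h4 : ‖((k + 1 : ℕ) : ℂ)‖ ≤ ‖μ + k + 1‖ + ‖μ‖ := by
          rw [show ((k + 1 : ℕ) : ℂ) = (μ + k + 1) - μ by push_cast; ring]
          exact norm_sub_le _ _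
        rw [norm_natCast] at h4
        push_cast at h4
        linarith
      rw [show μ + ((k + 1 : ℕ) : ℂ) + 1 = μ + k + 1 + 1 by push_cast; ring]
      refine le_trans ?_ ih
      rw [h1, norm_mul]
      exact le_mul_of_one_le_left (norm_nonneg _) h2

theorem norm_besselSeries_term_le {μ w : ℂ} {M R : ℝ} (hw : ‖w‖ ≤ R) (k : ℕ)
    (h : ‖(Gamma (μ + k + 1))⁻¹‖ ≤ M) :
    ‖w ^ k / ((k.factorial : ℂ) * Gamma (μ + k + 1))‖ ≤ M * (R ^ k / k.factorial) := by
  have hR : 0 ≤ R := (norm_nonneg _).trans hw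
  have hM : 0 ≤ M := (norm_nonneg _).trans h
  rw [div_eq_mul_inv, mul_inv, norm_mul, norm_mul, norm_pow, norm_inv, norm_natCast]
  calc ‖w‖ ^ k * ((k.factorial : ℝ)⁻¹ * ‖(Gamma (μ + k + 1))⁻¹‖)
      ≤ R ^ k * ((k.factorial : ℝ)⁻¹ * M) := by gcongr
    _ = _ := by ring

theorem summable_besselSeries (μ w : ℂ) :
    Summable fun k : ℕ => w ^ k / ((k.factorial : ℂ) * Gamma (μ + k + 1)) := by
  obtain ⟨M, -, hM⟩ := exists_norm_inv_Gamma_add_nat_le ‖μ‖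
  exact Summable.of_norm_bounded ((Real.summable_pow_div_factorial ‖w‖).mul_left M) fun k =>
    norm_besselSeries_term_le le_rfl k (hM μ le_rfl k)

theorem exists_norm_besselSeries_le (R : ℝ) :
    ∃ M : ℝ, 0 ≤ M ∧ ∀ μ : ℂ, ‖μ‖ ≤ R → ∀ w, ‖besselSeries μ w‖ ≤ M * Real.exp ‖w‖ := by
  obtain ⟨M, hM0, hM⟩ := exists_norm_inv_Gamma_add_nat_le R
  refine ⟨M, hM0, fun μ hμ w => ?_⟩
  rw [Real.exp_eq_exp_ℝ, NormedSpace.exp_eq_tsum_div, ← tsum_mul_left]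
  exact tsum_of_norm_bounded ((Real.summable_pow_div_factorial ‖w‖).mul_left M).hasSum fun k =>
    norm_besselSeries_term_le le_rfl k (hM μ hμ k)

theorem hasDerivAt_besselSeries (μ w : ℂ) :
    HasDerivAt (besselSeries μ) (besselSeries (μ + 1) w) w := by
  obtain ⟨M, -, hM⟩ := exists_norm_inv_Gamma_add_nat_le ‖μ‖
  set U := Metric.ball (0 : ℂ) (‖w‖ + 1)
  have hwU : w ∈ U := by simp [U]
  have hdiff : ∀ k : ℕ, DifferentiableOn ℂ
      (fun w : ℂ => w ^ k / ((k.factorial : ℂ) * Gamma (μ + k + 1))) U := fun k => by fun_prop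
  have hbd : ∀ (k : ℕ), ∀ w' ∈ U, ‖w' ^ k / ((k.factorial : ℂ) * Gamma (μ + k + 1))‖ ≤
      M * ((‖w‖ + 1) ^ k / k.factorial) := fun k w' hw' =>
    norm_besselSeries_term_le (by simpa [U] using (Metric.mem_ball.1 hw').le) k (hM μ le_rfl k)
  have hu := (Real.summable_pow_div_factorial (‖w‖ + 1)).mul_left M
  have hd := (differentiableOn_tsum_of_summable_norm hu hdiff Metric.isOpen_ball hbd).differentiableAt
    (Metric.isOpen_ball.mem_nhds hwU)
  have hs := hasSum_deriv_of_summable_norm hu hdiff Metric.isOpen_ball hbd hwU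
  have hval : besselSeries (μ + 1) w =
      deriv (fun w : ℂ => ∑' k : ℕ, w ^ k / ((k.factorial : ℂ) * Gamma (μ + k + 1))) w := by
    rw [← hs.tsum_eq, hs.summable.tsum_eq_zero_add, besselSeries]
    simp only [pow_zero, deriv_const', deriv_div_const, deriv_pow_field, zero_div, zero_add]
    refine tsum_congr fun k => ?_
    have hf : ((k : ℂ) + 1) ≠ 0 := by exact_mod_cast k.succ_ne_zero
    rw [show μ + ((k + 1 : ℕ) : ℂ) + 1 = μ + 1 + k + 1 by push_cast; ring, Nat.factorial_succ,
      Nat.add_sub_cancel]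
    push_cast
    rw [mul_assoc, mul_div_mul_left _ _ hf]
  rw [hval]
  exact hd.hasDerivAt

/-- The three-term recurrence of the Bessel functions. -/
theorem besselSeries_contiguous (μ w : ℂ) :
    besselSeries μ w = (μ + 1) * besselSeries (μ + 1) w + w * besselSeries (μ + 2) w := by
  have h1 := (summable_besselSeries (μ + 1) w).hasSum.mul_left (μ + 1)
  have h2 := (summable_besselSeries (μ + 2) w).hasSum.mul_left w
  have h3 : HasSum (fun k : ℕ => (k : ℂ) * (w ^ k / ((k.factorial : ℂ) * Gamma (μ + 1 + k + 1))))
      (w * besselSeries (μ + 2) w) := by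
    rw [← hasSum_nat_add_iff' 1]
    simp only [Finset.range_one, Finset.sum_singleton, Nat.cast_zero, zero_mul, sub_zero]
    refine h2.congr_fun ?_
    intro k
    have hf : ((k : ℂ) + 1) ≠ 0 := by exact_mod_cast k.succ_ne_zero
    rw [show μ + 1 + ((k + 1 : ℕ) : ℂ) + 1 = μ + 2 + k + 1 by push_cast; ring, Nat.factorial_succ,
      pow_succ]
    push_cast
    rw [mul_assoc, ← mul_div_assoc, mul_div_mul_left _ _ hf]
    ring
  refine (HasSum.tsum_eq ?_)
  refine (h1.add h3).congr_fun ?_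
  intro k
  have h4 := one_div_Gamma_eq_self_mul_one_div_Gamma_add_one (μ + k + 1)
  rw [div_eq_mul_inv, mul_inv, h4, show μ + 1 + k + 1 = μ + k + 1 + 1 by ring, div_eq_mul_inv,
    mul_inv]
  ring

theorem differentiable_besselSeries_param (w : ℂ) : Differentiable ℂ fun μ => besselSeries μ w := by
  intro μ
  obtain ⟨M, -, hM⟩ := exists_norm_inv_Gamma_add_nat_le (‖μ‖ + 1)
  set U := Metric.ball (0 : ℂ) (‖μ‖ + 1)
  have hμU : μ ∈ U := by simp [U]
  refine (differentiableOn_tsum_of_summable_norm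
    ((Real.summable_pow_div_factorial ‖w‖).mul_left M) (fun k => ?_) Metric.isOpen_ball
    fun k μ' hμ' => norm_besselSeries_term_le le_rfl k (hM μ' ?_ k)).differentiableAt
    (Metric.isOpen_ball.mem_nhds hμU)
  · have h : Differentiable ℂ fun μ : ℂ => (Gamma (μ + k + 1))⁻¹ :=
      differentiable_one_div_Gamma.comp (by fun_prop)
    simp only [div_eq_mul_inv, mul_inv]
    exact ((h.const_mul _).const_mul _).differentiableOn
  · simpa [U] using (Metric.mem_ball.1 hμ').le

theorem besselSeries_zero (μ : ℂ) : besselSeries μ 0 = (Gamma (μ + 1))⁻¹ := by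
  rw [besselSeries, tsum_eq_single 0 fun k hk => by simp [hk]]
  simp

/-- The Wronskian of `I_ν` and `I_{-ν}`. -/
theorem besselSeries_wronskian (ν w : ℂ) :
    w * besselSeries (ν + 1) w * besselSeries (-ν) w -
      besselSeries (-ν - 1) w * besselSeries ν w = sin (Real.pi * ν) / Real.pi := by
  have hconst : ∀ w, HasDerivAt (fun w => w * besselSeries (ν + 1) w * besselSeries (-ν) w -
      besselSeries (-ν - 1) w * besselSeries ν w) 0 w := by
    intro w
    have h := (((hasDerivAt_id w).mul (hasDerivAt_besselSeries (ν + 1) w)).mul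
      (hasDerivAt_besselSeries (-ν) w)).sub ((hasDerivAt_besselSeries (-ν - 1) w).mul
      (hasDerivAt_besselSeries ν w))
    refine h.congr_deriv ?_
    have h1 := besselSeries_contiguous ν w
    have h2 := besselSeries_contiguous (-ν - 1) w
    rw [show -ν - 1 + 1 = -ν by ring, show -ν - 1 + 2 = -ν + 1 by ring] at h2
    rw [show ν + 1 + 1 = ν + 2 by ring, show -ν - 1 + 1 = -ν by ring]
    simp only [id, Pi.mul_apply]
    linear_combination (-besselSeries (-ν) w) * h1 - besselSeries (ν + 1) w * h2
  have h := is_const_of_deriv_eq_zero (fun w => (hconst w).differentiableAt)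
    (fun w => (hconst w).deriv) w 0
  rw [h, besselSeries_zero (-ν - 1), besselSeries_zero ν, zero_mul, zero_mul, zero_sub, sub_add_cancel]
  have hr := Gamma_mul_Gamma_one_sub (-ν)
  rw [sub_neg_eq_add, mul_neg, sin_neg] at hr
  rw [← mul_inv, add_comm ν 1, hr, inv_div]
  ring


/-! ### Poisson's integral -/

/-- Poisson's integral with an additional factor `(1 + 2t)^j`. -/
noncomputable def poissonMoment (j : ℕ) (ν : ℂ) (z : ℝ) : ℂ :=
  ∫ t : ℝ in Ioi 0, (t : ℂ) ^ (ν - 1 / 2) * (1 + t : ℂ) ^ (ν - 1 / 2) * (1 + 2 * t : ℂ) ^ j *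
    exp (-((1 + 2 * t) * z))

theorem poissonMoment_zero (ν : ℂ) (z : ℝ) : poissonMoment 0 ν z = poissonIntegral ν z := by
  simp [poissonMoment, poissonIntegral]

theorem continuousOn_poissonMoment_integrand (j : ℕ) (ν : ℂ) (z : ℝ) :
    ContinuousOn (fun t : ℝ => (t : ℂ) ^ (ν - 1 / 2) * (1 + t : ℂ) ^ (ν - 1 / 2) *
      (1 + 2 * t : ℂ) ^ j * exp (-((1 + 2 * t) * z))) (Ioi 0) := by
  refine (((continuousOn_ofReal_cpow _).mul ?_).mul (by fun_prop)).mul (by fun_prop)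
  intro t ht
  have ht' : (0 : ℝ) < t := ht
  refine ContinuousAt.continuousWithinAt ?_
  refine (continuousAt_const.add continuous_ofReal.continuousAt).cpow continuousAt_const ?_
  left
  simp
  linarith

theorem norm_poissonMoment_integrand_le (j : ℕ) (ν : ℂ) {z t : ℝ} (ht : 0 < t) (hz : 0 ≤ z) :
    ‖(t : ℂ) ^ (ν - 1 / 2) * (1 + t : ℂ) ^ (ν - 1 / 2) * (1 + 2 * t : ℂ) ^ j *
      exp (-((1 + 2 * t) * z))‖ ≤
    2 ^ j * (t ^ ((ν + 1 / 2).re - 1) * (1 + t) ^ ((ν.re - 1 / 2) + j) *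
      Real.exp (-(2 * z * t))) := by
  have h1 : (1 + 2 * t : ℂ) = ((1 + 2 * t : ℝ) : ℂ) := by push_cast; rfl
  have ht1 : 0 < 1 + t := by linarith
  have h2 : (ν - 1 / 2).re = ν.re - 1 / 2 := by simp
  have h3 : (ν + 1 / 2).re - 1 = ν.re - 1 / 2 := by simp; ring
  rw [h1, norm_mul, norm_mul, norm_mul, norm_cpow_eq_rpow_re_of_pos ht, norm_one_add_cpow ht,
    norm_pow, norm_real, Real.norm_of_nonneg (by positivity), Complex.norm_exp, h2, h3,
    Real.rpow_add ht1, Real.rpow_natCast]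
  have h4 : (-(((1 + 2 * t : ℝ) : ℂ) * z)).re = -((1 + 2 * t) * z) := by
    rw [← ofReal_mul, neg_re, ofReal_re]
  have h5 : (1 + 2 * t) ^ j ≤ (2 * (1 + t)) ^ j := pow_le_pow_left₀ (by linarith) (by linarith) j
  have h6 : Real.exp (-((1 + 2 * t) * z)) ≤ Real.exp (-(2 * z * t)) :=
    Real.exp_le_exp.2 (by nlinarith)
  rw [h4]
  calc t ^ (ν.re - 1 / 2) * (1 + t) ^ (ν.re - 1 / 2) * (1 + 2 * t) ^ j *
        Real.exp (-((1 + 2 * t) * z))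
      ≤ t ^ (ν.re - 1 / 2) * (1 + t) ^ (ν.re - 1 / 2) * (2 * (1 + t)) ^ j *
        Real.exp (-(2 * z * t)) := mul_le_mul (mul_le_mul_of_nonneg_left h5 (by positivity)) h6
          (Real.exp_pos _).le (by positivity)
    _ = _ := by rw [mul_pow]; ring

theorem integrableOn_poissonMoment (j : ℕ) {ν : ℂ} (hν : 0 < (ν + 1 / 2).re) {z : ℝ} (hz : 0 < z) :
    IntegrableOn (fun t : ℝ => (t : ℂ) ^ (ν - 1 / 2) * (1 + t : ℂ) ^ (ν - 1 / 2) *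
      (1 + 2 * t : ℂ) ^ j * exp (-((1 + 2 * t) * z))) (Ioi 0) := by
  refine ((integrableOn_rpow_mul_one_add_rpow_mul_exp ((ν.re - 1 / 2) + j) hν
    (by positivity : 0 < 2 * z)).const_mul (2 ^ j)).mono'
    ((continuousOn_poissonMoment_integrand j ν z).aestronglyMeasurable measurableSet_Ioi) ?_
  filter_upwards [ae_restrict_mem measurableSet_Ioi] with t ht
  exact norm_poissonMoment_integrand_le j ν ht hz.le

theorem hasDerivAt_poissonMoment (j : ℕ) {ν : ℂ} (hν : 0 < (ν + 1 / 2).re) {z : ℝ} (hz : 0 < z) :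
    HasDerivAt (poissonMoment j ν) (-poissonMoment (j + 1) ν z) z := by
  have hz2 : 0 < z / 2 := by linarith
  have h := hasDerivAt_integral_of_dominated_loc_of_deriv_le (μ := volume.restrict (Ioi (0 : ℝ)))
    (F := fun (z t : ℝ) => (t : ℂ) ^ (ν - 1 / 2) * (1 + t : ℂ) ^ (ν - 1 / 2) *
      (1 + 2 * t : ℂ) ^ j * exp (-((1 + 2 * t) * z)))
    (F' := fun (z t : ℝ) => -((t : ℂ) ^ (ν - 1 / 2) * (1 + t : ℂ) ^ (ν - 1 / 2) *
      (1 + 2 * t : ℂ) ^ (j + 1) * exp (-((1 + 2 * t) * z))))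
    (bound := fun t => 2 ^ (j + 1) * (t ^ ((ν + 1 / 2).re - 1) *
      (1 + t) ^ ((ν.re - 1 / 2) + (j + 1 : ℕ)) * Real.exp (-(2 * (z / 2) * t))))
    (x₀ := z) (s := Ioi (z / 2)) (Ioi_mem_nhds (by linarith)) ?_ ?_ ?_ ?_ ?_ ?_
  · have h2 := h.2
    rw [integral_neg] at h2
    exact h2
  · exact Eventually.of_forall fun z =>
      (continuousOn_poissonMoment_integrand j ν z).aestronglyMeasurable measurableSet_Ioi
  · exact integrableOn_poissonMoment j hν hz
  · exact ((continuousOn_poissonMoment_integrand (j + 1) ν z).aestronglyMeasurable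
      measurableSet_Ioi).neg
  · filter_upwards [ae_restrict_mem measurableSet_Ioi] with t ht z' hz'
    have ht' : (0 : ℝ) < t := ht
    have hz'' : z / 2 < z' := hz'
    rw [norm_neg]
    refine (norm_poissonMoment_integrand_le (j + 1) ν ht (by linarith)).trans ?_
    gcongr
  · exact (integrableOn_rpow_mul_one_add_rpow_mul_exp _ hν
      (by positivity : 0 < 2 * (z / 2))).const_mul _
  · refine Eventually.of_forall fun t z' _ => ?_
    have h1 : HasDerivAt (fun z : ℝ => -((1 + 2 * t : ℂ) * z)) (-(1 + 2 * t : ℂ)) z' := by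
      exact ((hasDerivAt_id z').ofReal_comp.const_mul (1 + 2 * t : ℂ)).neg.congr_deriv (by simp)
    refine (h1.cexp.const_mul _).congr_deriv ?_
    ring

theorem poissonMoment_two {ν : ℂ} (hν : 0 < (ν + 1 / 2).re) {z : ℝ} (hz : 0 < z) :
    poissonMoment 2 ν z = poissonIntegral ν z + 4 * poissonIntegral (ν + 1) z := by
  have hν1 : 0 < (ν + 1 + 1 / 2).re := by
    rw [show ν + 1 + 1 / 2 = (ν + 1 / 2) + 1 by ring, add_re, one_re]
    linarith
  rw [← poissonMoment_zero, ← poissonMoment_zero, poissonMoment, poissonMoment, poissonMoment,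
    ← integral_const_mul, ← integral_add (integrableOn_poissonMoment 0 hν hz)
    ((integrableOn_poissonMoment 0 hν1 hz).const_mul 4)]
  refine setIntegral_congr_fun measurableSet_Ioi fun t ht => ?_
  have ht' : (0 : ℝ) < t := ht
  have h1 : (t : ℂ) ≠ 0 := by exact_mod_cast ht'.ne'
  have h2 : (1 + t : ℂ) ≠ 0 := by exact_mod_cast (show (0 : ℝ) < 1 + t by linarith).ne'
  simp only [pow_zero, mul_one]
  rw [show ν + 1 - 1 / 2 = (ν - 1 / 2) + 1 by ring, cpow_add _ _ h1, cpow_add _ _ h2, cpow_one,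
    cpow_one]
  ring

theorem hasDerivAt_one_add_cpow {t : ℝ} (ht : 0 < t) (c : ℂ) :
    HasDerivAt (fun t : ℝ => (1 + t : ℂ) ^ c) (c * (1 + t : ℂ) ^ (c - 1)) t := by
  have h := (hasDerivAt_ofReal_cpow (show 0 < 1 + t by linarith) c).comp_const_add 1 t
  push_cast at h
  exact h

/-- Integration by parts of the derivative of `(t(1+t))^{ν+1/2} e^{-(1+2t)z}`. -/
theorem mul_poissonMoment_one {ν : ℂ} (hν : 0 < (ν + 1 / 2).re) {z : ℝ} (hz : 0 < z) :
    (ν + 1 / 2) * poissonMoment 1 ν z = 2 * z * poissonIntegral (ν + 1) z := by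
  have hν1 : 0 < (ν + 1 + 1 / 2).re := by
    rw [show ν + 1 + 1 / 2 = (ν + 1 / 2) + 1 by ring, add_re, one_re]
    linarith
  have hs0 : ν + 1 / 2 ≠ 0 := by
    intro h
    rw [h] at hν
    simp at hν
  set f : ℝ → ℂ := fun t => (t : ℂ) ^ (ν + 1 / 2) * (1 + t : ℂ) ^ (ν + 1 / 2) *
    exp (-((1 + 2 * t) * z)) with hf
  set f' : ℝ → ℂ := fun t => (ν + 1 / 2) * ((t : ℂ) ^ (ν - 1 / 2) * (1 + t : ℂ) ^ (ν - 1 / 2) *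
      (1 + 2 * t : ℂ) ^ 1 * exp (-((1 + 2 * t) * z))) - 2 * z * ((t : ℂ) ^ (ν + 1 - 1 / 2) *
      (1 + t : ℂ) ^ (ν + 1 - 1 / 2) * (1 + 2 * t : ℂ) ^ 0 * exp (-((1 + 2 * t) * z))) with hf'
  have hi1 := (integrableOn_poissonMoment 1 hν hz).const_mul (ν + 1 / 2)
  have hi2 := (integrableOn_poissonMoment 0 hν1 hz).const_mul (2 * z : ℂ)
  have hderiv : ∀ t ∈ Ioi (0 : ℝ), HasDerivAt f (f' t) t := by
    intro t ht
    have ht' : (0 : ℝ) < t := ht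
    have h1 : (t : ℂ) ≠ 0 := by exact_mod_cast ht'.ne'
    have h2 : (1 + t : ℂ) ≠ 0 := by exact_mod_cast (show (0 : ℝ) < 1 + t by linarith).ne'
    have h3 : HasDerivAt (fun t : ℝ => -((1 + 2 * t : ℂ) * z)) (-(2 * z : ℂ)) t := by
      exact ((((hasDerivAt_id t).ofReal_comp.const_mul (2 : ℂ)).const_add 1).mul_const
        (z : ℂ)).neg.congr_deriv (by simp)
    refine (((hasDerivAt_ofReal_cpow ht' (ν + 1 / 2)).mul
      (hasDerivAt_one_add_cpow ht' (ν + 1 / 2))).mul h3.cexp).congr_deriv ?_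
    have p1 : (t : ℂ) ^ (ν + 1 / 2) = (t : ℂ) ^ (ν - 1 / 2) * t := by
      rw [show ν + 1 / 2 = (ν - 1 / 2) + 1 by ring, cpow_add _ _ h1, cpow_one]
    have p2 : (1 + t : ℂ) ^ (ν + 1 / 2) = (1 + t : ℂ) ^ (ν - 1 / 2) * (1 + t) := by
      rw [show ν + 1 / 2 = (ν - 1 / 2) + 1 by ring, cpow_add _ _ h2, cpow_one]
    simp only [hf', Pi.mul_apply, show ν + 1 - 1 / 2 = ν + 1 / 2 by ring,
      show ν + 1 / 2 - 1 = ν - 1 / 2 by ring, p1, p2]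
    ring
  have hf'int : IntegrableOn f' (Ioi 0) := hi1.sub hi2
  have hfint : IntegrableOn f (Ioi 0) := by
    have h := integrableOn_poissonMoment 0 hν1 hz
    rw [show ν + 1 - 1 / 2 = ν + 1 / 2 by ring] at h
    simpa [hf] using h
  have hlim := tendsto_zero_of_hasDerivAt_of_integrableOn_Ioi hderiv hf'int hfint
  have hcont : ContinuousWithinAt f (Ici 0) 0 := by
    refine ContinuousAt.continuousWithinAt ?_
    refine ((continuousAt_ofReal_cpow_const 0 _ (Or.inl hν)).mul ?_).mul (by fun_prop)
    refine (continuousAt_const.add continuous_ofReal.continuousAt).cpow continuousAt_const ?_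
    simp
  have h := integral_Ioi_of_hasDerivAt_of_tendsto hcont hderiv hf'int hlim
  have hf0 : f 0 = 0 := by simp only [hf, ofReal_zero, zero_cpow hs0, zero_mul]
  rw [hf0, sub_zero, hf', integral_sub hi1 hi2, integral_const_mul, integral_const_mul] at h
  rw [← poissonMoment_zero]
  exact sub_eq_zero.1 h

theorem differentiableOn_poissonIntegral_param {z : ℝ} (hz : 0 < z) :
    DifferentiableOn ℂ (fun ν => poissonIntegral ν z) {ν | 0 < (ν + 1 / 2).re} := by
  intro ν₀ hν₀
  have hν₀' : 0 < ν₀.re + 1 / 2 := by simpa using hν₀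
  set A := (ν₀.re - 1 / 2) / 2 with hA
  set B := ν₀.re + 1 with hB
  set U := {ν : ℂ | A < ν.re} ∩ {ν : ℂ | ν.re < B} with hU
  have hUo : IsOpen U := (isOpen_lt continuous_const continuous_re).inter
    (isOpen_lt continuous_re continuous_const)
  have hνU : ν₀ ∈ U := by
    constructor
    · simp only [mem_ofPred_eq, hA]; linarith
    · simp only [mem_ofPred_eq, hB]; linarith
  have hA' : 0 < A + 1 / 2 := by rw [hA]; linarith
  have hB' : 0 < B + 1 / 2 := by rw [hB]; linarith
  refine DifferentiableAt.differentiableWithinAt ?_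
  refine (differentiableOn_integral_of_dominated (μ := volume.restrict (Ioi (0 : ℝ))) hUo
    (bound := fun t : ℝ => t ^ (A + 1 / 2 - 1) * (1 + t) ^ (B - 1 / 2) * Real.exp (-(2 * z * t)) +
      t ^ (B + 1 / 2 - 1) * (1 + t) ^ (B - 1 / 2) * Real.exp (-(2 * z * t)))
    ?_ ?_ ?_ ?_).differentiableAt (hUo.mem_nhds hνU)
  · intro ν _
    have h := continuousOn_poissonMoment_integrand 0 ν z
    simp only [pow_zero, mul_one] at h
    exact h.aestronglyMeasurable measurableSet_Ioi
  · exact (integrableOn_rpow_mul_one_add_rpow_mul_exp _ hA' (by positivity)).add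
      (integrableOn_rpow_mul_one_add_rpow_mul_exp _ hB' (by positivity))
  · filter_upwards [ae_restrict_mem measurableSet_Ioi] with t ht ν hν
    have ht' : (0 : ℝ) < t := ht
    have h := norm_poissonMoment_integrand_le 0 ν ht hz.le
    have h1 : A < ν.re := hν.1
    have h2 : ν.re < B := hν.2
    have h3 : (ν + 1 / 2).re - 1 = ν.re - 1 / 2 := by simp; ring
    simp only [pow_zero, mul_one, one_mul, Nat.cast_zero, add_zero, h3] at h
    refine h.trans ?_
    have h4 : (1 + t) ^ (ν.re - 1 / 2) ≤ (1 + t) ^ (B - 1 / 2) :=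
      Real.rpow_le_rpow_of_exponent_le (by linarith) (by linarith)
    have h5 : t ^ (ν.re - 1 / 2) ≤ t ^ (A + 1 / 2 - 1) + t ^ (B + 1 / 2 - 1) := by
      rcases le_total t 1 with h6 | h6
      · exact (Real.rpow_le_rpow_of_exponent_ge ht' h6 (by linarith)).trans
          (le_add_of_nonneg_right (by positivity))
      · exact (Real.rpow_le_rpow_of_exponent_le h6 (by linarith)).trans
          (le_add_of_nonneg_left (by positivity))
    rw [← add_mul, ← add_mul]
    gcongr
  · filter_upwards [ae_restrict_mem measurableSet_Ioi] with t ht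
    have ht' : (0 : ℝ) < t := ht
    have h1 : (t : ℂ) ≠ 0 := by exact_mod_cast ht'.ne'
    have h2 : (1 + t : ℂ) ≠ 0 := by exact_mod_cast (show (0 : ℝ) < 1 + t by linarith).ne'
    refine Differentiable.differentiableOn ?_
    refine Differentiable.mul (Differentiable.mul ?_ ?_) (by fun_prop)
    · exact (differentiable_id.sub_const _).const_cpow (Or.inl h1)
    · exact (differentiable_id.sub_const _).const_cpow (Or.inl h2)


/-! ### Poisson's integral and the modified Bessel functions -/

/-- The right-hand side of Poisson's formula for `(z/2)^ν K_ν(z)`. -/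
noncomputable def poissonK (ν : ℂ) (z : ℝ) : ℂ :=
  (Real.sqrt Real.pi : ℂ) * (z : ℂ) ^ (2 * ν) * poissonIntegral ν z * (Gamma (ν + 1 / 2))⁻¹

theorem Gamma_add_one_add_half {ν : ℂ} (hν : 0 < (ν + 1 / 2).re) :
    Gamma (ν + 1 + 1 / 2) = (ν + 1 / 2) * Gamma (ν + 1 / 2) := by
  rw [show ν + 1 + 1 / 2 = (ν + 1 / 2) + 1 by ring, Gamma_add_one]
  intro h
  rw [h] at hν
  simp at hν

/-- The recurrence `K_ν' = -K_{ν+1} + (ν/z) K_ν`, for Poisson's integral. -/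
theorem hasDerivAt_poissonK {ν : ℂ} (hν : 0 < (ν + 1 / 2).re) {z : ℝ} (hz : 0 < z) :
    HasDerivAt (poissonK ν) (-(2 / z) * (poissonK (ν + 1) z - ν * poissonK ν z)) z := by
  have hzc : (z : ℂ) ≠ 0 := by exact_mod_cast hz.ne'
  have hs0 : ν + 1 / 2 ≠ 0 := by
    intro h
    rw [h] at hν
    simp at hν
  have hG := Gamma_ne_zero_of_re_pos hν
  have hY := mul_poissonMoment_one hν hz
  have hX := hasDerivAt_poissonMoment 0 hν hz
  simp only [funext (poissonMoment_zero ν), zero_add] at hX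
  have h := (((hasDerivAt_ofReal_cpow hz (2 * ν)).const_mul (Real.sqrt Real.pi : ℂ)).mul hX).mul_const
    (Gamma (ν + 1 / 2))⁻¹
  refine h.congr_deriv ?_
  rw [poissonK, poissonK, Gamma_add_one_add_half hν, show 2 * (ν + 1) = 2 * ν + 2 by ring,
    cpow_add _ _ hzc, cpow_sub _ _ hzc, cpow_one, cpow_ofNat]
  generalize ν + 1 / 2 = s at *
  generalize poissonMoment 1 ν z = Y at *
  have hY' : Y = 2 * z * poissonIntegral (ν + 1) z / s := by
    field_simp
    linear_combination hY
  rw [hY']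
  field_simp
  ring

/-- The recurrence `K_{ν+1}' = -K_ν - ((ν+1)/z) K_{ν+1}`, for Poisson's integral. -/
theorem hasDerivAt_poissonK_add_one {ν : ℂ} (hν : 0 < (ν + 1 / 2).re) {z : ℝ} (hz : 0 < z) :
    HasDerivAt (poissonK (ν + 1)) (-(z / 2) * poissonK ν z) z := by
  have hzc : (z : ℂ) ≠ 0 := by exact_mod_cast hz.ne'
  have hs0 : ν + 1 / 2 ≠ 0 := by
    intro h
    rw [h] at hν
    simp at hν
  have hG := Gamma_ne_zero_of_re_pos hν
  have heq : poissonK (ν + 1) =ᶠ[𝓝 z] fun z => (Real.sqrt Real.pi : ℂ) / 2 *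
      (z : ℂ) ^ (2 * ν + 1) * poissonMoment 1 ν z * (Gamma (ν + 1 / 2))⁻¹ := by
    filter_upwards [Ioi_mem_nhds hz] with y hy
    have hy' : (0 : ℝ) < y := hy
    have hyc : (y : ℂ) ≠ 0 := by exact_mod_cast hy'.ne'
    have hY := mul_poissonMoment_one hν hy'
    rw [poissonK, Gamma_add_one_add_half hν, show 2 * (ν + 1) = 2 * ν + 1 + 1 by ring,
      cpow_add _ _ hyc, cpow_one]
    generalize ν + 1 / 2 = s at *
    generalize poissonMoment 1 ν y = Y at *
    have hY' : Y = 2 * y * poissonIntegral (ν + 1) y / s := by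
      field_simp
      linear_combination hY
    rw [hY']
    field_simp
  have h := (((hasDerivAt_ofReal_cpow hz (2 * ν + 1)).const_mul ((Real.sqrt Real.pi : ℂ) / 2)).mul
    (hasDerivAt_poissonMoment 1 hν hz)).mul_const (Gamma (ν + 1 / 2))⁻¹
  refine (h.congr_of_eventuallyEq heq).congr_deriv ?_
  have hY := mul_poissonMoment_one hν hz
  rw [poissonMoment_two hν hz, poissonK, add_sub_cancel_right, cpow_add _ _ hzc, cpow_one]
  have hs : 2 * ν + 1 = 2 * (ν + 1 / 2) := by ring
  rw [hs]
  linear_combination (Real.sqrt Real.pi : ℂ) * (z : ℂ) ^ (2 * ν) * (Gamma (ν + 1 / 2))⁻¹ * hY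

theorem eq_of_hasDerivAt_zero_of_tendsto {f : ℝ → ℂ} {L : ℂ}
    (hf : ∀ z, 0 < z → HasDerivAt f 0 z) (hL : Tendsto f (𝓝[>] 0) (𝓝 L)) {z : ℝ} (hz : 0 < z) :
    f z = L := by
  refine tendsto_nhds_unique (tendsto_const_nhds.congr' ?_) hL
  filter_upwards [self_mem_nhdsWithin] with y hy
  exact isOpen_Ioi.is_const_of_deriv_eq_zero isPreconnected_Ioi
    (fun x hx => (hf x hx).differentiableAt.differentiableWithinAt)
    (fun x hx => (hf x hx).deriv) hz hy

theorem tendsto_ofReal_cpow_zero {c : ℂ} (hc : 0 < c.re) :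
    Tendsto (fun z : ℝ => (z : ℂ) ^ c) (𝓝[>] 0) (𝓝 0) := by
  have hc0 : c ≠ 0 := by
    rintro rfl
    simp at hc
  have h := (continuousAt_ofReal_cpow_const 0 c (Or.inl hc)).tendsto
  rw [ofReal_zero, zero_cpow hc0] at h
  exact h.mono_left nhdsWithin_le_nhds

/-- For `Re ν < 0` Poisson's integral tends to a Beta integral as `z → 0`. -/
theorem tendsto_poissonIntegral_zero {ν : ℂ} (hν : 0 < (ν + 1 / 2).re) (hν0 : ν.re < 0) :
    Tendsto (poissonIntegral ν) (𝓝[>] 0)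
      (𝓝 (Gamma (ν + 1 / 2) * Gamma (-(2 * ν)) / Gamma (-ν + 1 / 2))) := by
  have hv : 0 < (-(2 * ν)).re := by simp; linarith
  have hβ := (integral_cpow_mul_one_add_cpow hν hv).2
  rw [show ν + 1 / 2 + -(2 * ν) = -ν + 1 / 2 by ring] at hβ
  rw [← hβ]
  refine tendsto_integral_filter_of_dominated_convergence
    (fun t : ℝ => t ^ ((ν + 1 / 2).re - 1) * (1 + t) ^ (-(-ν + 1 / 2).re)) ?_ ?_ ?_ ?_
  · refine Eventually.of_forall fun z => ?_
    have h := continuousOn_poissonMoment_integrand 0 ν z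
    simp only [pow_zero, mul_one] at h
    exact h.aestronglyMeasurable measurableSet_Ioi
  · filter_upwards [self_mem_nhdsWithin] with z hz
    filter_upwards [ae_restrict_mem measurableSet_Ioi] with t ht
    have ht' : (0 : ℝ) < t := ht
    have hz' : (0 : ℝ) < z := hz
    have h := norm_poissonMoment_integrand_le 0 ν ht hz'.le
    have h2 : -(-ν + 1 / 2).re = ν.re - 1 / 2 := by simp; ring
    simp only [pow_zero, mul_one, one_mul, Nat.cast_zero, add_zero] at h
    rw [h2]
    refine h.trans (mul_le_of_le_one_right (by positivity) ?_)
    exact Real.exp_le_one_iff.2 (by nlinarith)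
  · exact integrableOn_rpow_mul_one_add_rpow hν (by simp; linarith)
  · filter_upwards [ae_restrict_mem measurableSet_Ioi] with t ht
    rw [show ν - 1 / 2 = ν + 1 / 2 - 1 by ring, show -(-ν + 1 / 2) = ν + 1 / 2 - 1 by ring]
    have h : Tendsto (fun z : ℝ => (t : ℂ) ^ (ν + 1 / 2 - 1) * (1 + t : ℂ) ^ (ν + 1 / 2 - 1) *
        exp (-((1 + 2 * t) * z))) (𝓝 0) (𝓝 ((t : ℂ) ^ (ν + 1 / 2 - 1) *
          (1 + t : ℂ) ^ (ν + 1 / 2 - 1) * exp (-((1 + 2 * t) * (0 : ℝ))))) :=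
      Continuous.tendsto (by fun_prop) 0
    rw [ofReal_zero, mul_zero, neg_zero, exp_zero, mul_one] at h
    exact h.mono_left nhdsWithin_le_nhds

/-- The behaviour at `z = 0`; the substitution `t = s/z` makes the limit of the integral finite. -/
theorem tendsto_poissonK_add_one_zero {ν : ℂ} (hν : 0 < (ν + 1 / 2).re) :
    Tendsto (poissonK (ν + 1)) (𝓝[>] 0) (𝓝 (Gamma (ν + 1) / 2)) := by
  set r := (ν + 1 / 2).re with hr
  set g : ℝ → ℝ → ℂ := fun z s => (s : ℂ) ^ (ν + 1 / 2) * ((z + s : ℝ) : ℂ) ^ (ν + 1 / 2) *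
    exp (-(z + 2 * s)) with hg
  have h22 : 0 < (2 * ν + 2).re := by
    have : (ν + 1 / 2).re = ν.re + 1 / 2 := by simp
    simp
    linarith
  have hgam := (integral_cpow_mul_exp_neg_mul_Ioi_of_re_pos (r := 2) h22 (by simp)).2
  have hlim : Tendsto (fun z => ∫ s : ℝ in Ioi 0, g z s) (𝓝[>] 0)
      (𝓝 ((2 : ℂ) ^ (-(2 * ν + 2)) * Gamma (2 * ν + 2))) := by
    rw [← hgam]
    refine tendsto_integral_filter_of_dominated_convergence
      (fun s : ℝ => s ^ (r + 1 - 1) * (1 + s) ^ r * Real.exp (-(2 * s))) ?_ ?_ ?_ ?_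
    · filter_upwards [self_mem_nhdsWithin] with z hz
      have hz' : (0 : ℝ) < z := hz
      refine ContinuousOn.aestronglyMeasurable ?_ measurableSet_Ioi
      refine ((continuousOn_ofReal_cpow _).mul ?_).mul (by fun_prop)
      exact (continuousOn_ofReal_cpow _).comp (f := fun s : ℝ => z + s) (by fun_prop)
        fun s hs => add_pos hz' hs
    · filter_upwards [self_mem_nhdsWithin, nhdsWithin_le_nhds (Iio_mem_nhds one_pos)] with z hz hz1
      filter_upwards [ae_restrict_mem measurableSet_Ioi] with s hs
      have hs' : (0 : ℝ) < s := hs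
      have hz' : (0 : ℝ) < z := hz
      have hz1' : z < 1 := hz1
      have h1 : (-(z + 2 * s : ℂ)).re = -(z + 2 * s) := by simp
      simp only [hg]
      rw [norm_mul, norm_mul, norm_cpow_eq_rpow_re_of_pos hs',
        norm_cpow_eq_rpow_re_of_pos (add_pos hz' hs'), Complex.norm_exp, h1, add_sub_cancel_right]
      have h2 : (z + s) ^ r ≤ (1 + s) ^ r :=
        Real.rpow_le_rpow (by positivity) (by linarith) hν.le
      have h3 : Real.exp (-(z + 2 * s)) ≤ Real.exp (-(2 * s)) :=
        Real.exp_le_exp.2 (by linarith)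
      exact mul_le_mul (mul_le_mul_of_nonneg_left h2 (by positivity)) h3 (by positivity)
        (by positivity)
    · exact integrableOn_rpow_mul_one_add_rpow_mul_exp _ (by linarith) two_pos
    · filter_upwards [ae_restrict_mem measurableSet_Ioi] with s hs
      have hs' : (0 : ℝ) < s := hs
      have hsc : (s : ℂ) ≠ 0 := by exact_mod_cast hs'.ne'
      have h : Tendsto (fun z => g z s) (𝓝 0) (𝓝 (g 0 s)) := by
        refine ContinuousAt.tendsto ?_
        refine (ContinuousAt.mul continuousAt_const ?_).mul (by fun_prop)
        exact (continuousAt_ofReal_cpow_const (0 + s) (ν + 1 / 2)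
          (Or.inr (by simpa using hs'.ne'))).comp (f := fun z : ℝ => z + s) (by fun_prop)
      have h0 : g 0 s = (s : ℂ) ^ (2 * ν + 2 - 1) * exp (-(2 * s)) := by
        simp only [hg]
        rw [zero_add, ← cpow_add _ _ hsc, ofReal_zero, zero_add]
        congr 2
        ring
      rw [h0] at h
      exact h.mono_left nhdsWithin_le_nhds
  have heq : ∀ z : ℝ, 0 < z → (Real.sqrt Real.pi : ℂ) * (Gamma (ν + 1 + 1 / 2))⁻¹ *
      ∫ s : ℝ in Ioi 0, g z s = poissonK (ν + 1) z := by
    intro z hz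
    have hzc : (z : ℂ) ≠ 0 := by exact_mod_cast hz.ne'
    have hsub := integral_comp_mul_left_Ioi' (g z) 0 hz
    rw [mul_zero] at hsub
    have hint : ∫ t : ℝ in Ioi 0, g z (z * t) =
        (z : ℂ) ^ (2 * ν + 1) * poissonIntegral (ν + 1) z := by
      rw [poissonIntegral, ← integral_const_mul]
      refine setIntegral_congr_fun measurableSet_Ioi fun t ht => ?_
      have ht' : (0 : ℝ) < t := ht
      have e1 : z + z * t = z * (1 + t) := by ring
      have e2 : (-(z + 2 * (z * t : ℝ)) : ℂ) = -((1 + 2 * t) * z) := by push_cast; ring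
      simp only [hg]
      rw [e1, e2, ofReal_mul, ofReal_mul, mul_cpow_ofReal_nonneg hz.le ht'.le,
        mul_cpow_ofReal_nonneg hz.le (by linarith : (0 : ℝ) ≤ 1 + t),
        show 2 * ν + 1 = (ν + 1 / 2) + (ν + 1 / 2) by ring, cpow_add (ν + 1 / 2) (ν + 1 / 2) hzc,
        show ν + 1 - 1 / 2 = ν + 1 / 2 by ring, ofReal_add, ofReal_one]
      ring
    rw [← hsub, hint, real_smul, poissonK, show 2 * (ν + 1) = (2 * ν + 1) + 1 by ring,
      cpow_add (2 * ν + 1) 1 hzc, cpow_one]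
    ring
  have hdup := Gamma_mul_Gamma_add_half (ν + 1)
  have hν1 : 0 < (ν + 1 + 1 / 2).re := by
    rw [show ν + 1 + 1 / 2 = (ν + 1 / 2) + 1 by ring, add_re, one_re]
    linarith
  have hG := Gamma_ne_zero_of_re_pos hν1
  have hval : (Real.sqrt Real.pi : ℂ) * (Gamma (ν + 1 + 1 / 2))⁻¹ *
      ((2 : ℂ) ^ (-(2 * ν + 2)) * Gamma (2 * ν + 2)) = Gamma (ν + 1) / 2 := by
    rw [show 2 * (ν + 1) = 2 * ν + 2 by ring, show 1 - (2 * ν + 2) = 1 + -(2 * ν + 2) by ring,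
      cpow_add _ _ two_ne_zero, cpow_one] at hdup
    generalize Gamma (ν + 1 + 1 / 2) = A at *
    generalize (2 : ℂ) ^ (-(2 * ν + 2)) = B at *
    generalize Gamma (2 * ν + 2) = C at *
    field_simp
    linear_combination -hdup
  rw [← hval]
  refine (hlim.const_mul _).congr' ?_
  filter_upwards [self_mem_nhdsWithin] with z hz using heq z hz

theorem hasDerivAt_half_sq (z : ℝ) :
    HasDerivAt (fun z : ℝ => ((z : ℂ) / 2) ^ 2) ((z : ℂ) / 2) z := by
  refine (((hasDerivAt_id z).ofReal_comp.div_const 2).pow 2).congr_deriv ?_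
  simp
  ring

theorem hasDerivAt_besselSeries_half_sq (μ : ℂ) (z : ℝ) :
    HasDerivAt (fun z : ℝ => besselSeries μ (((z : ℂ) / 2) ^ 2))
      (besselSeries (μ + 1) (((z : ℂ) / 2) ^ 2) * ((z : ℂ) / 2)) z :=
  (hasDerivAt_besselSeries μ _).comp z (hasDerivAt_half_sq z)

theorem tendsto_half_sq : Tendsto (fun z : ℝ => ((z : ℂ) / 2) ^ 2) (𝓝[>] 0) (𝓝 0) := by
  have h : Tendsto (fun z : ℝ => ((z : ℂ) / 2) ^ 2) (𝓝 0) (𝓝 (((0 : ℝ) / 2 : ℂ) ^ 2)) :=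
    Continuous.tendsto (by fun_prop) 0
  simp only [ofReal_zero, zero_div, ne_eq, OfNat.ofNat_ne_zero, not_false_eq_true, zero_pow] at h
  exact h.mono_left nhdsWithin_le_nhds

theorem tendsto_besselSeries_half_sq (μ : ℂ) :
    Tendsto (fun z : ℝ => besselSeries μ (((z : ℂ) / 2) ^ 2)) (𝓝[>] 0) (𝓝 (Gamma (μ + 1))⁻¹) := by
  rw [← besselSeries_zero]
  exact (hasDerivAt_besselSeries μ 0).continuousAt.tendsto.comp tendsto_half_sq

/-- The Wronskian of `I_ν` and `K_ν`, for Poisson's integral in place of `K_ν`. -/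
theorem poissonK_wronskian {ν : ℂ} (hν : 0 < (ν + 1 / 2).re) (hν0 : ν.re < 0) {z : ℝ}
    (hz : 0 < z) :
    2 * (besselSeries ν (((z : ℂ) / 2) ^ 2) * poissonK (ν + 1) z +
      ((z : ℂ) / 2) ^ 2 * besselSeries (ν + 1) (((z : ℂ) / 2) ^ 2) * poissonK ν z) = 1 := by
  have hνre : 0 < ν.re + 1 / 2 := by simpa using hν
  have hG1 : Gamma (ν + 1) ≠ 0 := Gamma_ne_zero_of_re_pos (by simp; linarith)
  have hf := eq_of_hasDerivAt_zero_of_tendsto (L := (Gamma (ν + 1))⁻¹ * (Gamma (ν + 1) / 2) + 0)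
    (f := fun z => besselSeries ν (((z : ℂ) / 2) ^ 2) * poissonK (ν + 1) z +
      ((z : ℂ) / 2) ^ 2 * besselSeries (ν + 1) (((z : ℂ) / 2) ^ 2) * poissonK ν z) ?_ ?_ hz
  · rw [hf]
    field_simp
    ring
  · intro z hz
    have hzc : (z : ℂ) ≠ 0 := by exact_mod_cast hz.ne'
    refine (((hasDerivAt_besselSeries_half_sq ν z).mul (hasDerivAt_poissonK_add_one hν hz)).add
      (((hasDerivAt_half_sq z).mul (hasDerivAt_besselSeries_half_sq (ν + 1) z)).mul
        (hasDerivAt_poissonK hν hz))).congr_deriv ?_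
    have h1 := besselSeries_contiguous ν (((z : ℂ) / 2) ^ 2)
    rw [show ν + 1 + 1 = ν + 2 by ring]
    simp only [Pi.mul_apply]
    generalize besselSeries ν (((z : ℂ) / 2) ^ 2) = A at *
    generalize besselSeries (ν + 1) (((z : ℂ) / 2) ^ 2) = B at *
    generalize besselSeries (ν + 2) (((z : ℂ) / 2) ^ 2) = C at *
    rw [h1]
    field_simp
    ring
  · refine ((tendsto_besselSeries_half_sq ν).mul (tendsto_poissonK_add_one_zero hν)).add ?_
    have h1 : Tendsto (fun z : ℝ => (z : ℂ) ^ (2 * ν + 2) * ((1 / 4 *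
        (Real.sqrt Real.pi : ℂ) * (Gamma (ν + 1 / 2))⁻¹) * (poissonIntegral ν z *
          besselSeries (ν + 1) (((z : ℂ) / 2) ^ 2)))) (𝓝[>] 0) (𝓝 (0 * _)) :=
      (tendsto_ofReal_cpow_zero (by simp; linarith)).mul (((tendsto_poissonIntegral_zero hν hν0).mul
        (tendsto_besselSeries_half_sq (ν + 1))).const_mul _)
    rw [zero_mul] at h1
    refine h1.congr' ?_
    filter_upwards [self_mem_nhdsWithin] with z hz
    have hz' : (0 : ℝ) < z := hz
    have hzc : (z : ℂ) ≠ 0 := by exact_mod_cast hz'.ne'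
    rw [poissonK, cpow_add _ _ hzc, cpow_ofNat]
    ring

/-- The Wronskian of `I_{-ν}` and `K_ν`, for Poisson's integral in place of `K_ν`. -/
theorem poissonK_wronskian_neg {ν : ℂ} (hν : 0 < (ν + 1 / 2).re) (hν0 : ν.re < 0) {z : ℝ}
    (hz : 0 < z) :
    (z : ℂ) ^ (-(2 * ν)) * (besselSeries (-ν) (((z : ℂ) / 2) ^ 2) * poissonK (ν + 1) z +
      besselSeries (-ν - 1) (((z : ℂ) / 2) ^ 2) * poissonK ν z) = (2 : ℂ) ^ (-(2 * ν)) / 2 := by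
  have hνn : 0 < (-ν).re := by simpa using hν0
  have hνn2 : 0 < (-ν + 1 / 2).re := by simp; linarith
  have hG0 := Gamma_ne_zero_of_re_pos hν
  have hG1 := Gamma_ne_zero_of_re_pos hνn
  have hG2 := Gamma_ne_zero_of_re_pos hνn2
  have hf := eq_of_hasDerivAt_zero_of_tendsto
    (L := 0 * ((Gamma (-ν + 1))⁻¹ * (Gamma (ν + 1) / 2)) + (Gamma (-ν))⁻¹ * ((Real.sqrt Real.pi : ℂ) * (Gamma (ν + 1 / 2))⁻¹ *
      (Gamma (ν + 1 / 2) * Gamma (-(2 * ν)) / Gamma (-ν + 1 / 2))))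
    (f := fun z => (z : ℂ) ^ (-(2 * ν)) *
      (besselSeries (-ν) (((z : ℂ) / 2) ^ 2) * poissonK (ν + 1) z +
      besselSeries (-ν - 1) (((z : ℂ) / 2) ^ 2) * poissonK ν z)) ?_ ?_ hz
  · rw [hf]
    have hdup := Gamma_mul_Gamma_add_half (-ν)
    rw [show 2 * -ν = -(2 * ν) by ring, show 1 - -(2 * ν) = 1 - -(2 * ν) by ring,
      cpow_sub _ _ two_ne_zero, cpow_one] at hdup
    have h2 : (2 : ℂ) ^ (-(2 * ν)) ≠ 0 := by simp [cpow_eq_zero_iff]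
    generalize (2 : ℂ) ^ (-(2 * ν)) = T at *
    generalize Gamma (-ν + 1 / 2) = C at *
    generalize Gamma (ν + 1 / 2) = D at *
    field_simp at hdup ⊢
    linear_combination -hdup
  · intro z hz
    have hzc : (z : ℂ) ≠ 0 := by exact_mod_cast hz.ne'
    refine ((hasDerivAt_ofReal_cpow hz (-(2 * ν))).mul (((hasDerivAt_besselSeries_half_sq (-ν) z).mul
      (hasDerivAt_poissonK_add_one hν hz)).add ((hasDerivAt_besselSeries_half_sq (-ν - 1) z).mul
        (hasDerivAt_poissonK hν hz)))).congr_deriv ?_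
    have h1 := besselSeries_contiguous (-ν - 1) (((z : ℂ) / 2) ^ 2)
    rw [sub_add_cancel, show -ν - 1 + 2 = -ν + 1 by ring] at h1
    rw [sub_add_cancel, cpow_sub _ _ hzc, cpow_one]
    simp only [Pi.mul_apply, Pi.add_apply]
    generalize besselSeries (-ν) (((z : ℂ) / 2) ^ 2) = A at *
    generalize besselSeries (-ν + 1) (((z : ℂ) / 2) ^ 2) = B at *
    generalize besselSeries (-ν - 1) (((z : ℂ) / 2) ^ 2) = C at *
    rw [h1]
    generalize (z : ℂ) ^ (-(2 * ν)) = T at *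
    field_simp
    ring
  · have h1 := (tendsto_ofReal_cpow_zero (c := -(2 * ν)) (by simp; linarith)).mul
      ((tendsto_besselSeries_half_sq (-ν)).mul (tendsto_poissonK_add_one_zero hν))
    have h2 := (tendsto_besselSeries_half_sq (-ν - 1)).mul
      ((tendsto_poissonIntegral_zero hν hν0).const_mul
        ((Real.sqrt Real.pi : ℂ) * (Gamma (ν + 1 / 2))⁻¹))
    rw [sub_add_cancel] at h2
    refine (h1.add h2).congr' ?_
    filter_upwards [self_mem_nhdsWithin] with z hz
    have hz' : (0 : ℝ) < z := hz
    have hzc : (z : ℂ) ≠ 0 := by exact_mod_cast hz'.ne'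
    have h3 : (z : ℂ) ^ (-(2 * ν)) * (z : ℂ) ^ (2 * ν) = 1 := by
      rw [← cpow_add _ _ hzc, neg_add_cancel, cpow_zero]
    simp only [poissonK]
    linear_combination (-(besselSeries (-ν - 1) (((z : ℂ) / 2) ^ 2) * (Real.sqrt Real.pi : ℂ) *
      (Gamma (ν + 1 / 2))⁻¹ * poissonIntegral ν z)) * h3

theorem besselSeries_connection_of_re_neg {ν : ℂ} (hν : 0 < (ν + 1 / 2).re) (hν0 : ν.re < 0) {z : ℝ}
    (hz : 0 < z) :
    besselSeries (-ν) (((z : ℂ) / 2) ^ 2) -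
      (z : ℂ) ^ (2 * ν) * (2 : ℂ) ^ (-(2 * ν)) * besselSeries ν (((z : ℂ) / 2) ^ 2) =
    2 * (sin (Real.pi * ν) / Real.pi) * poissonK ν z := by
  have hzc : (z : ℂ) ≠ 0 := by exact_mod_cast hz.ne'
  have h1 := poissonK_wronskian hν hν0 hz
  have h2 := poissonK_wronskian_neg hν hν0 hz
  have h3 := besselSeries_wronskian ν (((z : ℂ) / 2) ^ 2)
  have h4 : (z : ℂ) ^ (2 * ν) * (z : ℂ) ^ (-(2 * ν)) = 1 := by
    rw [← cpow_add _ _ hzc, add_neg_cancel, cpow_zero]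
  linear_combination (-besselSeries (-ν) (((z : ℂ) / 2) ^ 2)) * h1 +
    2 * besselSeries ν (((z : ℂ) / 2) ^ 2) * (z : ℂ) ^ (2 * ν) * h2 + 2 * poissonK ν z * h3 -
    2 * besselSeries ν (((z : ℂ) / 2) ^ 2) * (besselSeries (-ν) (((z : ℂ) / 2) ^ 2) *
      poissonK (ν + 1) z + besselSeries (-ν - 1) (((z : ℂ) / 2) ^ 2) * poissonK ν z) * h4

theorem differentiableOn_poissonK_param {z : ℝ} (hz : 0 < z) :
    DifferentiableOn ℂ (fun ν => poissonK ν z) {ν | 0 < (ν + 1 / 2).re} := by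
  have hzc : (z : ℂ) ≠ 0 := by exact_mod_cast hz.ne'
  have h1 : Differentiable ℂ fun ν : ℂ => (z : ℂ) ^ (2 * ν) :=
    (differentiable_id.const_mul _).const_cpow (Or.inl hzc)
  have h2 : Differentiable ℂ fun ν : ℂ => (Gamma (ν + 1 / 2))⁻¹ :=
    differentiable_one_div_Gamma.comp (by fun_prop)
  exact ((h1.const_mul _).differentiableOn.mul (differentiableOn_poissonIntegral_param hz)).mul
    h2.differentiableOn

theorem isOpen_re_add_half_pos : IsOpen {ν : ℂ | 0 < (ν + 1 / 2).re} :=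
  isOpen_lt continuous_const (continuous_re.comp (by fun_prop))

/-- The formula `I_{-ν} - I_ν = (2/π) sin(πν) K_ν` on the positive axis, multiplied by `(z/2)^ν`, with
Poisson's integral in place of `K_ν`. -/
theorem besselSeries_connection {ν : ℂ} (hν : 0 < (ν + 1 / 2).re) {z : ℝ} (hz : 0 < z) :
    besselSeries (-ν) (((z : ℂ) / 2) ^ 2) -
      (z : ℂ) ^ (2 * ν) * (2 : ℂ) ^ (-(2 * ν)) * besselSeries ν (((z : ℂ) / 2) ^ 2) =
    2 * (sin (Real.pi * ν) / Real.pi) * poissonK ν z := by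
  have hzc : (z : ℂ) ≠ 0 := by exact_mod_cast hz.ne'
  set U := {ν : ℂ | 0 < (ν + 1 / 2).re} with hU
  have hUc : IsPreconnected U := by
    have h : U = {ν : ℂ | -1 / 2 < ν.re} := by
      ext ν
      simp only [hU, mem_ofPred_eq, add_re]
      norm_num
      constructor <;> intro h <;> linarith
    rw [h]
    exact (convex_halfSpace_re_gt _).isPreconnected
  have hL : AnalyticOnNhd ℂ (fun ν : ℂ => besselSeries (-ν) (((z : ℂ) / 2) ^ 2) -
      (z : ℂ) ^ (2 * ν) * (2 : ℂ) ^ (-(2 * ν)) * besselSeries ν (((z : ℂ) / 2) ^ 2)) U := by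
    refine DifferentiableOn.analyticOnNhd ?_ isOpen_re_add_half_pos
    have h1 := differentiable_besselSeries_param (((z : ℂ) / 2) ^ 2)
    have h2 : Differentiable ℂ fun ν : ℂ => (z : ℂ) ^ (2 * ν) :=
      (differentiable_id.const_mul _).const_cpow (Or.inl hzc)
    have h3 : Differentiable ℂ fun ν : ℂ => (2 : ℂ) ^ (-(2 * ν)) :=
      (differentiable_id.const_mul _).neg.const_cpow (Or.inl two_ne_zero)
    exact ((h1.comp differentiable_neg).sub ((h2.mul h3).mul h1)).differentiableOn
  have hR : AnalyticOnNhd ℂ (fun ν : ℂ => 2 * (sin (Real.pi * ν) / Real.pi) * poissonK ν z) U := by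
    refine DifferentiableOn.analyticOnNhd ?_ isOpen_re_add_half_pos
    refine DifferentiableOn.mul ?_ (differentiableOn_poissonK_param hz)
    fun_prop
  have hmem : (-(1 / 4) : ℂ) ∈ U := by
    simp only [hU, mem_ofPred_eq]
    norm_num
  refine hL.eqOn_of_preconnected_of_eventuallyEq hR hUc hmem ?_ hν
  filter_upwards [isOpen_re_add_half_pos.mem_nhds hmem,
    (isOpen_lt continuous_re continuous_const).mem_nhds
      (show (-(1 / 4) : ℂ).re < 0 by norm_num)] with ν h1 h2
  exact besselSeries_connection_of_re_neg h1 h2 hz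


/-! ### The functions `K_ν` and `Y_ν`, for integer and for noninteger order -/

/-- L'Hôpital's rule for simple zeros. -/
theorem tendsto_div_of_hasDerivAt {f g : ℂ → ℂ} {f' g' x : ℂ} (hf : HasDerivAt f f' x)
    (hg : HasDerivAt g g' x) (hfx : f x = 0) (hgx : g x = 0) (hg' : g' ≠ 0) :
    Tendsto (fun y => f y / g y) (𝓝[≠] x) (𝓝 (f' / g')) := by
  refine ((hasDerivAt_iff_tendsto_slope.1 hf).div (hasDerivAt_iff_tendsto_slope.1 hg) hg').congr' ?_
  filter_upwards [self_mem_nhdsWithin] with y hy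
  have hy' : y - x ≠ 0 := sub_ne_zero.2 hy
  simp only [Pi.div_apply, slope_def_field, hfx, hgx, sub_zero]
  exact div_div_div_cancel_right₀ hy' _ _

theorem hasDerivAt_sin_pi_mul (ν : ℂ) :
    HasDerivAt (fun μ : ℂ => sin (Real.pi * μ)) (Real.pi * cos (Real.pi * ν)) ν := by
  refine (((hasDerivAt_id ν).const_mul (Real.pi : ℂ)).csin).congr_deriv ?_
  simp
  ring

theorem pi_mul_cos_pi_mul_int_ne_zero (n : ℤ) : (Real.pi : ℂ) * cos (Real.pi * n) ≠ 0 := by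
  refine mul_ne_zero (by exact_mod_cast Real.pi_ne_zero) ?_
  rw [mul_comm, ← ofReal_intCast, ← ofReal_mul, ← ofReal_cos, Real.cos_int_mul_pi]
  exact_mod_cast zpow_ne_zero n (by norm_num : (-1 : ℝ) ≠ 0)

theorem sin_pi_mul_int (n : ℤ) : sin (Real.pi * (n : ℂ)) = 0 := by
  rw [mul_comm]
  exact sin_int_mul_pi n

theorem sin_pi_mul_eq_zero_iff {ν : ℂ} : sin (Real.pi * ν) = 0 ↔ ∃ n : ℤ, ν = n := by
  have hpi : (Real.pi : ℂ) ≠ 0 := by exact_mod_cast Real.pi_ne_zero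
  rw [Complex.sin_eq_zero_iff]
  refine exists_congr fun n => ⟨fun h => ?_, fun h => by rw [h, mul_comm]⟩
  rw [mul_comm (n : ℂ)] at h
  exact mul_left_cancel₀ hpi h

theorem eventually_sin_pi_mul_ne_zero (ν : ℂ) : ∀ᶠ μ in 𝓝[≠] ν, sin (Real.pi * μ) ≠ 0 := by
  by_cases h : sin (Real.pi * ν) = 0
  · obtain ⟨n, rfl⟩ := sin_pi_mul_eq_zero_iff.1 h
    exact (hasDerivAt_sin_pi_mul (n : ℂ)).eventually_ne (pi_mul_cos_pi_mul_int_ne_zero n)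
  · exact nhdsWithin_le_nhds ((hasDerivAt_sin_pi_mul ν).continuousAt.eventually_ne h)

/-- For integer `n`, the series for the orders `n` and `-n` are proportional, so that the quotients
that define `K_n` and `Y_n` are of the form `0/0`. -/
theorem besselSeries_neg_nat (n : ℕ) (w : ℂ) :
    besselSeries (-n) w = w ^ n * besselSeries n w := by
  induction n using Nat.strong_induction_on with
  | _ n ih =>
    match n with
    | 0 => simp
    | 1 =>
      have h := besselSeries_contiguous (-1) w
      rw [show (-1 : ℂ) + 1 = 0 by ring, show (-1 : ℂ) + 2 = 1 by ring] at h
      simpa using h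
    | n + 2 =>
      have h1 := besselSeries_contiguous (-(n + 2 : ℕ)) w
      have h2 := besselSeries_contiguous n w
      have h3 := ih n (by omega)
      have h4 := ih (n + 1) (by omega)
      rw [show (-(n + 2 : ℕ) + 1 : ℂ) = -(n + 1 : ℕ) by push_cast; ring,
        show (-(n + 2 : ℕ) + 2 : ℂ) = -n by push_cast; ring, h3, h4] at h1
      rw [h1]
      push_cast at h2 ⊢
      rw [h2]
      ring

theorem differentiable_besselI_param (ζ : ℂ) : Differentiable ℂ fun μ => besselI μ ζ := by
  simp only [besselI_eq]
  exact Differentiable.mul (by fun_prop) (differentiable_besselSeries_param _)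

theorem differentiable_besselJ_param (ζ : ℂ) : Differentiable ℂ fun μ => besselJ μ ζ := by
  simp only [besselJ_eq]
  exact Differentiable.mul (by fun_prop) (differentiable_besselSeries_param _)

theorem differentiable_besselI (ν : ℂ) : Differentiable ℂ (besselI ν) := by
  have h : besselI ν = fun ζ => exp (ν * (ζ - Real.log 2)) * besselSeries ν ((exp ζ / 2) ^ 2) :=
    funext (besselI_eq ν)
  rw [h]
  have h1 : Differentiable ℂ (besselSeries ν) := fun w => (hasDerivAt_besselSeries ν w).differentiableAt
  exact Differentiable.mul (by fun_prop) (h1.comp (by fun_prop))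

theorem exp_log_two : exp (Real.log 2 : ℂ) = 2 := by
  rw [← ofReal_exp, Real.exp_log two_pos, ofReal_ofNat]

theorem exp_mul_sub_log_two (n : ℕ) (ζ : ℂ) :
    exp (-n * (ζ - Real.log 2)) * ((exp ζ / 2) ^ 2) ^ n = exp (n * (ζ - Real.log 2)) := by
  have h : exp ζ / 2 = exp (ζ - Real.log 2) := by rw [exp_sub, exp_log_two]
  rw [h, ← pow_mul, ← exp_nat_mul, ← exp_add]
  congr 1
  push_cast
  ring

theorem besselI_neg_int (n : ℤ) (ζ : ℂ) : besselI (-n) ζ = besselI n ζ := by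
  have h : ∀ n : ℕ, besselI (-n) ζ = besselI n ζ := by
    intro n
    rw [besselI_eq, besselI_eq, besselSeries_neg_nat, ← mul_assoc, exp_mul_sub_log_two]
  obtain ⟨k, rfl | rfl⟩ := n.eq_nat_or_neg
  · exact_mod_cast h k
  · push_cast
    rw [neg_neg, h]

theorem besselJ_neg_int (n : ℤ) (ζ : ℂ) : besselJ (-n) ζ = cos (Real.pi * n) * besselJ n ζ := by
  have hcos : ∀ n : ℕ, cos (Real.pi * n) = (-1) ^ n := by
    intro n
    rw [mul_comm, ← ofReal_natCast, ← ofReal_mul, ← ofReal_cos, Real.cos_nat_mul_pi]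
    push_cast
    rfl
  have h : ∀ n : ℕ, besselJ (-n) ζ = (-1) ^ n * besselJ n ζ := by
    intro n
    rw [besselJ_eq, besselJ_eq, besselSeries_neg_nat, neg_pow, ← exp_mul_sub_log_two n ζ]
    ring
  obtain ⟨k, rfl | rfl⟩ := n.eq_nat_or_neg
  · push_cast
    rw [hcos, h]
  · push_cast
    rw [neg_neg, h, mul_neg, cos_neg, hcos, ← mul_assoc, ← mul_pow]
    simp

/-- The quotient that defines `K_ν`. -/
noncomputable def besselKQuot (μ ζ : ℂ) : ℂ :=
  (Real.pi / 2) * (besselI (-μ) ζ - besselI μ ζ) / sin (Real.pi * μ)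

/-- The quotient that defines `Y_ν`. -/
noncomputable def besselYQuot (μ ζ : ℂ) : ℂ :=
  (besselJ μ ζ * cos (Real.pi * μ) - besselJ (-μ) ζ) / sin (Real.pi * μ)

theorem hasDerivAt_besselI_sub (ν ζ : ℂ) :
    HasDerivAt (fun μ => (Real.pi / 2) * (besselI (-μ) ζ - besselI μ ζ))
      ((Real.pi / 2) * (-deriv (fun μ => besselI μ ζ) (-ν) - deriv (fun μ => besselI μ ζ) ν)) ν := by
  have h1 := (differentiable_besselI_param ζ ν).hasDerivAt
  have h2 := (differentiable_besselI_param ζ (-ν)).hasDerivAt.scomp ν (hasDerivAt_neg ν)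
  refine ((h2.sub h1).const_mul _).congr_deriv ?_
  simp

/-- For integer order, `K_n` is the quotient of the derivatives with respect to the order. -/
theorem besselK_int (n : ℤ) (ζ : ℂ) :
    Tendsto (fun μ => besselKQuot μ ζ) (𝓝[≠] (n : ℂ)) (𝓝 ((Real.pi / 2) *
      (-deriv (fun μ => besselI μ ζ) (-n) - deriv (fun μ => besselI μ ζ) n) /
        (Real.pi * cos (Real.pi * n)))) ∧
    besselK n ζ = (Real.pi / 2) *
      (-deriv (fun μ => besselI μ ζ) (-n) - deriv (fun μ => besselI μ ζ) n) /
        (Real.pi * cos (Real.pi * n)) := by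
  have h := tendsto_div_of_hasDerivAt (hasDerivAt_besselI_sub n ζ) (hasDerivAt_sin_pi_mul n)
    (by rw [besselI_neg_int, sub_self, mul_zero]) (sin_pi_mul_int n)
    (pi_mul_cos_pi_mul_int_ne_zero n)
  refine ⟨h, ?_⟩
  have hex : ∃ m : ℤ, (n : ℂ) = m := ⟨n, rfl⟩
  simp only [besselK, if_pos hex]
  exact h.limUnder_eq

theorem besselK_of_sin_ne_zero {ν : ℂ} (h : sin (Real.pi * ν) ≠ 0) (ζ : ℂ) :
    besselK ν ζ = besselKQuot ν ζ := by
  rw [Ne, sin_pi_mul_eq_zero_iff] at h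
  simp only [besselK, if_neg h, besselKQuot]

/-- For every order, integer or not, `K_ν` is the limit of the defining quotient. Identities between
quotients thereby extend to integer order. -/
theorem tendsto_besselKQuot (ν ζ : ℂ) :
    Tendsto (fun μ => besselKQuot μ ζ) (𝓝[≠] ν) (𝓝 (besselK ν ζ)) := by
  by_cases h : sin (Real.pi * ν) = 0
  · obtain ⟨n, rfl⟩ := sin_pi_mul_eq_zero_iff.1 h
    rw [(besselK_int n ζ).2]
    exact (besselK_int n ζ).1
  · rw [besselK_of_sin_ne_zero h]
    exact (((hasDerivAt_besselI_sub ν ζ).continuousAt.div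
      (hasDerivAt_sin_pi_mul ν).continuousAt h).tendsto).mono_left nhdsWithin_le_nhds

theorem tendsto_besselYQuot (ν ζ : ℂ) :
    Tendsto (fun μ => besselYQuot μ ζ) (𝓝[≠] ν) (𝓝 (besselY ν ζ)) := by
  have hd : Differentiable ℂ fun μ => besselJ μ ζ * cos (Real.pi * μ) - besselJ (-μ) ζ := by
    have h1 := differentiable_besselJ_param ζ
    exact (h1.mul (by fun_prop)).sub (h1.comp differentiable_neg)
  by_cases h : sin (Real.pi * ν) = 0
  · obtain ⟨n, rfl⟩ := sin_pi_mul_eq_zero_iff.1 h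
    have hT := tendsto_div_of_hasDerivAt (hd n).hasDerivAt (hasDerivAt_sin_pi_mul n)
      (by rw [besselJ_neg_int]; ring) (sin_pi_mul_int n) (pi_mul_cos_pi_mul_int_ne_zero n)
    have hex : ∃ m : ℤ, (n : ℂ) = m := ⟨n, rfl⟩
    have hval := hT.limUnder_eq
    simp only [besselY, if_pos hex]
    rw [hval]
    exact hT
  · have hval : besselY ν ζ = besselYQuot ν ζ := by
      have h' := h
      rw [sin_pi_mul_eq_zero_iff] at h'
      simp only [besselY, if_neg h', besselYQuot]
    rw [hval]
    exact (((hd ν).continuousAt.div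
      (hasDerivAt_sin_pi_mul ν).continuousAt h).tendsto).mono_left nhdsWithin_le_nhds

theorem besselK_neg (ν ζ : ℂ) : besselK (-ν) ζ = besselK ν ζ := by
  have hneg : Tendsto (fun μ : ℂ => -μ) (𝓝[≠] ν) (𝓝[≠] (-ν)) := by
    refine tendsto_nhdsWithin_iff.2 ⟨(continuous_neg.tendsto ν).mono_left nhdsWithin_le_nhds, ?_⟩
    filter_upwards [self_mem_nhdsWithin] with μ hμ h
    exact hμ (neg_injective h)
  refine tendsto_nhds_unique (((tendsto_besselKQuot (-ν) ζ).comp hneg).congr fun μ => ?_)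
    (tendsto_besselKQuot ν ζ)
  simp only [Function.comp_apply, besselKQuot, neg_neg, mul_neg, sin_neg, div_neg]
  ring

theorem exists_norm_besselI_le (R : ℝ) (ζ₀ : ℂ) :
    ∃ C : ℝ, ∀ μ : ℂ, ‖μ‖ ≤ R → ∀ ζ ∈ Metric.ball ζ₀ 1, ‖besselI μ ζ‖ ≤ C := by
  obtain ⟨M, hM0, hM⟩ := exists_norm_besselSeries_le R
  have hc1 : Continuous fun ζ : ℂ => ‖ζ - Real.log 2‖ := by fun_prop
  have hc2 : Continuous fun ζ : ℂ => ‖(exp ζ / 2) ^ 2‖ := by fun_prop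
  obtain ⟨A, hA⟩ := (isCompact_closedBall ζ₀ 1).exists_bound_of_continuousOn hc1.continuousOn
  obtain ⟨B, hB⟩ := (isCompact_closedBall ζ₀ 1).exists_bound_of_continuousOn hc2.continuousOn
  refine ⟨Real.exp (R * A) * (M * Real.exp B), fun μ hμ ζ hζ => ?_⟩
  have h1 := hA ζ (Metric.ball_subset_closedBall hζ)
  have h2 := hB ζ (Metric.ball_subset_closedBall hζ)
  rw [norm_norm] at h1 h2
  rw [besselI_eq, norm_mul]
  have h3 : ‖exp (μ * (ζ - Real.log 2))‖ ≤ Real.exp (R * A) := by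
    refine (norm_exp_le_exp_norm _).trans (Real.exp_le_exp.2 ?_)
    rw [norm_mul]
    exact mul_le_mul hμ h1 (norm_nonneg _) ((norm_nonneg _).trans hμ)
  have h4 : ‖besselSeries μ ((exp ζ / 2) ^ 2)‖ ≤ M * Real.exp B :=
    (hM μ hμ _).trans (mul_le_mul_of_nonneg_left (Real.exp_le_exp.2 h2) hM0)
  exact mul_le_mul h3 h4 (norm_nonneg _) (Real.exp_pos _).le

/-- The derivative of `I_μ` with respect to the order is entire in `ζ`; it enters `K_n`. -/
theorem differentiable_deriv_besselI_param (ν : ℂ) :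
    Differentiable ℂ fun ζ => deriv (fun μ => besselI μ ζ) ν := by
  intro ζ₀
  obtain ⟨C, hC⟩ := exists_norm_besselI_le (‖ν‖ + 1) ζ₀
  have hsph : ∀ θ : ℝ, ‖circleMap ν 1 θ‖ ≤ ‖ν‖ + 1 := by
    intro θ
    refine (norm_le_norm_add_norm_sub' _ ν).trans ?_
    have h := circleMap_mem_sphere ν (zero_le_one' ℝ) θ
    rw [mem_sphere_iff_norm] at h
    rw [norm_sub_rev] at h ⊢
    linarith
  -- Cauchy's formula exhibits the derivative as an integral over the parameter
  have hcauchy : ∀ ζ : ℂ, deriv (fun μ => besselI μ ζ) ν = (2 * Real.pi * I : ℂ)⁻¹ *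
      ∫ θ : ℝ in Ioc 0 (2 * Real.pi), deriv (circleMap ν 1) θ *
        (((circleMap ν 1 θ - ν) ^ 2)⁻¹ * besselI (circleMap ν 1 θ) ζ) := by
    intro ζ
    have h := ((differentiable_besselI_param ζ).diffContOnCl
      (s := Metric.ball ν 1)).deriv_eq_smul_circleIntegral one_pos
    rw [circleIntegral, intervalIntegral.integral_of_le (by positivity)] at h
    simp only [smul_eq_mul, one_div] at h
    rw [h, inv_mul_cancel_left₀ two_pi_I_ne_zero]
  have hn : ∀ θ : ℝ, ‖deriv (circleMap ν 1) θ‖ = 1 ∧ ‖((circleMap ν 1 θ - ν) ^ 2)⁻¹‖ = 1 := by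
    intro θ
    constructor
    · simp [deriv_circleMap]
    · rw [circleMap_sub_center, norm_inv, norm_pow]
      simp
  have hD : DifferentiableOn ℂ (fun ζ => ∫ θ : ℝ in Ioc 0 (2 * Real.pi), deriv (circleMap ν 1) θ *
        (((circleMap ν 1 θ - ν) ^ 2)⁻¹ * besselI (circleMap ν 1 θ) ζ)) (Metric.ball ζ₀ 1) := by
    refine differentiableOn_integral_of_dominated Metric.isOpen_ball (bound := fun _ => C)
      (fun ζ _ => ?_) ?_ ?_ ?_
    · have h1 : Continuous fun θ : ℝ => besselI (circleMap ν 1 θ) ζ :=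
        (differentiable_besselI_param ζ).continuous.comp (continuous_circleMap ν 1)
      have h2 : Continuous fun θ : ℝ => ((circleMap ν 1 θ - ν) ^ 2)⁻¹ :=
        ((continuous_circleMap ν 1).sub continuous_const).pow 2 |>.inv₀ fun θ =>
          pow_ne_zero 2 (sub_ne_zero.2 (circleMap_ne_center one_ne_zero))
      have h3 : Continuous fun θ : ℝ => deriv (circleMap ν 1) θ := by
        simp only [deriv_circleMap]
        exact (continuous_circleMap 0 1).mul continuous_const
      exact (h3.mul (h2.mul h1)).aestronglyMeasurable
    · exact integrableOn_const measure_Ioc_lt_top.ne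
    · refine Eventually.of_forall fun θ ζ hζ => ?_
      rw [norm_mul, norm_mul, (hn θ).1, (hn θ).2, one_mul, one_mul]
      exact hC _ (hsph θ) ζ hζ
    · exact Eventually.of_forall fun θ =>
        (((differentiable_besselI _).const_mul _).const_mul _).differentiableOn
  rw [funext hcauchy]
  exact (hD.differentiableAt (Metric.ball_mem_nhds ζ₀ one_pos)).const_mul _

theorem differentiable_besselK (ν : ℂ) : Differentiable ℂ (besselK ν) := by
  by_cases h : sin (Real.pi * ν) = 0
  · obtain ⟨n, rfl⟩ := sin_pi_mul_eq_zero_iff.1 h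
    rw [funext fun ζ => (besselK_int n ζ).2]
    exact ((((differentiable_deriv_besselI_param _).neg).sub
      (differentiable_deriv_besselI_param _)).const_mul _).div_const _
  · rw [funext fun ζ => besselK_of_sin_ne_zero h ζ]
    exact (((differentiable_besselI _).sub (differentiable_besselI _)).const_mul _).div_const _

/-- Poisson's integral for `K_ν` on the positive axis. -/
theorem besselK_ofReal {ν : ℂ} (hν : 0 < (ν + 1 / 2).re) (x : ℝ) :
    besselK ν x = exp (-(ν * (x - Real.log 2))) * poissonK ν (Real.exp x) := by
  have hcont : Tendsto (fun μ : ℂ => exp (-(μ * (x - Real.log 2))) * poissonK μ (Real.exp x)) (𝓝[≠] ν)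
      (𝓝 (exp (-(ν * (x - Real.log 2))) * poissonK ν (Real.exp x))) := by
    have h1 := ((differentiableOn_poissonK_param (Real.exp_pos x)).differentiableAt
      (isOpen_re_add_half_pos.mem_nhds hν)).continuousAt
    have h2 : ContinuousAt (fun μ : ℂ => exp (-(μ * (x - Real.log 2)))) ν := by fun_prop
    exact ((h2.mul h1).tendsto).mono_left nhdsWithin_le_nhds
  refine tendsto_nhds_unique (tendsto_besselKQuot ν x) (hcont.congr' ?_)
  filter_upwards [eventually_sin_pi_mul_ne_zero ν,
    nhdsWithin_le_nhds (isOpen_re_add_half_pos.mem_nhds hν)] with μ hsin hμ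
  have hpi : (Real.pi : ℂ) ≠ 0 := by exact_mod_cast Real.pi_ne_zero
  have hE : ((Real.exp x : ℝ) : ℂ) ≠ 0 := by exact_mod_cast (Real.exp_pos x).ne'
  have hconn := besselSeries_connection hμ (Real.exp_pos x)
  have h1 : ((Real.exp x : ℝ) : ℂ) ^ (2 * μ) = exp (2 * μ * x) := by
    rw [cpow_def_of_ne_zero hE, ← ofReal_log (Real.exp_pos x).le, Real.log_exp, mul_comm]
  have h2 : (2 : ℂ) ^ (-(2 * μ)) = exp (-(2 * μ * Real.log 2)) := by
    rw [cpow_def_of_ne_zero two_ne_zero, ← ofReal_ofNat, ← ofReal_log zero_le_two, ofReal_ofNat]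
    congr 1
    ring
  have h3 : exp (-(μ * (x - Real.log 2))) * (exp (2 * μ * x) * exp (-(2 * μ * Real.log 2))) =
      exp (μ * (x - Real.log 2)) := by
    rw [← exp_add, ← exp_add]
    congr 1
    ring
  rw [h1, h2, ofReal_exp] at hconn
  rw [besselKQuot, besselI_eq, besselI_eq, ← h3, eq_div_iff hsin, neg_mul]
  generalize besselSeries (-μ) _ = A at *
  generalize besselSeries μ _ = B at *
  generalize exp (-(μ * (x - Real.log 2))) = D at *
  generalize exp (2 * μ * x) * exp (-(2 * μ * Real.log 2)) = E at *
  field_simp at hconn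
  linear_combination (-D / 2) * hconn


/-! ### The integral as a function on the Riemann surface -/

theorem hyperF_symm (a b c w : ℂ) : hyperF a b c w = hyperF b a c w := by
  have h := regularizedGaussHGFun_symm (a := a) (b := b) (c := c)
  unfold hyperF
  rw [h]

theorem integrand_neg_param (T : ℂ → ℂ → ℂ) (N : ℕ) (ν lam ζ : ℂ) :
    integrand T N (-ν) lam ζ = integrand T N ν lam ζ := by
  funext t
  rw [integrand, integrand, neg_neg, hyperF_symm]

/-- Near every point with `|arg z| < 3π/2` the integrand is dominated, uniformly in `z`. -/
theorem exists_nhds_integrand_dominated {ν lam : ℂ} {κ : ℝ} {N : ℕ} (ha : 0 < (ν + 1 / 2).re)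
    (hb : -(-ν + 1 / 2).re ≤ κ) (haκ : 0 < (ν + 1 / 2).re + κ) (hκN : κ < N) (hlam : 0 < lam.re)
    {ζ₀ : ℂ} (hζ₀ : |ζ₀.im| < 3 * Real.pi / 2) :
    ∃ V : Set ℂ, IsOpen V ∧ ζ₀ ∈ V ∧ ∃ bound : ℝ → ℝ, IntegrableOn bound (Ioi 0) ∧
      ∀ ζ ∈ V, ContinuousOn (integrand Lam N ν lam ζ) (Ioi 0) ∧ ∀ t ∈ Ioi (0 : ℝ),
        ‖integrand Lam N ν lam ζ t‖ ≤ bound t ∧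
        DifferentiableAt ℂ (fun ζ => integrand Lam N ν lam ζ t) ζ := by
  have hp : 0 < ((N : ℂ) + lam).re := by rw [add_re, natCast_re]; positivity
  -- a third of `arg z` as the direction of the ray leaves two thirds, less than `π`
  set α : ℝ := ζ₀.im / 3 with hα
  have hαlt : |α| < Real.pi / 2 := by
    rw [hα, abs_div, abs_of_pos (three_pos : (0 : ℝ) < 3)]
    linarith
  have hdist : |ζ₀.im - α| < Real.pi := by
    rw [hα, show ζ₀.im - ζ₀.im / 3 = 2 / 3 * ζ₀.im by ring, abs_mul,
      abs_of_pos (by norm_num : (0 : ℝ) < 2 / 3)]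
    linarith
  set η : ℝ := (|ζ₀.im - α| + Real.pi) / 2 with hη
  have hη0 : 0 ≤ η := by
    have := abs_nonneg (ζ₀.im - α)
    have := Real.pi_pos
    rw [hη]
    linarith
  have hηpi : η < Real.pi := by rw [hη]; linarith
  obtain ⟨C, hC⟩ := norm_rayTerminant_le hp hαlt hη0 hηpi
  obtain ⟨C', hC'0, hC'⟩ := exists_norm_hyperF_neg_le ha hb haκ lam
  have him : ∀ (ζ : ℂ) (t : ℝ), (ζ + (Real.log (2 * (1 + t)) : ℂ)).im = ζ.im := by
    intro ζ t
    simp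
  have hLam : ∀ ζ : ℂ, |ζ.im - α| < η → Lam (N + lam) ζ = rayTerminant (N + lam) α ζ := fun ζ hζ =>
    Lam_eq_rayTerminant hp hαlt (hζ.trans hηpi)
  have hVo : IsOpen {ζ : ℂ | |ζ.im - α| < η} :=
    isOpen_lt ((continuous_im.sub continuous_const).abs) continuous_const
  have hLamd : ∀ ζ : ℂ, |ζ.im - α| < η → DifferentiableAt ℂ (Lam (N + lam)) ζ := by
    intro ζ hζ
    refine (hasDerivAt_rayTerminant hp hαlt (hζ.trans hηpi)).differentiableAt.congr_of_eventuallyEq ?_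
    filter_upwards [hVo.mem_nhds hζ] with ξ hξ using hLam ξ hξ
  refine ⟨{ζ | |ζ.im - α| < η}, hVo, by simp only [mem_ofPred_eq]; linarith,
    fun t => C' * C * (t ^ (lam.re - 1) * (1 + t) ^ (-(N + lam.re - κ))), ?_, ?_⟩
  · exact (integrableOn_rpow_mul_one_add_rpow hlam (by linarith)).const_mul _
  · intro ζ hζ
    refine ⟨?_, fun t ht => ⟨?_, ?_⟩⟩
    · have h1 : ContinuousOn (fun t : ℝ => ((1 + t : ℝ) : ℂ) ^ ((N : ℂ) + lam)) (Ioi 0) :=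
        (continuousOn_ofReal_cpow _).comp (f := fun t : ℝ => 1 + t) (by fun_prop) fun t ht => by
          have ht' : (0 : ℝ) < t := ht
          simp only [mem_Ioi]
          linarith
      refine (((continuousOn_ofReal_cpow _).div h1 fun t ht => ?_).mul
        (continuousOn_hyperF_neg ha hb haκ lam)).mul ?_
      · have ht' : (0 : ℝ) < t := ht
        rw [Ne, cpow_eq_zero_iff]
        rintro ⟨h, -⟩
        have : (1 + t : ℝ) = 0 := by exact_mod_cast h
        linarith
      · intro t ht
        have ht' : (0 : ℝ) < t := ht
        refine ContinuousAt.continuousWithinAt ?_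
        have hlog : ContinuousAt (fun t : ℝ => ζ + (Real.log (2 * (1 + t)) : ℂ)) t := by
          refine continuousAt_const.add (continuous_ofReal.continuousAt.comp ?_)
          exact ContinuousAt.log (by fun_prop) (by positivity)
        have h2 : ContinuousAt (Lam (N + lam)) (ζ + (Real.log (2 * (1 + t)) : ℂ)) :=
          (hLamd _ (by rw [him]; exact hζ)).continuousAt
        exact h2.comp (f := fun t : ℝ => ζ + (Real.log (2 * (1 + t)) : ℂ)) hlog
    · have ht' : (0 : ℝ) < t := ht
      have ht1 : (0 : ℝ) < 1 + t := by linarith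
      have hL : ‖Lam (N + lam) (ζ + (Real.log (2 * (1 + t)) : ℂ))‖ ≤ C := by
        have hζ' : |(ζ + (Real.log (2 * (1 + t)) : ℂ)).im - α| < η := by rw [him]; exact hζ
        rw [hLam _ hζ']
        exact hC _ hζ'.le
      have hre : ((N : ℂ) + lam).re = N + lam.re := by simp
      rw [integrand, norm_mul, norm_mul, norm_div, norm_cpow_eq_rpow_re_of_pos ht',
        norm_cpow_eq_rpow_re_of_pos ht1, hre, sub_re, one_re]
      calc t ^ (lam.re - 1) / (1 + t) ^ (N + lam.re) * ‖hyperF (ν + 1 / 2) (-ν + 1 / 2) lam (-(t : ℂ))‖ *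
            ‖Lam (N + lam) (ζ + (Real.log (2 * (1 + t)) : ℂ))‖
          ≤ t ^ (lam.re - 1) / (1 + t) ^ (N + lam.re) * (C' * (1 + t) ^ κ) * C := by
            gcongr
            exact hC' t ht'
        _ = C' * C * (t ^ (lam.re - 1) * ((1 + t) ^ κ / (1 + t) ^ (N + lam.re))) := by ring
        _ = _ := by
            rw [← Real.rpow_sub ht1, neg_sub]
    · have h2 := hLamd (ζ + (Real.log (2 * (1 + t)) : ℂ)) (by rw [him]; exact hζ)
      exact (h2.comp (f := fun ζ : ℂ => ζ + (Real.log (2 * (1 + t)) : ℂ)) ζ (by fun_prop)).const_mul _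

theorem isOpen_strip (r : ℝ) : IsOpen {ζ : ℂ | |ζ.im| < r} :=
  isOpen_lt continuous_im.abs continuous_const

theorem integrableOn_integrand_Lam {ν lam : ℂ} {κ : ℝ} {N : ℕ} (ha : 0 < (ν + 1 / 2).re)
    (hb : -(-ν + 1 / 2).re ≤ κ) (haκ : 0 < (ν + 1 / 2).re + κ) (hκN : κ < N) (hlam : 0 < lam.re)
    {ζ : ℂ} (hζ : |ζ.im| < 3 * Real.pi / 2) : IntegrableOn (integrand Lam N ν lam ζ) (Ioi 0) := by
  obtain ⟨V, -, hζV, bound, hbi, hV⟩ := exists_nhds_integrand_dominated ha hb haκ hκN hlam hζ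
  refine hbi.mono' ((hV ζ hζV).1.aestronglyMeasurable measurableSet_Ioi) ?_
  filter_upwards [ae_restrict_mem measurableSet_Ioi] with t ht using ((hV ζ hζV).2 t ht).1

theorem differentiableOn_integral_integrand_Lam {ν lam : ℂ} {κ : ℝ} {N : ℕ}
    (ha : 0 < (ν + 1 / 2).re) (hb : -(-ν + 1 / 2).re ≤ κ) (haκ : 0 < (ν + 1 / 2).re + κ)
    (hκN : κ < N) (hlam : 0 < lam.re) :
    DifferentiableOn ℂ (fun ζ => ∫ t : ℝ in Ioi 0, integrand Lam N ν lam ζ t)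
      {ζ | |ζ.im| < 3 * Real.pi / 2} := by
  intro ζ₀ hζ₀
  obtain ⟨V, hVo, hζV, bound, hbi, hV⟩ := exists_nhds_integrand_dominated ha hb haκ hκN hlam hζ₀
  refine DifferentiableAt.differentiableWithinAt ?_
  refine (differentiableOn_integral_of_dominated hVo (bound := bound)
    (fun ζ hζ => (hV ζ hζ).1.aestronglyMeasurable measurableSet_Ioi) hbi ?_ ?_).differentiableAt
    (hVo.mem_nhds hζV)
  · filter_upwards [ae_restrict_mem measurableSet_Ioi] with t ht ζ hζ using ((hV ζ hζ).2 t ht).1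
  · filter_upwards [ae_restrict_mem measurableSet_Ioi] with t ht ζ hζ
    exact ((hV ζ hζ).2 t ht).2.differentiableWithinAt

/-! ### The remainder for the modified Bessel function -/

theorem RK_denom_ne_zero (ζ : ℂ) :
    (Real.sqrt (Real.pi / 2) : ℂ) * exp (-(ζ / 2)) * exp (-exp ζ) ≠ 0 := by
  have h : 0 < Real.sqrt (Real.pi / 2) := Real.sqrt_pos.2 (by positivity)
  exact mul_ne_zero (mul_ne_zero (by exact_mod_cast h.ne') (exp_ne_zero _)) (exp_ne_zero _)

theorem differentiable_RK (N : ℕ) (ν : ℂ) : Differentiable ℂ (RK N ν) := by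
  refine Differentiable.sub ((differentiable_besselK ν).div (by fun_prop) RK_denom_ne_zero) ?_
  refine Differentiable.fun_sum fun n _ => ?_
  exact Differentiable.div (by fun_prop) (by fun_prop) fun ζ => pow_ne_zero _ (exp_ne_zero _)

theorem RK_ofReal {ν : ℂ} (hν : 0 < (ν + 1 / 2).re) (N : ℕ) (x : ℝ) :
    RK N ν x = (2 * Real.exp x : ℂ) ^ (ν + 1 / 2) * exp (Real.exp x) *
      poissonIntegral ν (Real.exp x) / Gamma (ν + 1 / 2) -
      ∑ n ∈ Finset.range N, a n ν / exp x ^ n := by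
  rw [RK]
  congr 1
  have hE : ((Real.exp x : ℝ) : ℂ) ≠ 0 := by exact_mod_cast (Real.exp_pos x).ne'
  have h2E : (2 * (Real.exp x : ℝ) : ℂ) ≠ 0 := mul_ne_zero two_ne_zero hE
  have h1 : ((Real.exp x : ℝ) : ℂ) ^ (2 * ν) = exp (2 * ν * x) := by
    rw [cpow_def_of_ne_zero hE, ← ofReal_log (Real.exp_pos x).le, Real.log_exp, mul_comm]
  have h2 : (2 * (Real.exp x : ℝ) : ℂ) ^ (ν + 1 / 2) =
      exp ((ν + 1 / 2) * (x + Real.log 2)) := by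
    rw [cpow_def_of_ne_zero h2E, ← ofReal_ofNat, ← ofReal_mul, ← ofReal_log (by positivity),
      Real.log_mul two_ne_zero (Real.exp_pos x).ne', Real.log_exp]
    congr 1
    push_cast
    ring
  have hsq : (Real.sqrt Real.pi : ℂ) = exp (1 / 2 * Real.log 2) * Real.sqrt (Real.pi / 2) := by
    have h3 : Real.sqrt Real.pi = Real.exp (1 / 2 * Real.log 2) * Real.sqrt (Real.pi / 2) := by
      rw [mul_comm (1 / 2 : ℝ), ← Real.rpow_def_of_pos two_pos, ← Real.sqrt_eq_rpow,
        ← Real.sqrt_mul zero_le_two]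
      congr 1
      ring
    rw [h3]
    push_cast
    rfl
  have h4 : exp ((ν + 1 / 2) * (x + Real.log 2)) * exp (-(x / 2)) =
      exp (-(ν * (x - Real.log 2))) * exp (2 * ν * x) * exp (1 / 2 * Real.log 2) := by
    rw [← exp_add, ← exp_add, ← exp_add]
    congr 1
    ring
  have h5 : exp ((Real.exp x : ℝ) : ℂ) * exp (-exp (x : ℂ)) = 1 := by
    rw [← exp_add, ofReal_exp, add_neg_cancel, exp_zero]
  rw [besselK_ofReal hν, poissonK, h1, h2, div_eq_iff (RK_denom_ne_zero _), hsq,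
    div_eq_mul_inv _ (Gamma _)]
  generalize exp ((ν + 1 / 2) * (x + Real.log 2)) = A at *
  generalize exp (1 / 2 * Real.log 2 : ℂ) = B at *
  generalize (Gamma (ν + 1 / 2))⁻¹ = G at *
  linear_combination (-(Real.sqrt (Real.pi / 2) : ℂ) * poissonIntegral ν (Real.exp x) * G) * h4 -
    A * exp (-(x / 2)) * (Real.sqrt (Real.pi / 2) : ℂ) * poissonIntegral ν (Real.exp x) * G * h5

theorem frequently_nhdsNE_of_forall_ofReal {P : ℂ → Prop} (h : ∀ x : ℝ, P x) :
    ∃ᶠ z in 𝓝[≠] (0 : ℂ), P z := by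
  have hT : Tendsto (fun x : ℝ => (x : ℂ)) (𝓝[≠] 0) (𝓝[≠] 0) := by
    refine tendsto_nhdsWithin_iff.2
      ⟨(continuous_ofReal.tendsto' 0 0 ofReal_zero).mono_left nhdsWithin_le_nhds, ?_⟩
    filter_upwards [self_mem_nhdsWithin] with x hx
    simpa using hx
  exact hT.frequently (Eventually.of_forall h).frequently

/-- Both sides are holomorphic in `ζ` on the strip and agree on the real axis, which is the ray
`arg z = 0`. -/
theorem RK_eq_of_nonneg_re {N : ℕ} {ν lam : ℂ} (hν0 : 0 ≤ ν.re) (hν : ν.re < N + 1 / 2)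
    (hlam : 0 < lam.re) {ζ : ℂ} (hζ : |ζ.im| < 3 * Real.pi / 2) :
    IntegrableOn (integrand Lam N ν lam ζ) (Ioi 0) ∧
    RK N ν ζ = (-1) ^ N * (cos (Real.pi * ν) / Real.pi) * (Gamma (N + lam) / 2 ^ N) *
      (1 / exp ζ ^ N) * ∫ t in Ioi (0 : ℝ), integrand Lam N ν lam ζ t := by
  have ha : 0 < (ν + 1 / 2).re := by simp; linarith
  set κ : ℝ := max (ν.re - 1 / 2) (-(1 / 4)) with hκ
  have hb : -(-ν + 1 / 2).re ≤ κ := by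
    refine le_trans (le_of_eq ?_) (le_max_left _ _)
    simp
    ring
  have haκ : 0 < (ν + 1 / 2).re + κ := by
    have h1 : -(1 / 4) ≤ κ := le_max_right _ _
    have h2 : (ν + 1 / 2).re = ν.re + 1 / 2 := by simp
    rw [h2]
    linarith
  have hκN : κ < N := max_lt (by linarith) (by linarith [Nat.cast_nonneg (α := ℝ) N])
  have hνN : (ν + 1 / 2).re < N + 1 := by
    have h2 : (ν + 1 / 2).re = ν.re + 1 / 2 := by simp
    rw [h2]
    linarith
  refine ⟨integrableOn_integrand_Lam ha hb haκ hκN hlam hζ, ?_⟩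
  set U := {ζ : ℂ | |ζ.im| < 3 * Real.pi / 2} with hU
  have hUo : IsOpen U := isOpen_strip _
  have hUc : IsPreconnected U := by
    have h : U = im ⁻¹' (Ioo (-(3 * Real.pi / 2)) (3 * Real.pi / 2)) := by
      ext ζ
      simp [hU, abs_lt]
    rw [h]
    exact ((convex_Ioo _ _).is_linear_preimage imCLM.isBoundedLinearMap.toIsLinearMap).isPreconnected
  have h0U : (0 : ℂ) ∈ U := by
    simp only [hU, mem_ofPred_eq, zero_im, abs_zero]
    positivity
  have hL : AnalyticOnNhd ℂ (RK N ν) U := (differentiable_RK N ν).differentiableOn.analyticOnNhd hUo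
  have hR : AnalyticOnNhd ℂ (fun ζ => (-1) ^ N * (cos (Real.pi * ν) / Real.pi) *
      (Gamma (N + lam) / 2 ^ N) * (1 / exp ζ ^ N) *
        ∫ t in Ioi (0 : ℝ), integrand Lam N ν lam ζ t) U := by
    refine DifferentiableOn.analyticOnNhd ?_ hUo
    refine DifferentiableOn.mul ?_ (differentiableOn_integral_integrand_Lam ha hb haκ hκN hlam)
    refine Differentiable.differentiableOn (Differentiable.const_mul ?_ _)
    exact Differentiable.div (by fun_prop) (by fun_prop) fun ζ => pow_ne_zero _ (exp_ne_zero _)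
  refine hL.eqOn_of_preconnected_of_frequently_eq hR hUc h0U
    (frequently_nhdsNE_of_forall_ofReal fun x => ?_) hζ
  rw [RK_ofReal ha, ← rhs_self_eq_poissonIntegral ha hνN,
    ← Gamma_mul_integral_integrand_eq ha hb haκ hκN hlam ha x]
  ring

theorem RK_neg (N : ℕ) (ν ζ : ℂ) : RK N (-ν) ζ = RK N ν ζ := by
  simp only [RK, besselK_neg, a, neg_sq]

/-- The formula for the remainder in the expansion of `K_ν`. -/
theorem RK_eq {N : ℕ} {ν lam : ℂ} (hν : |ν.re| < N + 1 / 2) (hlam : 0 < lam.re) {ζ : ℂ}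
    (hζ : |ζ.im| < 3 * Real.pi / 2) :
    IntegrableOn (integrand Lam N ν lam ζ) (Ioi 0) ∧
    RK N ν ζ = (-1) ^ N * (cos (Real.pi * ν) / Real.pi) * (Gamma (N + lam) / 2 ^ N) *
      (1 / exp ζ ^ N) * ∫ t in Ioi (0 : ℝ), integrand Lam N ν lam ζ t := by
  rcases le_total 0 ν.re with h | h
  · exact RK_eq_of_nonneg_re h (lt_of_abs_lt hν) hlam hζ
  · have h1 := RK_eq_of_nonneg_re (N := N) (ν := -ν) (by simpa using h)
      (by rw [neg_re]; exact neg_lt_of_abs_lt hν |> fun h => by linarith) hlam hζ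
    rwa [integrand_neg_param, RK_neg, mul_neg, cos_neg] at h1


/-! ### The remainders for the Bessel functions -/

theorem exp_add_half_pi_mul_I (ζ : ℂ) : exp (ζ + Real.pi / 2 * I) = I * exp ζ := by
  rw [exp_add, exp_pi_div_two_mul_I, mul_comm]

theorem exp_sub_half_pi_mul_I (ζ : ℂ) : exp (ζ - Real.pi / 2 * I) = -I * exp ζ := by
  rw [sub_eq_add_neg, ← neg_mul, ← neg_div, exp_add, exp_neg_pi_div_two_mul_I, mul_comm]

theorem exp_neg_mul_I_eq_cos_sub (x : ℂ) : exp (-(x * I)) = cos x - sin x * I := by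
  rw [← neg_mul, exp_mul_I, cos_neg, sin_neg, neg_mul, sub_eq_add_neg]

theorem besselI_add_half_pi_mul_I (ν ζ : ℂ) :
    besselI ν (ζ + Real.pi / 2 * I) = exp (ν * (Real.pi / 2 * I)) * besselJ ν ζ := by
  have h : (I * exp ζ / 2) ^ 2 = -(exp ζ / 2) ^ 2 := by
    rw [mul_div_assoc, mul_pow, I_sq, neg_one_mul]
  rw [besselI_eq, besselJ_eq, exp_add_half_pi_mul_I, h, ← mul_assoc, ← exp_add]
  congr 2
  ring

theorem besselI_sub_half_pi_mul_I (ν ζ : ℂ) :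
    besselI ν (ζ - Real.pi / 2 * I) = exp (-(ν * (Real.pi / 2 * I))) * besselJ ν ζ := by
  have h : (-I * exp ζ / 2) ^ 2 = -(exp ζ / 2) ^ 2 := by
    rw [mul_div_assoc, mul_pow, neg_sq, I_sq, neg_one_mul]
  rw [besselI_eq, besselJ_eq, exp_sub_half_pi_mul_I, h, ← mul_assoc, ← exp_add]
  congr 2
  ring

theorem tendsto_exp_mul_besselYQuot (ν ζ c d : ℂ) :
    Tendsto (fun μ => (Real.pi / 2) * exp (μ * c) * (d * besselJ μ ζ - besselYQuot μ ζ)) (𝓝[≠] ν)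
      (𝓝 ((Real.pi / 2) * exp (ν * c) * (d * besselJ ν ζ - besselY ν ζ))) := by
  have h1 : Tendsto (fun μ : ℂ => (Real.pi / 2) * exp (μ * c)) (𝓝[≠] ν)
      (𝓝 ((Real.pi / 2) * exp (ν * c))) :=
    (Continuous.tendsto (by fun_prop) ν).mono_left nhdsWithin_le_nhds
  have h2 : Tendsto (fun μ => besselJ μ ζ) (𝓝[≠] ν) (𝓝 (besselJ ν ζ)) :=
    ((differentiable_besselJ_param ζ).continuous.tendsto ν).mono_left nhdsWithin_le_nhds
  exact h1.mul ((h2.const_mul d).sub (tendsto_besselYQuot ν ζ))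

/-- `K_ν(z e^{-πi/2})` as a Hankel function. -/
theorem besselK_sub_half_pi_mul_I (ν ζ : ℂ) :
    besselK ν (ζ - Real.pi / 2 * I) =
      (Real.pi / 2) * exp (ν * (Real.pi / 2 * I)) * (I * besselJ ν ζ - besselY ν ζ) := by
  refine tendsto_nhds_unique (tendsto_besselKQuot ν _)
    ((tendsto_exp_mul_besselYQuot ν ζ (Real.pi / 2 * I) I).congr' ?_)
  filter_upwards [eventually_sin_pi_mul_ne_zero ν] with μ hμ
  have h : exp (-(μ * (Real.pi / 2 * I))) = exp (μ * (Real.pi / 2 * I)) *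
      (cos (Real.pi * μ) - sin (Real.pi * μ) * I) := by
    rw [← exp_neg_mul_I_eq_cos_sub, ← exp_add]
    congr 1
    ring
  rw [besselKQuot, besselYQuot, besselI_sub_half_pi_mul_I, besselI_sub_half_pi_mul_I, neg_mul,
    neg_neg, h]
  field_simp
  ring

/-- `K_ν(z e^{πi/2})` as a Hankel function. -/
theorem besselK_add_half_pi_mul_I (ν ζ : ℂ) :
    besselK ν (ζ + Real.pi / 2 * I) =
      (Real.pi / 2) * exp (ν * -(Real.pi / 2 * I)) * (-I * besselJ ν ζ - besselY ν ζ) := by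
  refine tendsto_nhds_unique (tendsto_besselKQuot ν _)
    ((tendsto_exp_mul_besselYQuot ν ζ (-(Real.pi / 2 * I)) (-I)).congr' ?_)
  filter_upwards [eventually_sin_pi_mul_ne_zero ν] with μ hμ
  have h : exp (μ * (Real.pi / 2 * I)) = exp (μ * -(Real.pi / 2 * I)) *
      (cos (Real.pi * μ) + sin (Real.pi * μ) * I) := by
    rw [← exp_mul_I, ← exp_add]
    congr 1
    ring
  rw [besselKQuot, besselYQuot, besselI_add_half_pi_mul_I, besselI_add_half_pi_mul_I, h, neg_mul,
    ← mul_neg]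
  field_simp
  ring

theorem sqrt_pi_div_two_eq :
    (Real.sqrt (Real.pi / 2) : ℂ) = Real.pi / 2 * Real.sqrt (2 / Real.pi) := by
  have h : Real.sqrt (Real.pi / 2) = Real.pi / 2 * Real.sqrt (2 / Real.pi) := by
    have hpi := Real.pi_pos
    rw [Real.sqrt_eq_iff_mul_self_eq (by positivity) (by positivity), mul_mul_mul_comm,
      Real.mul_self_sqrt (by positivity)]
    field_simp
  rw [h]
  push_cast
  rfl

/-- Rotating `z` by `-π/2` turns the remainder for `K_ν` into that for Hankel's `P + iQ`. -/
theorem RK_sub_half_pi_mul_I (N : ℕ) (ν ζ : ℂ) :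
    RK N ν (ζ - Real.pi / 2 * I) = hankelP ν ζ + I * hankelQ ν ζ -
      ∑ n ∈ Finset.range N, I ^ n * (a n ν / exp ζ ^ n) := by
  rw [RK]
  congr 1
  · have hexp : exp (ν * (Real.pi / 2 * I)) * I = exp (-(omega ν ζ * I)) *
        (exp (Real.pi / 4 * I) * exp (-(-I * exp ζ))) := by
      nth_rw 2 [← exp_pi_div_two_mul_I]
      rw [← exp_add, ← exp_add, ← exp_add, omega]
      congr 1
      ring
    have hden : exp (-((ζ - Real.pi / 2 * I) / 2)) = exp (-(ζ / 2)) * exp (Real.pi / 4 * I) := by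
      rw [← exp_add]
      congr 1
      ring
    have hne : exp (Real.pi / 4 * I) * exp (-(-I * exp ζ)) ≠ 0 :=
      mul_ne_zero (exp_ne_zero _) (exp_ne_zero _)
    have hamp := amp_ne_zero ζ
    have hPQ : hankelP ν ζ + I * hankelQ ν ζ =
        exp (-(omega ν ζ * I)) * (besselJ ν ζ + I * besselY ν ζ) / amp ζ := by
      rw [hankelP, hankelQ, exp_neg_mul_I_eq_cos_sub]
      field_simp
      linear_combination (besselY ν ζ * sin (omega ν ζ)) * I_sq
    rw [besselK_sub_half_pi_mul_I, exp_sub_half_pi_mul_I, hden, hPQ, sqrt_pi_div_two_eq]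
    rw [show (Real.pi / 2 * Real.sqrt (2 / Real.pi) : ℂ) * (exp (-(ζ / 2)) * exp (Real.pi / 4 * I)) *
      exp (-(-I * exp ζ)) = Real.pi / 2 * amp ζ * (exp (Real.pi / 4 * I) * exp (-(-I * exp ζ))) by
        rw [amp]; ring, div_eq_div_iff (mul_ne_zero (mul_ne_zero (by simp) hamp) hne) hamp]
    generalize exp (Real.pi / 4 * I) * exp (-(-I * exp ζ)) = E at *
    linear_combination (Real.pi / 2 * amp ζ) * (besselJ ν ζ + I * besselY ν ζ) * hexp -
      (Real.pi / 2 * amp ζ) * exp (ν * (Real.pi / 2 * I)) * besselY ν ζ * I_sq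
  · refine Finset.sum_congr rfl fun n _ => ?_
    have h : (I : ℂ) ^ n * (-I) ^ n = 1 := by rw [← mul_pow]; simp
    have h2 : (-I : ℂ) ^ n ≠ 0 := right_ne_zero_of_mul_eq_one h
    have h3 := pow_ne_zero n (exp_ne_zero ζ)
    rw [exp_sub_half_pi_mul_I, mul_pow, div_eq_iff (mul_ne_zero h2 h3)]
    field_simp
    linear_combination (-a n ν) * h

/-- Rotating `z` by `π/2` turns the remainder for `K_ν` into that for Hankel's `P - iQ`. -/
theorem RK_add_half_pi_mul_I (N : ℕ) (ν ζ : ℂ) :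
    RK N ν (ζ + Real.pi / 2 * I) = hankelP ν ζ - I * hankelQ ν ζ -
      ∑ n ∈ Finset.range N, (-I) ^ n * (a n ν / exp ζ ^ n) := by
  rw [RK]
  congr 1
  · have hexp : exp (ν * -(Real.pi / 2 * I)) * -I = exp (omega ν ζ * I) *
        (exp (-(Real.pi / 4 * I)) * exp (-(I * exp ζ))) := by
      rw [← exp_neg_pi_div_two_mul_I, ← exp_add, ← exp_add, ← exp_add, omega]
      congr 1
      ring
    have hden : exp (-((ζ + Real.pi / 2 * I) / 2)) = exp (-(ζ / 2)) * exp (-(Real.pi / 4 * I)) := by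
      rw [← exp_add]
      congr 1
      ring
    have hne : exp (-(Real.pi / 4 * I)) * exp (-(I * exp ζ)) ≠ 0 :=
      mul_ne_zero (exp_ne_zero _) (exp_ne_zero _)
    have hamp := amp_ne_zero ζ
    have hPQ : hankelP ν ζ - I * hankelQ ν ζ =
        exp (omega ν ζ * I) * (besselJ ν ζ - I * besselY ν ζ) / amp ζ := by
      rw [hankelP, hankelQ, exp_mul_I]
      field_simp
      linear_combination (besselY ν ζ * sin (omega ν ζ)) * I_sq
    rw [besselK_add_half_pi_mul_I, exp_add_half_pi_mul_I, hden, hPQ, sqrt_pi_div_two_eq]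
    rw [show (Real.pi / 2 * Real.sqrt (2 / Real.pi) : ℂ) *
      (exp (-(ζ / 2)) * exp (-(Real.pi / 4 * I))) * exp (-(I * exp ζ)) =
        Real.pi / 2 * amp ζ * (exp (-(Real.pi / 4 * I)) * exp (-(I * exp ζ))) by
        rw [amp]; ring, div_eq_div_iff (mul_ne_zero (mul_ne_zero (by simp) hamp) hne) hamp]
    generalize exp (-(Real.pi / 4 * I)) * exp (-(I * exp ζ)) = E at *
    linear_combination (Real.pi / 2 * amp ζ) * (besselJ ν ζ - I * besselY ν ζ) * hexp -
      (Real.pi / 2 * amp ζ) * exp (ν * -(Real.pi / 2 * I)) * besselY ν ζ * I_sq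
  · refine Finset.sum_congr rfl fun n _ => ?_
    have h : (-I : ℂ) ^ n * I ^ n = 1 := by rw [← mul_pow]; simp
    have h2 : (I : ℂ) ^ n ≠ 0 := right_ne_zero_of_mul_eq_one h
    have h3 := pow_ne_zero n (exp_ne_zero ζ)
    rw [exp_add_half_pi_mul_I, mul_pow, div_eq_iff (mul_ne_zero h2 h3)]
    field_simp
    linear_combination (-a n ν) * h

theorem I_pow_two_mul (M : ℕ) : I ^ (2 * M) = (-1) ^ M := by
  rw [pow_mul, I_sq]

theorem neg_I_pow_two_mul (M : ℕ) : (-I) ^ (2 * M) = (-1) ^ M := by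
  rw [pow_mul, neg_sq, I_sq]

theorem sum_range_two_mul_I_pow_add (f : ℕ → ℂ) (M : ℕ) :
    ∑ n ∈ Finset.range (2 * M), I ^ n * f n + ∑ n ∈ Finset.range (2 * M), (-I) ^ n * f n =
      2 * ∑ k ∈ Finset.range M, (-1) ^ k * f (2 * k) := by
  induction M with
  | zero => simp
  | succ M ih =>
    rw [show 2 * (M + 1) = 2 * M + 1 + 1 by ring]
    simp only [Finset.sum_range_succ, pow_succ, I_pow_two_mul, neg_I_pow_two_mul]
    linear_combination ih

theorem sum_range_two_mul_add_one_I_pow_sub (f : ℕ → ℂ) (M : ℕ) :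
    ∑ n ∈ Finset.range (2 * M + 1), I ^ n * f n - ∑ n ∈ Finset.range (2 * M + 1), (-I) ^ n * f n =
      2 * I * ∑ k ∈ Finset.range M, (-1) ^ k * f (2 * k + 1) := by
  induction M with
  | zero => simp
  | succ M ih =>
    rw [show 2 * (M + 1) + 1 = 2 * M + 1 + 1 + 1 by ring]
    rw [Finset.sum_range_succ, Finset.sum_range_succ, Finset.sum_range_succ _ (2 * M + 1 + 1),
      Finset.sum_range_succ _ (2 * M + 1), Finset.sum_range_succ _ M]
    simp only [pow_succ, I_pow_two_mul, neg_I_pow_two_mul]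
    linear_combination ih

theorem RJ_even (M : ℕ) (ν ζ : ℂ) :
    2 * RJ (2 * M) ν ζ =
      RK (2 * M) ν (ζ - Real.pi / 2 * I) + RK (2 * M) ν (ζ + Real.pi / 2 * I) := by
  have h := sum_range_two_mul_I_pow_add (fun n => a n ν / exp ζ ^ n) M
  rw [RJ, if_pos (even_two_mul M), Nat.mul_div_cancel_left M two_pos, RK_sub_half_pi_mul_I,
    RK_add_half_pi_mul_I]
  linear_combination h

theorem RJ_odd (M : ℕ) (ν ζ : ℂ) :
    2 * I * RJ (2 * M + 1) ν ζ =
      RK (2 * M + 1) ν (ζ + Real.pi / 2 * I) - RK (2 * M + 1) ν (ζ - Real.pi / 2 * I) := by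
  have h := sum_range_two_mul_add_one_I_pow_sub (fun n => a n ν / exp ζ ^ n) M
  have hodd : ¬ Even (2 * M + 1) := Nat.not_even_iff_odd.2 (odd_two_mul_add_one M)
  rw [RJ, if_neg hodd, show (2 * M + 1) / 2 = M by omega, RK_sub_half_pi_mul_I,
    RK_add_half_pi_mul_I]
  linear_combination -h

theorem integrand_Pit (N : ℕ) (ν lam ζ : ℂ) (t : ℝ) :
    integrand Pit N ν lam ζ t = 1 / 2 * (integrand Lam N ν lam (ζ + Real.pi / 2 * I) t +
      integrand Lam N ν lam (ζ - Real.pi / 2 * I) t) := by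
  simp only [integrand, Pit, add_right_comm ζ (Real.pi / 2 * I), sub_add_eq_add_sub]
  ring

/-- The formula for the remainders in the expansion of `J_ν` and `Y_ν`. -/
theorem RJ_eq {N : ℕ} {ν lam : ℂ} (hν : |ν.re| < N + 1 / 2) (hlam : 0 < lam.re) {ζ : ℂ}
    (hζ : |ζ.im| < Real.pi) :
    IntegrableOn (integrand Pit N ν lam ζ) (Ioi 0) ∧
    RJ N ν ζ = (-1) ^ (N / 2) * (cos (Real.pi * ν) / Real.pi) * (Gamma (N + lam) / 2 ^ N) *
      (1 / exp ζ ^ N) * ∫ t in Ioi (0 : ℝ), integrand Pit N ν lam ζ t := by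
  have him : (Real.pi / 2 * I : ℂ).im = Real.pi / 2 := by
    rw [← ofReal_ofNat, ← ofReal_div, im_ofReal_mul, I_im, mul_one]
  have hpi := Real.pi_pos
  have hz1 : |(ζ + Real.pi / 2 * I).im| < 3 * Real.pi / 2 := by
    rw [add_im, him, abs_lt]
    constructor <;> linarith [(abs_lt.1 hζ).1, (abs_lt.1 hζ).2]
  have hz2 : |(ζ - Real.pi / 2 * I).im| < 3 * Real.pi / 2 := by
    rw [sub_im, him, abs_lt]
    constructor <;> linarith [(abs_lt.1 hζ).1, (abs_lt.1 hζ).2]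
  obtain ⟨i1, e1⟩ := RK_eq hν hlam hz1
  obtain ⟨i2, e2⟩ := RK_eq hν hlam hz2
  have hfun : integrand Pit N ν lam ζ = fun t => 1 / 2 *
      (integrand Lam N ν lam (ζ + Real.pi / 2 * I) t +
        integrand Lam N ν lam (ζ - Real.pi / 2 * I) t) := funext (integrand_Pit N ν lam ζ)
  refine ⟨by rw [hfun]; exact (i1.add i2).const_mul _, ?_⟩
  rw [hfun, integral_const_mul, integral_add i1 i2]
  generalize ∫ t in Ioi (0 : ℝ), integrand Lam N ν lam (ζ + Real.pi / 2 * I) t = A at *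
  generalize ∫ t in Ioi (0 : ℝ), integrand Lam N ν lam (ζ - Real.pi / 2 * I) t = B at *
  -- `(-1)^N / (± i z)^N = (± i)^N / z^N`
  have p1 : (-1 : ℂ) ^ N * (1 / (I * exp ζ) ^ N) = I ^ N * (1 / exp ζ ^ N) := by
    rw [mul_pow, one_div, mul_inv, ← inv_pow, inv_I, ← mul_assoc, ← mul_pow, neg_one_mul, neg_neg,
      one_div]
  have p2 : (-1 : ℂ) ^ N * (1 / (-I * exp ζ) ^ N) = (-I) ^ N * (1 / exp ζ ^ N) := by
    rw [mul_pow, one_div, mul_inv, ← inv_pow, inv_neg, inv_I, neg_neg, ← mul_assoc, ← mul_pow,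
      neg_one_mul, one_div]
  rw [exp_add_half_pi_mul_I] at e1
  rw [exp_sub_half_pi_mul_I] at e2
  generalize Gamma (N + lam) / 2 ^ N = G at *
  generalize cos (Real.pi * ν) / Real.pi = c at *
  have e1' : RK N ν (ζ + Real.pi / 2 * I) = I ^ N * (1 / exp ζ ^ N) * c * G * A := by
    rw [e1, ← p1]
    ring
  have e2' : RK N ν (ζ - Real.pi / 2 * I) = (-I) ^ N * (1 / exp ζ ^ N) * c * G * B := by
    rw [e2, ← p2]
    ring
  rcases Nat.even_or_odd' N with ⟨M, rfl | rfl⟩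
  · have h := RJ_even M ν ζ
    rw [e1', e2', I_pow_two_mul, neg_I_pow_two_mul] at h
    rw [Nat.mul_div_cancel_left M two_pos]
    linear_combination 1 / 2 * h
  · have h := RJ_odd M ν ζ
    rw [e1', e2', pow_succ I, pow_succ (-I), I_pow_two_mul, neg_I_pow_two_mul] at h
    rw [show (2 * M + 1) / 2 = M by omega]
    refine mul_left_cancel₀ (mul_ne_zero two_ne_zero I_ne_zero) ?_
    linear_combination h

end BesselRemainder

theorem theorem1 (N : ℕ) (ν lam : ℂ) (hν : |ν.re| < (N : ℝ) + 1 / 2) (hlam : 0 < lam.re) :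
    (∀ ζ : ℂ, |ζ.im| < 3 * Real.pi / 2 →
      MeasureTheory.IntegrableOn
        (BesselRemainder.integrand BesselRemainder.Lam N ν lam ζ) (Set.Ioi 0) ∧
      BesselRemainder.RK N ν ζ =
        (-1) ^ N * (Complex.cos (Real.pi * ν) / Real.pi) *
          (Complex.Gamma ((N : ℂ) + lam) / 2 ^ N) * (1 / Complex.exp ζ ^ N) *
          ∫ t in Set.Ioi (0 : ℝ),
            BesselRemainder.integrand BesselRemainder.Lam N ν lam ζ t) ∧
    (∀ ζ : ℂ, |ζ.im| < Real.pi →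
      MeasureTheory.IntegrableOn
        (BesselRemainder.integrand BesselRemainder.Pit N ν lam ζ) (Set.Ioi 0) ∧
      BesselRemainder.RJ N ν ζ =
        (-1) ^ (N / 2) * (Complex.cos (Real.pi * ν) / Real.pi) *
          (Complex.Gamma ((N : ℂ) + lam) / 2 ^ N) * (1 / Complex.exp ζ ^ N) *
          ∫ t in Set.Ioi (0 : ℝ),
            BesselRemainder.integrand BesselRemainder.Pit N ν lam ζ t) :=
  ⟨fun _ hζ => BesselRemainder.RK_eq hν hlam hζ, fun _ hζ => BesselRemainder.RJ_eq hν hlam hζ⟩
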